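/- Let $\Omega\subset\mathbb{R}^3$ be a smooth bounded domain (bounded, open, connected, with $C^\infty$ boundary, lying locally on one side of $\partial\Omega$) and let $T>0$. For $x$ near $\partial\Omega$ let $\sigma(x)\in\partial\Omega$ denote the orthogonal (nearest-point) projection of $x$ to $\partial\Omega$, and let $n$ denote the outer unit normal to $\partial\Omega$. Let $(u,p)$, $u:\Omega\times(0,T)\to\mathbb{R}^3$, $p:\Omega\times(0,T)\to\mathbb{R}$, be a weak solution of the incompressible Euler equations in $\Omega\times(0,T)$, i.e. $u\in L^2_{loc}(\Omega\times(0,T))$, $p\in L^1_{loc}(\Omega\times(0,T))$ and $$\partial_t u+\operatorname{div}(u\otimes u)+\nabla p=0,\qquad \operatorname{div}u=0$$ in the sense of distributions on $\Omega\times(0,T)$. Suppose that: 1. for every compact $K\subset\Omega$, $$\lim_{\epsilon\to0}\int_0^T\int_K\int_{B_\epsilon(0)}\frac{|u(x,t)-u(x-y,t)|^3}{\epsilon^4}\,dy\,dx\,dt=0;$$ 2. $(u,p)$ is bounded near $\partial\Omega$: there are a neighbourhood $\Gamma$ of $\partial\Omega$ and a constant $C$ such that $|u|\le C$ and $|p|\le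 C$ almost everywhere in $(\Gamma\cap\Omega)\times(0,T)$; 3. for almost every $t\in(0,T)$, the function $x\mapsto u(x,t)\cdot n(\sigma(x))$ agrees almost everywhere in $\Omega$ near $\partial\Omega$ with a function that is continuous on the intersection of $\overline\Omega$ with a neighbourhood of $\partial\Omega$ and vanishes on $\partial\Omega$ (that is, $u\cdot n$ is continuous near $\partial\Omega$ and $u\cdot n=0$ on $\partial\Omega$). Then the global energy equality $$\frac{d}{dt}\int_\Omega|u(x,t)|^2\,dx=0$$ holds in the sense of distributions on $(0,T)$: the function $|u|^2$ is integrable on $\Omega\times J$ for every compact $J\subset(0,T)$, and $\int_0^T\psi'(t)\int_\Omega|u(x,t)|^2\,dx\,dt=0$ for every $\psi\in C_c^\infty((0,T))$. -/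

import Mathlib

open MeasureTheory Set Filter Topology
open scoped ContDiff

noncomputable section

namespace EulerBdry

/-- Physical space. -/
abbrev R3 := EuclideanSpace ℝ (Fin 3)

/-- `ρ` is a smooth function with nonzero gradient at `x` which describes `Ω` near `x` as the
sublevel set `{ρ < 0}`. -/
structure IsLocalDefiningFunction (Ω : Set R3) (x : R3) (ρ : R3 → ℝ) : Prop where
  smooth : ContDiff ℝ ∞ ρ
  gradient_ne_zero : gradient ρ x ≠ 0
  mem_iff : ∀ᶠ y in 𝓝 x, (y ∈ Ω ↔ ρ y < 0)

/-- A smooth bounded domain: a bounded, connected, nonempty open set with smooth boundary, lying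
locally on one side of its boundary. -/
structure IsSmoothBoundedDomain (Ω : Set R3) : Prop where
  isOpen : IsOpen Ω
  isConnected : IsConnected Ω
  isBounded : Bornology.IsBounded Ω
  smooth_boundary : ∀ x ∈ frontier Ω, ∃ ρ : R3 → ℝ, IsLocalDefiningFunction Ω x ρ

/-- `ν` is the outer unit normal to `∂Ω` at `x`: the normalized gradient of a local defining
function. By `IsOuterUnitNormal.unique` below, it does not depend on the defining function. -/
def IsOuterUnitNormal (Ω : Set R3) (x ν : R3) : Prop :=
  ∃ ρ : R3 → ℝ, IsLocalDefiningFunction Ω x ρ ∧ ν = ‖gradient ρ x‖⁻¹ • gradient ρ x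

/-- `ρ` is negative just after leaving a zero in a direction of decrease. -/
theorem eventually_neg_of_inner_neg {ρ : R3 → ℝ} {x v : R3} (hρ : DifferentiableAt ℝ ρ x)
    (h0 : ρ x = 0) (hv : inner ℝ (gradient ρ x) v < 0) :
    ∀ᶠ s : ℝ in 𝓝[>] 0, ρ (x + s • v) < 0 := by
  have h1 : HasDerivAt (fun s : ℝ => x + s • v) v 0 := by
    simpa using ((hasDerivAt_id (0 : ℝ)).smul_const v).const_add x
  have h2 : HasFDerivAt ρ (fderiv ℝ ρ x) (x + (0 : ℝ) • v) := by simpa using hρ.hasFDerivAt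
  have h3 : HasDerivAt (fun s : ℝ => ρ (x + s • v)) (fderiv ℝ ρ x v) 0 :=
    h2.comp_hasDerivAt 0 h1
  have h4 : fderiv ℝ ρ x v < 0 := by
    rwa [gradient, InnerProductSpace.toDual_symm_apply] at hv
  have h5 := (hasDerivAt_iff_tendsto_slope.1 h3).eventually (gt_mem_nhds h4)
  have h6 : ∀ᶠ s : ℝ in 𝓝[>] 0, slope (fun s : ℝ => ρ (x + s • v)) 0 s < 0 :=
    h5.filter_mono (nhdsWithin_mono _ fun s hs => ne_of_gt hs)
  filter_upwards [h6, self_mem_nhdsWithin] with s hs hs0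
  have hs0' : (0 : ℝ) < s := hs0
  simp only [slope, vsub_eq_sub, sub_zero, zero_smul, add_zero, h0, smul_eq_mul] at hs
  by_contra hcon
  push Not at hcon
  have : 0 ≤ s⁻¹ * ρ (x + s • v) := by positivity
  linarith

theorem IsLocalDefiningFunction.eq_zero {Ω : Set R3} {x : R3} {ρ : R3 → ℝ}
    (h : IsLocalDefiningFunction Ω x ρ) (hΩ : IsOpen Ω) (hx : x ∈ frontier Ω) : ρ x = 0 := by
  have hxΩ : x ∉ Ω := by
    rw [hΩ.frontier_eq] at hx
    exact hx.2
  apply le_antisymm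
  · by_contra hcon
    push Not at hcon
    have h1 : ∀ᶠ y in 𝓝 x, 0 < ρ y := h.smooth.continuous.continuousAt.eventually (lt_mem_nhds hcon)
    have h2 := mem_closure_iff_frequently.1 hx.1
    obtain ⟨y, hy, hy1, hy2⟩ := (h2.and_eventually (h1.and h.mem_iff)).exists
    exact absurd (hy2.1 hy) (not_lt.2 hy1.le)
  · exact not_lt.1 fun hlt => hxΩ (h.mem_iff.self_of_nhds.2 hlt)

theorem IsOuterUnitNormal.unique {Ω : Set R3} {x ν₁ ν₂ : R3} (hΩ : IsOpen Ω)
    (hx : x ∈ frontier Ω) (h₁ : IsOuterUnitNormal Ω x ν₁) (h₂ : IsOuterUnitNormal Ω x ν₂) :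
    ν₁ = ν₂ := by
  obtain ⟨ρ₁, hρ₁, rfl⟩ := h₁
  obtain ⟨ρ₂, hρ₂, rfl⟩ := h₂
  by_contra hne
  set a := gradient ρ₁ x with ha
  set b := gradient ρ₂ x with hb
  have ha0 : 0 < ‖a‖ := norm_pos_iff.2 hρ₁.gradient_ne_zero
  have hb0 : 0 < ‖b‖ := norm_pos_iff.2 hρ₂.gradient_ne_zero
  have hna : ‖‖a‖⁻¹ • a‖ = 1 := by rw [norm_smul, norm_inv, norm_norm, inv_mul_cancel₀ ha0.ne']
  have hnb : ‖‖b‖⁻¹ • b‖ = 1 := by rw [norm_smul, norm_inv, norm_norm, inv_mul_cancel₀ hb0.ne']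
  set e := ‖a‖⁻¹ • a with he
  set f := ‖b‖⁻¹ • b with hf
  have hef : inner ℝ e f < 1 := (inner_lt_one_iff_real_of_norm_eq_one hna hnb).2 hne
  have hae : a = ‖a‖ • e := by rw [he, smul_inv_smul₀ ha0.ne']
  have hbf : b = ‖b‖ • f := by rw [hf, smul_inv_smul₀ hb0.ne']
  have hav : inner ℝ a (f - e) < 0 := by
    rw [hae, real_inner_smul_left, inner_sub_right, real_inner_self_eq_norm_sq, hna]
    nlinarith
  have hbv : inner ℝ b (e - f) < 0 := by
    rw [hbf, real_inner_smul_left, inner_sub_right, real_inner_self_eq_norm_sq, hnb,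
      real_inner_comm]
    nlinarith
  have hd₁ : DifferentiableAt ℝ ρ₁ x := (hρ₁.smooth.differentiable (by simp)).differentiableAt
  have hd₂ : DifferentiableAt ℝ ρ₂ x := (hρ₂.smooth.differentiable (by simp)).differentiableAt
  have h1 := eventually_neg_of_inner_neg hd₁ (hρ₁.eq_zero hΩ hx) hav
  have hg : gradient (fun y => -ρ₂ y) x = -b := by
    rw [hb, gradient, gradient, fderiv_fun_neg, map_neg]
  have h2 := eventually_neg_of_inner_neg (ρ := fun y => -ρ₂ y) (x := x) (v := f - e)
    hd₂.neg (by simp [hρ₂.eq_zero hΩ hx])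
    (by rw [hg, inner_neg_left, ← inner_neg_right, neg_sub]; exact hbv)
  have hc : Tendsto (fun s : ℝ => x + s • (f - e)) (𝓝[>] 0) (𝓝 x) := by
    have : Continuous fun s : ℝ => x + s • (f - e) := by fun_prop
    simpa using (this.tendsto 0).mono_left nhdsWithin_le_nhds
  obtain ⟨s, hs1, hs2, hs3, hs4⟩ :=
    (h1.and (h2.and ((hc.eventually hρ₁.mem_iff).and (hc.eventually hρ₂.mem_iff)))).exists
  have := hs4.1 (hs3.2 hs1)
  linarith

/-- The outer unit normal `n(x)` to `∂Ω` at `x ∈ ∂Ω`. -/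
def outerUnitNormal (Ω : Set R3) (x : R3) : R3 :=
  Classical.epsilon (IsOuterUnitNormal Ω x)

/-- The orthogonal projection `σ(x)` of `x` to `∂Ω`: the point of `∂Ω` nearest to `x`. For a smooth
bounded domain it is unique when `x` is close enough to `∂Ω`; otherwise one nearest point is
chosen. -/
def boundaryProj (Ω : Set R3) (x : R3) : R3 :=
  Classical.epsilon fun z => z ∈ frontier Ω ∧ dist x z = Metric.infDist x (frontier Ω)

/-- The spatial divergence of a time-dependent vector field at `z = (x, t)`. -/
def divx (φ : R3 × ℝ → R3) (z : R3 × ℝ) : ℝ :=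
  ∑ i : Fin 3, (fderiv ℝ φ z (EuclideanSpace.single i 1, 0)) i

/-- `(u, p)` is a weak (distributional) solution on `Ω × (0, T)` of
`∂ₜ u + div (u ⊗ u) + ∇p = 0`, `div u = 0`; the integrability required is the one that gives
meaning to the weak formulation. Here `fderiv ℝ φ z (0, 1)` is `∂ₜφ` and `fderiv ℝ φ z (u z, 0)`
is `(u · ∇)φ`, so that its inner product with `u` is `(u ⊗ u) : ∇φ`. -/
structure IsWeakEulerSolution (Ω : Set R3) (T : ℝ) (u : R3 × ℝ → R3) (p : R3 × ℝ → ℝ) :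
    Prop where
  memLp_velocity : ∀ K : Set (R3 × ℝ), IsCompact K → K ⊆ Ω ×ˢ Ioo 0 T →
    MemLp u 2 (volume.restrict K)
  integrable_pressure : ∀ K : Set (R3 × ℝ), IsCompact K → K ⊆ Ω ×ˢ Ioo 0 T →
    IntegrableOn p K
  momentum : ∀ φ : R3 × ℝ → R3, ContDiff ℝ ∞ φ → HasCompactSupport φ →
    tsupport φ ⊆ Ω ×ˢ Ioo 0 T →
    ∫ z in Ω ×ˢ Ioo 0 T, (inner ℝ (u z) (fderiv ℝ φ z (0, 1))
      + inner ℝ (u z) (fderiv ℝ φ z (u z, 0)) + p z * divx φ z) = 0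
  divergence_free : ∀ ψ : R3 × ℝ → ℝ, ContDiff ℝ ∞ ψ → HasCompactSupport ψ →
    tsupport ψ ⊆ Ω ×ˢ Ioo 0 T →
    ∫ z in Ω ×ˢ Ioo 0 T, fderiv ℝ ψ z (u z, 0) = 0

/-- The Besov-type condition with exponent `1/3`, locally in `Ω`. For `ε < dist(K, ∂Ω)` only values
of `u` in `Ω` enter. -/
def LocalBesovVMO (Ω : Set R3) (T : ℝ) (u : R3 × ℝ → R3) : Prop :=
  ∀ K : Set R3, IsCompact K → K ⊆ Ω →
    Tendsto (fun ε : ℝ => ∫⁻ t in Ioo 0 T, ∫⁻ x in K, ∫⁻ y in Metric.ball (0 : R3) ε,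
      ENNReal.ofReal (‖u (x, t) - u (x - y, t)‖ ^ 3 / ε ^ 4)) (𝓝[>] 0) (𝓝 0)

/-- `(u, p)` is (essentially) bounded in some neighbourhood of `∂Ω`. -/
def BoundedNearBoundary (Ω : Set R3) (T : ℝ) (u : R3 × ℝ → R3) (p : R3 × ℝ → ℝ) : Prop :=
  ∃ Γ : Set R3, IsOpen Γ ∧ frontier Ω ⊆ Γ ∧ ∃ C : ℝ,
    ∀ᵐ z ∂(volume.restrict ((Γ ∩ Ω) ×ˢ Ioo 0 T)), ‖u z‖ ≤ C ∧ |p z| ≤ C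

/-- For almost every time, `x ↦ u(x, t) · n(σ(x))` is continuous in a neighbourhood of `∂Ω`
(relative to the closed domain) and vanishes on `∂Ω`. Since `u` is defined almost everywhere in `Ω`,
this is said of a representative `g` of this function. -/
def NormalComponentContinuousAndZero (Ω : Set R3) (T : ℝ) (u : R3 × ℝ → R3) : Prop :=
  ∀ᵐ t ∂(volume.restrict (Ioo 0 T)), ∃ Γ : Set R3, IsOpen Γ ∧ frontier Ω ⊆ Γ ∧
    ∃ g : R3 → ℝ,
      (∀ᵐ x ∂(volume.restrict (Γ ∩ Ω)),
        g x = inner ℝ (u (x, t)) (outerUnitNormal Ω (boundaryProj Ω x))) ∧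
      ContinuousOn g (Γ ∩ closure Ω) ∧
      ∀ x ∈ frontier Ω, g x = 0

/-- The energy `t ↦ ∫_Ω |u(x, t)|² dx` is locally integrable on `(0, T)` and its distributional
derivative is zero. -/
def GlobalEnergyEquality (Ω : Set R3) (T : ℝ) (u : R3 × ℝ → R3) : Prop :=
  (∀ J : Set ℝ, IsCompact J → J ⊆ Ioo 0 T → IntegrableOn (fun z => ‖u z‖ ^ 2) (Ω ×ˢ J)) ∧
  ∀ ψ : ℝ → ℝ, ContDiff ℝ ∞ ψ → HasCompactSupport ψ → tsupport ψ ⊆ Ioo 0 T →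
    ∫ t in Ioo 0 T, deriv ψ t * (∫ x in Ω, ‖u (x, t)‖ ^ 2) = 0

end EulerBdry

end

/-!
# Global energy equality for bounded Euler flows with Besov regularity inside the domain

Inside the domain the argument is that of Duchon and Robert. Testing the momentum equation with
`ζ (k * u)` and with `k * (ζ u)`, for a symmetric space-time mollifier `k`, gives the energy balance
of the mollified velocity up to the cubic defect `∫ ζ D_k(u)`
(`IsLocalSolution.regularized_energy`). If the mollification in time is much finer than the one in
space, the defect is controlled by the spatial increments of order `ε`, divided by `ε ^ 4`, which
tend to zero by the Besov condition (`exists_tendsto_defect`). The passage to the limit in the other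
terms is simple when `∇ζ` is supported where `(u, p)` is bounded
(`IsLocalSolution.energy_of_tendsto_defect`). This uses `u ∈ L³_loc`, whereas a weak solution is
only in `L²_loc`. The missing integrability is obtained in `IsLocalSolution.lintegral_cube_lt_top`: the
mollification of `u` in space alone is locally bounded, since by the momentum equation its time
derivative is integrable in time, and the difference from `u` is bounded by the increments in the
Besov condition, which are finite for a small `ε`.

The cutoffs in space are functions of the distance `d` to the boundary: `boundaryCutoff Ω δ` rises
from `0` to `1` in the layer `{d < δ}`. They are merely Lipschitz, and are approximated by smooth
functions with bounded and almost everywhere convergent gradients (`exists_smooth_approx`). The only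
term which has to be estimated as `δ → 0` is the flux `∫ ψ (|u|² + 2p) u · ∇χ_δ`. At every point of
differentiability in `Ω` the gradient of `d` is `-n ∘ σ`
(`IsSmoothBoundedDomain.fderiv_infDist`), so the integrand is at most a constant times
`δ⁻¹ |u · n(σ)|` in the layer. The layer has volume `O(δ)`
(`IsSmoothBoundedDomain.exists_volume_layer_le`), and at almost every time `u · n(σ)` is uniformly
small in thin layers, because it is continuous up to the compact boundary and vanishes there. By
dominated convergence in time the flux tends to zero (`tendsto_normal_flux`), and the energy
equality remains.
-/

noncomputable section

namespace EulerBdry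

set_option linter.unusedSectionVars false

/-! ### Mollification -/

section Mollification

variable {G : Type*} [NormedAddCommGroup G] [NormedSpace ℝ G] [FiniteDimensional ℝ G]
  [MeasureSpace G] [BorelSpace G] [(volume : Measure G).IsAddHaarMeasure]
  {F : Type*} [NormedAddCommGroup F] [InnerProductSpace ℝ F] [CompleteSpace F]

/-- The convolution `k * f` of a scalar kernel with a vector-valued function. -/
def mol (k : G → ℝ) (f : G → F) (z : G) : F := ∫ w, k (z - w) • f w

theorem mol_eq_convolution (k : G → ℝ) (f : G → F) :
    mol k f = convolution k f (ContinuousLinearMap.lsmul ℝ ℝ) volume := by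
  funext z
  rw [convolution_eq_swap]
  rfl

theorem contDiff_mol {k : G → ℝ} (hk : ContDiff ℝ ∞ k) (hks : HasCompactSupport k) {f : G → F}
    (hf : Integrable f) : ContDiff ℝ ∞ (mol k f) := by
  rw [mol_eq_convolution]
  exact hks.contDiff_convolution_left _ hk hf.locallyIntegrable

theorem fderiv_mol {k : G → ℝ} (hk : ContDiff ℝ ∞ k) (hks : HasCompactSupport k) {f : G → F}
    (hf : Integrable f) (z e : G) :
    fderiv ℝ (mol k f) z e = mol (fun h => fderiv ℝ k h e) f z := by
  have h1 : ContDiff ℝ 1 k := hk.of_le (by simp)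
  have h := hks.hasFDerivAt_convolution_left (ContinuousLinearMap.lsmul ℝ ℝ : ℝ →L[ℝ] F →L[ℝ] F)
    h1 hf.locallyIntegrable z
  rw [mol_eq_convolution, h.fderiv, convolution_eq_swap]
  have hcs : HasCompactSupport (fderiv ℝ k) := hks.fderiv ℝ
  have hex : ConvolutionExistsAt (fderiv ℝ k) f z
      ((ContinuousLinearMap.lsmul ℝ ℝ : ℝ →L[ℝ] F →L[ℝ] F).precompL G) volume :=
    hcs.convolutionExists_left _ (h1.continuous_fderiv (by simp)) hf.locallyIntegrable z
  rw [ContinuousLinearMap.integral_apply hex.integrable_swap]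
  rfl

theorem integrable_mol_integrand {k : G → ℝ} (hk : Continuous k) (hks : HasCompactSupport k)
    {f : G → F} (hf : Integrable f) (z : G) : Integrable (fun w => k (z - w) • f w) := by
  obtain ⟨C, hC⟩ := hks.exists_bound_of_continuous hk
  exact Integrable.bdd_smul hf C
    (by fun_prop : Continuous fun w => k (z - w)).aestronglyMeasurable
    (Eventually.of_forall fun w => hC _)

theorem norm_mol_le {k : G → ℝ} {C : ℝ} (hC : ∀ h, |k h| ≤ C) {f : G → F}
    (hf : Integrable f) (z : G) : ‖mol k f z‖ ≤ C * ∫ w, ‖f w‖ := by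
  rw [← integral_const_mul]
  refine norm_integral_le_of_norm_le (hf.norm.const_mul C) (Eventually.of_forall fun w => ?_)
  rw [norm_smul]
  exact mul_le_mul_of_nonneg_right (hC _) (norm_nonneg _)

theorem tsupport_mol_subset {k : G → ℝ} {r : ℝ} (hk : tsupport k ⊆ Metric.closedBall 0 r)
    {f : G → F} {A : Set G} (hf : ∀ z, z ∉ A → f z = 0) :
    tsupport (mol k f) ⊆ Metric.cthickening r A := by
  refine closure_minimal (fun z hz => ?_) Metric.isClosed_cthickening
  by_contra hcon
  apply hz
  unfold mol
  refine integral_eq_zero_of_ae (Eventually.of_forall fun w => ?_)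
  by_cases hw : w ∈ A
  · have : k (z - w) = 0 := by
      by_contra h
      have := hk (subset_tsupport _ h)
      apply hcon
      refine Metric.mem_cthickening_of_dist_le z w r A hw ?_
      simpa [dist_eq_norm] using this
    simp [this]
  · simp [hf w hw]

theorem mol_congr {k : G → ℝ} {r : ℝ} (hk : tsupport k ⊆ Metric.closedBall 0 r)
    {f g : G → F} {z : G} (h : ∀ w ∈ Metric.closedBall z r, f w = g w) : mol k f z = mol k g z := by
  unfold mol
  congr 1
  funext w
  by_cases hw : w ∈ Metric.closedBall z r
  · rw [h w hw]
  · have : k (z - w) = 0 := by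
      by_contra h
      have := hk (subset_tsupport _ h)
      apply hw
      simpa [dist_eq_norm, norm_sub_rev] using this
    simp [this]

/-- The kernel can be moved from one factor of an `L²`-type pairing to the other, by reflecting
it. -/
theorem integral_inner_mol {k : G → ℝ} (hk : Continuous k) (hks : HasCompactSupport k)
    {f g : G → F} (hf : Integrable f) (hg : Integrable g) :
    ∫ z, inner ℝ (f z) (mol k g z) = ∫ z, inner ℝ (mol (fun h => k (-h)) f z) (g z) := by
  obtain ⟨C, hC⟩ := hks.exists_bound_of_continuous hk
  have hk' : HasCompactSupport fun h => k (-h) := hks.comp_homeomorph (Homeomorph.neg G)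
  have hI : Integrable (Function.uncurry fun z w => k (z - w) * inner ℝ (f z) (g w))
      (volume.prod volume) := by
    have hfg : Integrable (fun p : G × G => inner ℝ (f p.1) (g p.2)) (volume.prod volume) := by
      refine Integrable.mono' (hf.norm.mul_prod hg.norm) ?_ (Eventually.of_forall fun p => ?_)
      · exact (hf.aestronglyMeasurable.comp_fst).inner (hg.aestronglyMeasurable.comp_snd)
      · exact norm_inner_le_norm _ _
    refine Integrable.bdd_mul (c := C) hfg ?_ (Eventually.of_forall fun p => hC _)
    exact (by fun_prop : Continuous fun p : G × G => k (p.1 - p.2)).aestronglyMeasurable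
  have h1 : ∀ z, inner ℝ (f z) (mol k g z) = ∫ w, k (z - w) * inner ℝ (f z) (g w) := by
    intro z
    rw [mol, ← integral_inner (integrable_mol_integrand hk hks hg z)]
    simp only [inner_smul_right]
  have h2 : ∀ w, inner ℝ (mol (fun h => k (-h)) f w) (g w)
      = ∫ z, k (z - w) * inner ℝ (f z) (g w) := by
    intro w
    rw [real_inner_comm, mol,
      ← integral_inner (integrable_mol_integrand (by fun_prop) hk' hf w)]
    simp only [inner_smul_right, neg_sub, real_inner_comm]
  simp only [h1, h2]
  exact integral_integral_swap hI

theorem mol_neg_kernel (k : G → ℝ) (f : G → F) (z : G) :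
    mol (fun h => -k h) f z = -mol k f z := by
  simp [mol, integral_neg]

end Mollification

/-! ### The regularized energy identity -/

instance isAddHaarMeasure_volume_spaceTime :
    (volume : Measure (R3 × ℝ)).IsAddHaarMeasure :=
  inferInstanceAs ((volume : Measure R3).prod (volume : Measure ℝ)).IsAddHaarMeasure

/-- The `i`-th spatial unit vector in space-time. -/
def dir (i : Fin 3) : R3 × ℝ := (EuclideanSpace.single i 1, 0)

/-- The derivative of `f` in the fixed direction `e`. -/
def pd {G F : Type*} [NormedAddCommGroup G] [NormedSpace ℝ G] [NormedAddCommGroup F]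
    [NormedSpace ℝ F] (e : G) (f : G → F) : G → F := fun z => fderiv ℝ f z e

/-- `(V, P)` is globally integrable on space-time and solves the Euler equations weakly in `S`. It
arises from a weak solution by truncation to the bounded set `S`. -/
structure IsLocalSolution (S : Set (R3 × ℝ)) (V : R3 × ℝ → R3) (P : R3 × ℝ → ℝ) : Prop where
  integrable_velocity : Integrable V
  memLp_velocity : MemLp V 2
  integrable_pressure : Integrable P
  momentum : ∀ φ : R3 × ℝ → R3, ContDiff ℝ ∞ φ → HasCompactSupport φ → tsupport φ ⊆ S →
    ∫ z, (inner ℝ (V z) (fderiv ℝ φ z (0, 1)) + inner ℝ (V z) (fderiv ℝ φ z (V z, 0))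
      + P z * divx φ z) = 0
  divergence_free : ∀ ψ : R3 × ℝ → ℝ, ContDiff ℝ ∞ ψ → HasCompactSupport ψ → tsupport ψ ⊆ S →
    ∫ z, fderiv ℝ ψ z (V z, 0) = 0

theorem spatial_eq_sum (v : R3) : ((v, 0) : R3 × ℝ) = ∑ i, v i • dir i := by
  ext j
  · simp [dir, Prod.fst_sum, Finset.sum_apply, Pi.single_apply]
  · simp [dir, Prod.snd_sum]

theorem fderiv_spatial {F : Type*} [NormedAddCommGroup F] [NormedSpace ℝ F] (φ : R3 × ℝ → F)
    (z : R3 × ℝ) (v : R3) : fderiv ℝ φ z (v, 0) = ∑ i, v i • pd (dir i) φ z := by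
  rw [spatial_eq_sum, map_sum]
  simp [pd]

section pd
variable {G : Type*} [NormedAddCommGroup G] [NormedSpace ℝ G]
    {F : Type*} [NormedAddCommGroup F] [NormedSpace ℝ F]

theorem contDiff_pd {f : G → F} (hf : ContDiff ℝ ∞ f) (e : G) : ContDiff ℝ ∞ (pd e f) := by
  have : ContDiff ℝ ∞ (fderiv ℝ f) := hf.fderiv_right (by simp)
  exact this.clm_apply contDiff_const

theorem tsupport_pd_subset (f : G → F) (e : G) : tsupport (pd e f) ⊆ tsupport f :=
  tsupport_fderiv_apply_subset ℝ e

theorem hasCompactSupport_pd {f : G → F} (hf : HasCompactSupport f) (e : G) :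
    HasCompactSupport (pd e f) := hf.of_isClosed_subset (isClosed_tsupport _)
      (tsupport_pd_subset f e)

theorem pd_smul {ζ : G → ℝ} {f : G → F} (hζ : ContDiff ℝ ∞ ζ) (hf : ContDiff ℝ ∞ f) (e z : G) :
    pd e (fun z => ζ z • f z) z = pd e ζ z • f z + ζ z • pd e f z := by
  have h1 := (hζ.differentiable (by simp)).differentiableAt (x := z)
  have h2 := (hf.differentiable (by simp)).differentiableAt (x := z)
  simp [pd, fderiv_fun_smul h1 h2]
  abel

theorem pd_reflect {k : G → ℝ} (hk : ContDiff ℝ ∞ k) (e z w : G) :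
    pd e (fun w => k (z - w)) w = -pd e k (z - w) := by
  have h1 := (hk.differentiable (by simp)).differentiableAt (x := z - w)
  have h2 : HasFDerivAt (fun w => z - w) (-ContinuousLinearMap.id ℝ G) w := by
    simpa using (hasFDerivAt_id w).const_sub z
  have := h1.hasFDerivAt.comp w h2
  have h3 := this.fderiv
  simp only [pd]
  change fderiv ℝ (k ∘ fun w => z - w) w e = _
  rw [h3]
  simp

theorem pd_neg_of_even {k : G → ℝ} (hk : ContDiff ℝ ∞ k) (heven : ∀ h, k (-h) = k h) (e h : G) :
    pd e k (-h) = -pd e k h := by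
  have h1 := pd_reflect hk e 0 h
  have h2 : (fun x => k (0 - x)) = k := funext fun x => by rw [zero_sub, heven]
  rw [h2, zero_sub] at h1
  rw [h1, neg_neg]

end pd

section Mollification
variable {G : Type*} [NormedAddCommGroup G] [NormedSpace ℝ G] [FiniteDimensional ℝ G]
  [MeasureSpace G] [BorelSpace G] [(volume : Measure G).IsAddHaarMeasure]
  {F : Type*} [NormedAddCommGroup F] [InnerProductSpace ℝ F] [CompleteSpace F]

theorem pd_mol {k : G → ℝ} (hk : ContDiff ℝ ∞ k) (hks : HasCompactSupport k) {f : G → F}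
    (hf : Integrable f) (e z : G) : pd e (mol k f) z = mol (pd e k) f z :=
  fderiv_mol hk hks hf z e

theorem mol_apply {k : G → ℝ} (hk : Continuous k) (hks : HasCompactSupport k) {f : G → R3}
    (hf : Integrable f) (z : G) (i : Fin 3) : mol k f z i = mol k (fun w => f w i) z := by
  have := ContinuousLinearMap.integral_comp_comm (EuclideanSpace.proj i : R3 →L[ℝ] ℝ)
    (integrable_mol_integrand hk hks hf z)
  simpa [mol] using this.symm

theorem integrable_inner_mol {k : G → ℝ} (hk : ContDiff ℝ ∞ k) (hks : HasCompactSupport k)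
    {f g : G → F} (hf : Integrable f) (hg : Integrable g) :
    Integrable (fun z => inner ℝ (f z) (mol k g z)) := by
  obtain ⟨C, hC⟩ := hks.exists_bound_of_continuous hk.continuous
  refine Integrable.mono' (hf.norm.mul_const (C * ∫ w, ‖g w‖))
    (hf.aestronglyMeasurable.inner (contDiff_mol hk hks hg).continuous.aestronglyMeasurable)
    (Eventually.of_forall fun z => (norm_inner_le_norm _ _).trans ?_)
  exact mul_le_mul_of_nonneg_left (norm_mol_le hC hg z) (norm_nonneg _)

theorem integrable_mul_mol {k : G → ℝ} (hk : ContDiff ℝ ∞ k) (hks : HasCompactSupport k)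
    {f g : G → ℝ} (hf : Integrable f) (hg : Integrable g) :
    Integrable (fun z => f z * mol k g z) := by
  simpa [mul_comm] using integrable_inner_mol hk hks hf hg

theorem integrable_cc_mul {ζ : G → ℝ} (hζ : Continuous ζ) (hζs : HasCompactSupport ζ)
    {f : G → F} (hf : Integrable f) : Integrable (fun z => ζ z • f z) := by
  obtain ⟨C, hC⟩ := hζs.exists_bound_of_continuous hζ
  exact Integrable.bdd_smul hf C hζ.aestronglyMeasurable (Eventually.of_forall fun w => hC _)

theorem integral_kernel_pd {k : G → ℝ} (hk : ContDiff ℝ ∞ k) (hks : HasCompactSupport k)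
    (e z : G) : ∫ w, pd e k (z - w) = 0 := by
  rw [integral_sub_left_eq_self (pd e k) volume z]
  have hi : Integrable (pd e k) := (contDiff_pd hk e).continuous.integrable_of_hasCompactSupport
    (hasCompactSupport_pd hks e)
  have := integral_mul_fderiv_eq_neg_fderiv_mul_of_integrable (μ := (volume : Measure G))
    (f := fun _ : G => (1 : ℝ)) (g := k) (v := e) (by simp)
    (by simp only [one_mul]; exact hi)
    (by simpa using hk.continuous.integrable_of_hasCompactSupport hks)
    (fun x _ => by fun_prop)
    (fun x _ => (hk.differentiable (by simp)).differentiableAt)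
  simpa [pd] using this

theorem integral_mul_pd {f g : G → ℝ} (hf : ContDiff ℝ ∞ f) (hfs : HasCompactSupport f)
    (hg : ContDiff ℝ ∞ g) (e : G) : ∫ z, f z * pd e g z = -∫ z, pd e f z * g z := by
  refine integral_mul_fderiv_eq_neg_fderiv_mul_of_integrable ?_ ?_ ?_
    (fun x _ => (hf.differentiable (by simp)).differentiableAt)
    (fun x _ => (hg.differentiable (by simp)).differentiableAt)
  · exact ((contDiff_pd hf e).continuous.mul hg.continuous).integrable_of_hasCompactSupport
      (hasCompactSupport_pd hfs e).mul_right
  · exact (hf.continuous.mul (contDiff_pd hg e).continuous).integrable_of_hasCompactSupport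
      hfs.mul_right
  · exact (hf.continuous.mul hg.continuous).integrable_of_hasCompactSupport hfs.mul_right

end Mollification

/-- The spatial derivative of `ζ` in the direction `V`. -/
def advect (V : R3 × ℝ → R3) (ζ : R3 × ℝ → ℝ) (z : R3 × ℝ) : ℝ := ∑ i, pd (dir i) ζ z * V z i

theorem fderiv_eq_advect (V : R3 × ℝ → R3) (ζ : R3 × ℝ → ℝ) (z : R3 × ℝ) :
    fderiv ℝ ζ z (V z, 0) = advect V ζ z := by
  rw [fderiv_spatial]
  simp [advect, mul_comm]

/-- The defect density of Duchon and Robert for the kernel `k`. -/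
def defect (k : R3 × ℝ → ℝ) (V : R3 × ℝ → R3) (z : R3 × ℝ) : ℝ :=
  ∫ w, (∑ i, (V z i - V w i) * pd (dir i) k (z - w)) * ‖V z - V w‖ ^ 2

theorem integrable_coord {V : R3 × ℝ → R3} (hV : Integrable V) (i : Fin 3) :
    Integrable (fun z => V z i) :=
  (EuclideanSpace.proj i : R3 →L[ℝ] ℝ).integrable_comp hV

theorem abs_coord_le (v : R3) (i : Fin 3) : |v i| ≤ ‖v‖ := by
  simpa using PiLp.norm_apply_le v i

theorem aestronglyMeasurable_coord {V : R3 × ℝ → R3} (hV : AEStronglyMeasurable V) (i : Fin 3) :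
    AEStronglyMeasurable (fun z => V z i) :=
  (EuclideanSpace.proj i : R3 →L[ℝ] ℝ).continuous.comp_aestronglyMeasurable hV

/-- `f` is integrable with integral `I`. -/
def HasInt {G : Type*} [MeasureSpace G] (f : G → ℝ) (I : ℝ) : Prop :=
  Integrable f ∧ ∫ x, f x = I

namespace HasInt
variable {G : Type*} [MeasureSpace G] {f g : G → ℝ} {I J : ℝ}

theorem of_integrable (hf : Integrable f) : HasInt f (∫ x, f x) := ⟨hf, rfl⟩

theorem add (hf : HasInt f I) (hg : HasInt g J) : HasInt (fun x => f x + g x) (I + J) :=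
  ⟨hf.1.add hg.1, by rw [integral_add hf.1 hg.1, hf.2, hg.2]⟩

theorem sub (hf : HasInt f I) (hg : HasInt g J) : HasInt (fun x => f x - g x) (I - J) :=
  ⟨hf.1.sub hg.1, by rw [integral_sub hf.1 hg.1, hf.2, hg.2]⟩

theorem const_mul (c : ℝ) (hf : HasInt f I) : HasInt (fun x => c * f x) (c * I) :=
  ⟨hf.1.const_mul c, by rw [integral_const_mul, hf.2]⟩

theorem neg (hf : HasInt f I) : HasInt (fun x => -f x) (-I) :=
  ⟨hf.1.neg, by rw [integral_neg, hf.2]⟩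

theorem sum {f : Fin 3 → G → ℝ} {I : Fin 3 → ℝ} (hf : ∀ i, HasInt (f i) (I i)) :
    HasInt (fun x => ∑ i, f i x) (∑ i, I i) :=
  ⟨integrable_finsetSum _ fun i _ => (hf i).1, by
    rw [integral_finsetSum _ fun i _ => (hf i).1]
    exact Finset.sum_congr rfl fun i _ => (hf i).2⟩

theorem congr (hf : HasInt f I) (h : ∀ x, g x = f x) : HasInt g I := by
  rwa [funext h]

end HasInt

section moments
variable {S : Set (R3 × ℝ)} {V : R3 × ℝ → R3} {P : R3 × ℝ → ℝ}

theorem integrable_sq (hV : MemLp V 2) : Integrable (fun z => ‖V z‖ ^ 2) := by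
  simpa using hV.integrable_norm_pow (by simp)

theorem integrable_cube (hV : MemLp V 3) : Integrable (fun z => ‖V z‖ ^ 3) := by
  simpa using hV.integrable_norm_pow (by simp)

theorem integrable_coord_smul (hV : MemLp V 2) (i : Fin 3) :
    Integrable (fun z => V z i • V z) := by
  refine Integrable.mono' (integrable_sq hV)
    ((aestronglyMeasurable_coord hV.1 i).smul hV.1) (Eventually.of_forall fun z => ?_)
  rw [norm_smul, sq]
  exact mul_le_mul_of_nonneg_right (abs_coord_le _ i) (norm_nonneg _)

theorem integrable_coord_mul_sq (hV : MemLp V 3) (i : Fin 3) :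
    Integrable (fun z => V z i * ‖V z‖ ^ 2) := by
  refine Integrable.mono' (integrable_cube hV)
    ((aestronglyMeasurable_coord hV.1 i).mul (hV.1.norm.pow 2)) (Eventually.of_forall fun z => ?_)
  rw [norm_mul, norm_pow, norm_norm, pow_succ' _ 2]
  exact mul_le_mul_of_nonneg_right (abs_coord_le _ i) (by positivity)

variable {k ζ : R3 × ℝ → ℝ} {r : ℝ}

theorem integrable_advect (hV : Integrable V) (hζ : ContDiff ℝ ∞ ζ) (hζs : HasCompactSupport ζ) :
    Integrable (advect V ζ) := by
  unfold advect
  exact integrable_finsetSum _ fun i _ => integrable_cc_mul (contDiff_pd hζ _).continuous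
    (hasCompactSupport_pd hζs _) (integrable_coord hV i)

/-- The mollified field is divergence free where the kernel fits into the region of the weak
formulation. -/
theorem IsLocalSolution.sum_mol_eq_zero (h : IsLocalSolution S V P) (hk : ContDiff ℝ ∞ k)
    (hks : HasCompactSupport k) (hkr : tsupport k ⊆ Metric.closedBall 0 r) {z : R3 × ℝ}
    (hz : Metric.closedBall z r ⊆ S) : ∑ i, mol (pd (dir i) k) (fun w => V w i) z = 0 := by
  have hψ : ContDiff ℝ ∞ fun w => k (z - w) := hk.comp (contDiff_const.sub contDiff_id)
  have hsupp : tsupport (fun w => k (z - w)) ⊆ Metric.closedBall z r := by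
    refine closure_minimal (fun w hw => ?_) Metric.isClosed_closedBall
    have := hkr (subset_tsupport _ hw)
    simpa [dist_eq_norm, norm_sub_rev] using this
  have h1 := h.divergence_free _ hψ
    ((isCompact_closedBall z r).of_isClosed_subset (isClosed_tsupport _) hsupp) (hsupp.trans hz)
  have h2 : ∀ w, fderiv ℝ (fun w => k (z - w)) w (V w, 0)
      = ∑ i, -(pd (dir i) k (z - w) * V w i) := by
    intro w
    rw [fderiv_spatial]
    refine Finset.sum_congr rfl fun i _ => ?_
    rw [pd_reflect hk, smul_eq_mul]
    ring
  have h3 := (HasInt.sum fun i => (HasInt.of_integrable (integrable_mol_integrand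
    (contDiff_pd hk (dir i)).continuous (hasCompactSupport_pd hks _)
    (integrable_coord h.integrable_velocity i) z)).neg).congr h2
  rw [h3.2, Finset.sum_neg_distrib, neg_eq_zero] at h1
  exact h1

/-- `div (k * (ζ V)) = k * (V · ∇ζ)`, because `V` is divergence free. -/
theorem IsLocalSolution.sum_mol_smul (h : IsLocalSolution S V P) (hk : ContDiff ℝ ∞ k)
    (hks : HasCompactSupport k) (hζ : ContDiff ℝ ∞ ζ) (hζs : HasCompactSupport ζ)
    (hζS : tsupport ζ ⊆ S) (z : R3 × ℝ) :
    ∑ i, mol (pd (dir i) k) (fun w => ζ w * V w i) z = mol k (advect V ζ) z := by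
  have hk' : ContDiff ℝ ∞ fun w => k (z - w) := hk.comp (contDiff_const.sub contDiff_id)
  have h0 : tsupport (fun w => k (z - w) • ζ w) ⊆ tsupport ζ :=
    tsupport_smul_subset_right (fun w => k (z - w)) ζ
  have h1 := h.divergence_free (fun w => k (z - w) • ζ w) (hk'.smul hζ)
    (hζs.of_isClosed_subset (isClosed_tsupport _) h0) (h0.trans hζS)
  have h2 : ∀ w, fderiv ℝ (fun w => k (z - w) • ζ w) w (V w, 0)
      = k (z - w) • advect V ζ w - ∑ i, pd (dir i) k (z - w) • (ζ w * V w i) := by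
    intro w
    rw [fderiv_spatial, advect, Finset.smul_sum, ← Finset.sum_sub_distrib]
    refine Finset.sum_congr rfl fun i _ => ?_
    rw [pd_smul hk' hζ, pd_reflect hk]
    simp only [smul_eq_mul]
    ring
  have h3 := ((HasInt.of_integrable (integrable_mol_integrand hk.continuous hks
    (integrable_advect h.integrable_velocity hζ hζs) z)).sub (HasInt.sum fun i =>
    HasInt.of_integrable (integrable_mol_integrand (contDiff_pd hk (dir i)).continuous
      (hasCompactSupport_pd hks _) (integrable_cc_mul hζ.continuous hζs
        (integrable_coord h.integrable_velocity i)) z))).congr h2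
  rw [h3.2] at h1
  simp only [smul_eq_mul] at h1
  simp only [mol, smul_eq_mul]
  linarith

/-- The defect, expanded with `|a - b|² = |a|² - 2 a · b + |b|²`. -/
theorem defect_eq (hV : Integrable V) (hV2 : MemLp V 2) (hV3 : MemLp V 3) (hk : ContDiff ℝ ∞ k)
    (hks : HasCompactSupport k) (z : R3 × ℝ) :
    defect k V z = -2 * ∑ i, V z i * inner ℝ (V z) (mol (pd (dir i) k) V z)
      + ∑ i, V z i * mol (pd (dir i) k) (fun w => ‖V w‖ ^ 2) z
      - ‖V z‖ ^ 2 * ∑ i, mol (pd (dir i) k) (fun w => V w i) z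
      + 2 * ∑ i, inner ℝ (V z) (mol (pd (dir i) k) (fun w => V w i • V w) z)
      - ∑ i, mol (pd (dir i) k) (fun w => V w i * ‖V w‖ ^ 2) z := by
  have hc : ∀ i, Continuous (pd (dir i) k) := fun i => (contDiff_pd hk _).continuous
  have hs : ∀ i, HasCompactSupport (pd (dir i) k) := fun i => hasCompactSupport_pd hks _
  have e1 : ∀ i, Integrable fun w => pd (dir i) k (z - w) := fun i =>
    ((hc i).integrable_of_hasCompactSupport (hs i)).comp_sub_left z
  have e2 : ∀ i, Integrable fun w => inner ℝ (V z) (pd (dir i) k (z - w) • V w) := fun i =>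
    (integrable_mol_integrand (hc i) (hs i) hV z).const_inner _
  have e3 := fun i => integrable_mol_integrand (hc i) (hs i) (integrable_sq hV2) z
  have e4 := fun i => integrable_mol_integrand (hc i) (hs i) (integrable_coord hV i) z
  have e5 : ∀ i, Integrable fun w => inner ℝ (V z) (pd (dir i) k (z - w) • (V w i • V w)) :=
    fun i => (integrable_mol_integrand (hc i) (hs i) (integrable_coord_smul hV2 i) z).const_inner _
  have e6 := fun i => integrable_mol_integrand (hc i) (hs i) (integrable_coord_mul_sq hV3 i) z
  have hpt : ∀ w, (∑ i, (V z i - V w i) * pd (dir i) k (z - w)) * ‖V z - V w‖ ^ 2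
      = ∑ i, ((V z i * ‖V z‖ ^ 2) * pd (dir i) k (z - w)
        + (-2 * V z i) * inner ℝ (V z) (pd (dir i) k (z - w) • V w)
        + V z i * (pd (dir i) k (z - w) • ‖V w‖ ^ 2)
        + (-‖V z‖ ^ 2) * (pd (dir i) k (z - w) • V w i)
        + 2 * inner ℝ (V z) (pd (dir i) k (z - w) • (V w i • V w))
        + (-1) * (pd (dir i) k (z - w) • (V w i * ‖V w‖ ^ 2))) := by
    intro w
    rw [Finset.sum_mul]
    refine Finset.sum_congr rfl fun i _ => ?_
    rw [norm_sub_sq_real]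
    simp only [inner_smul_right, smul_eq_mul]
    ring
  have hI := (HasInt.sum fun i =>
    ((((((HasInt.of_integrable (e1 i)).const_mul (V z i * ‖V z‖ ^ 2)).add
      ((HasInt.of_integrable (e2 i)).const_mul (-2 * V z i))).add
      ((HasInt.of_integrable (e3 i)).const_mul (V z i))).add
      ((HasInt.of_integrable (e4 i)).const_mul (-‖V z‖ ^ 2))).add
      ((HasInt.of_integrable (e5 i)).const_mul 2)).add
      ((HasInt.of_integrable (e6 i)).const_mul (-1))).congr hpt
  unfold defect
  rw [hI.2]
  simp only [Finset.mul_sum]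
  rw [← Finset.sum_add_distrib, ← Finset.sum_sub_distrib, ← Finset.sum_add_distrib,
    ← Finset.sum_sub_distrib]
  refine Finset.sum_congr rfl fun i _ => ?_
  rw [integral_kernel_pd hk hks, integral_inner (integrable_mol_integrand (hc i) (hs i) hV z),
    integral_inner (integrable_mol_integrand (hc i) (hs i) (integrable_coord_smul hV2 i) z)]
  simp only [mol]
  ring

end moments

section identity
variable {S : Set (R3 × ℝ)} {V : R3 × ℝ → R3} {P : R3 × ℝ → ℝ} {k ζ : R3 × ℝ → ℝ} {r : ℝ}

/-- The momentum equation, written with coordinate derivatives. -/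
theorem IsLocalSolution.momentum_coord (h : IsLocalSolution S V P) {φ : R3 × ℝ → R3}
    (hφ : ContDiff ℝ ∞ φ) (hφs : HasCompactSupport φ) (hφS : tsupport φ ⊆ S) :
    ∫ z, (inner ℝ (V z) (pd (0, 1) φ z) + (∑ i, V z i * inner ℝ (V z) (pd (dir i) φ z))
      + P z * ∑ i, pd (dir i) φ z i) = 0 := by
  rw [← h.momentum φ hφ hφs hφS]
  refine integral_congr_ae (Eventually.of_forall fun z => ?_)
  simp only [fderiv_spatial, inner_sum, inner_smul_right]
  rfl

/-- Odd kernels are skew for the `L²` pairing. -/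
theorem integral_inner_mol_pd {f g : R3 × ℝ → R3} (hk : ContDiff ℝ ∞ k) (hks : HasCompactSupport k)
    (heven : ∀ h, k (-h) = k h) (e : R3 × ℝ) (hf : Integrable f) (hg : Integrable g) :
    ∫ z, inner ℝ (f z) (mol (pd e k) g z) = -∫ z, inner ℝ (g z) (mol (pd e k) f z) := by
  rw [integral_inner_mol (contDiff_pd hk e).continuous (hasCompactSupport_pd hks e) hf hg,
    ← integral_neg]
  refine integral_congr_ae (Eventually.of_forall fun z => ?_)
  simp only [pd_neg_of_even hk heven, mol_neg_kernel, inner_neg_left, real_inner_comm]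

/-- The momentum equation tested with `ζ (k * V)`. The pressure term simplifies because `k * V` is
divergence free on the support of `ζ`. -/
theorem IsLocalSolution.momentum_cutoff_mol (h : IsLocalSolution S V P) (hζ : ContDiff ℝ ∞ ζ)
    (hζs : HasCompactSupport ζ) (hk : ContDiff ℝ ∞ k) (hks : HasCompactSupport k)
    (hkr : tsupport k ⊆ Metric.closedBall 0 r) (hS : Metric.cthickening r (tsupport ζ) ⊆ S) :
    (∫ z, pd (0, 1) ζ z * inner ℝ (V z) (mol k V z))
      + (∫ z, ζ z * inner ℝ (V z) (mol (pd (0, 1) k) V z))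
      + (∫ z, advect V ζ z * inner ℝ (V z) (mol k V z))
      + (∫ z, ζ z * ∑ i, V z i * inner ℝ (V z) (mol (pd (dir i) k) V z))
      + ∫ z, P z * ∑ i, pd (dir i) ζ z * mol k V z i = 0 := by
  have hV := h.integrable_velocity
  have hm := contDiff_mol hk hks hV
  have h0 : tsupport (fun z => ζ z • mol k V z) ⊆ tsupport ζ := tsupport_smul_subset_left ζ _
  have h1 := h.momentum_coord (hζ.smul hm) (hζs.of_isClosed_subset (isClosed_tsupport _) h0)
    (h0.trans ((Metric.self_subset_cthickening _).trans hS))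
  have hdivz : ∀ z, ζ z * ∑ i, mol (pd (dir i) k) V z i = 0 := by
    intro z
    by_cases hz : ζ z = 0
    · simp [hz]
    · have hb : Metric.closedBall z r ⊆ S :=
        (Metric.closedBall_subset_cthickening (subset_tsupport _ hz) r).trans hS
      simp_rw [mol_apply (contDiff_pd hk _).continuous (hasCompactSupport_pd hks _) hV]
      rw [h.sum_mol_eq_zero hk hks hkr hb, mul_zero]
  have hpt : ∀ z, inner ℝ (V z) (pd (0, 1) (fun z => ζ z • mol k V z) z)
      + (∑ i, V z i * inner ℝ (V z) (pd (dir i) (fun z => ζ z • mol k V z) z))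
      + P z * ∑ i, pd (dir i) (fun z => ζ z • mol k V z) z i
      = (pd (0, 1) ζ z * inner ℝ (V z) (mol k V z))
      + (ζ z * inner ℝ (V z) (mol (pd (0, 1) k) V z))
      + (advect V ζ z * inner ℝ (V z) (mol k V z))
      + (ζ z * ∑ i, V z i * inner ℝ (V z) (mol (pd (dir i) k) V z))
      + P z * ∑ i, pd (dir i) ζ z * mol k V z i := by
    intro z
    have hd := hdivz z
    simp only [pd_smul hζ hm, pd_mol hk hks hV, advect]
    simp only [inner_add_right, inner_smul_right, PiLp.add_apply, PiLp.smul_apply, smul_eq_mul,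
      mul_add, Finset.sum_add_distrib, Finset.sum_mul]
    have e1 : ∀ i, V z i * (pd (dir i) ζ z * inner ℝ (V z) (mol k V z))
      = pd (dir i) ζ z * V z i * inner ℝ (V z) (mol k V z) := fun i => by ring
    have e2 : ∀ i, V z i * (ζ z * inner ℝ (V z) (mol (pd (dir i) k) V z))
      = ζ z * (V z i * inner ℝ (V z) (mol (pd (dir i) k) V z)) := fun i => by ring
    simp only [e1, e2, ← Finset.mul_sum, hd]
    ring
  have i1 : Integrable fun z => inner ℝ (V z) (mol k V z) := integrable_inner_mol hk hks hV hV
  have i2 : ∀ e, Integrable fun z => inner ℝ (V z) (mol (pd e k) V z) := fun e =>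
    integrable_inner_mol (contDiff_pd hk e) (hasCompactSupport_pd hks e) hV hV
  have i3 : ∀ i, Integrable fun z => inner ℝ (V z i • V z) (mol k V z) := fun i =>
    integrable_inner_mol hk hks (integrable_coord_smul h.memLp_velocity i) hV
  have i4 : ∀ i, Integrable fun z => inner ℝ (V z i • V z) (mol (pd (dir i) k) V z) := fun i =>
    integrable_inner_mol (contDiff_pd hk _) (hasCompactSupport_pd hks _)
      (integrable_coord_smul h.memLp_velocity i) hV
  have i5 : ∀ i, Integrable fun z => P z * mol k V z i := fun i => by
    simp_rw [mol_apply hk.continuous hks hV]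
    exact integrable_mul_mol hk hks h.integrable_pressure (integrable_coord hV i)
  have hI := ((((HasInt.of_integrable (integrable_cc_mul (contDiff_pd hζ (0, 1)).continuous
    (hasCompactSupport_pd hζs _) i1)).add
    (HasInt.of_integrable (integrable_cc_mul hζ.continuous hζs (i2 (0, 1))))).add
    (HasInt.of_integrable (f := fun z => advect V ζ z * inner ℝ (V z) (mol k V z)) ?_)).add
    (HasInt.of_integrable (f := fun z => ζ z * ∑ i, V z i
      * inner ℝ (V z) (mol (pd (dir i) k) V z)) ?_)).add
    (HasInt.of_integrable (f := fun z => P z * ∑ i, pd (dir i) ζ z * mol k V z i) ?_)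
  · have := (hI.congr hpt).2
    exact this.symm.trans h1
  · simp only [advect, Finset.sum_mul]
    refine integrable_finsetSum _ fun i _ => ?_
    refine (integrable_cc_mul (contDiff_pd hζ (dir i)).continuous
      (hasCompactSupport_pd hζs _) (i3 i)).congr (Eventually.of_forall fun z => ?_)
    simp only [inner_smul_left, smul_eq_mul]
    simp [mul_assoc]
  · refine integrable_cc_mul (F := ℝ) hζ.continuous hζs (integrable_finsetSum _ fun i _ => ?_)
    refine (i4 i).congr (Eventually.of_forall fun z => ?_)
    simp [inner_smul_left]
  · simp only [Finset.mul_sum]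
    refine integrable_finsetSum _ fun i _ => ?_
    refine (integrable_cc_mul (contDiff_pd hζ (dir i)).continuous
      (hasCompactSupport_pd hζs _) (i5 i)).congr (Eventually.of_forall fun z => ?_)
    simp only [smul_eq_mul]
    ring

/-- The momentum equation tested with `k * (ζ V)`. Moving the odd derivatives of `k` to the other
factor produces the time term of `IsLocalSolution.momentum_cutoff_mol` with the opposite sign. -/
theorem IsLocalSolution.momentum_mol_cutoff (h : IsLocalSolution S V P) (hζ : ContDiff ℝ ∞ ζ)
    (hζs : HasCompactSupport ζ) (hk : ContDiff ℝ ∞ k) (hks : HasCompactSupport k)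
    (heven : ∀ h, k (-h) = k h)
    (hkr : tsupport k ⊆ Metric.closedBall 0 r) (hS : Metric.cthickening r (tsupport ζ) ⊆ S) :
    -(∫ z, ζ z * inner ℝ (V z) (mol (pd (0, 1) k) V z))
      - (∫ z, ζ z * ∑ i, inner ℝ (V z) (mol (pd (dir i) k) (fun w => V w i • V w) z))
      + ∫ z, P z * mol k (advect V ζ) z = 0 := by
  have hV := h.integrable_velocity
  have hζV := integrable_cc_mul hζ.continuous hζs hV
  have hadv := integrable_advect hV hζ hζs
  have hζS : tsupport ζ ⊆ S := (Metric.self_subset_cthickening _).trans hS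
  have h0 : tsupport (mol k fun w => ζ w • V w) ⊆ Metric.cthickening r (tsupport ζ) := by
    refine tsupport_mol_subset hkr fun z hz => ?_
    simp [image_eq_zero_of_notMem_tsupport hz]
  have h1 := h.momentum_coord (contDiff_mol hk hks hζV)
    (hζs.isCompact.cthickening.of_isClosed_subset (isClosed_tsupport _) h0) (h0.trans hS)
  have hVi := integrable_coord_smul h.memLp_velocity
  have hpt : ∀ z, inner ℝ (V z) (pd (0, 1) (mol k fun w => ζ w • V w) z)
      + (∑ i, V z i * inner ℝ (V z) (pd (dir i) (mol k fun w => ζ w • V w) z))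
      + P z * ∑ i, pd (dir i) (mol k fun w => ζ w • V w) z i
      = inner ℝ (V z) (mol (pd (0, 1) k) (fun w => ζ w • V w) z)
        + (∑ i, inner ℝ (V z i • V z) (mol (pd (dir i) k) (fun w => ζ w • V w) z))
        + P z * mol k (advect V ζ) z := by
    intro z
    simp only [pd_mol hk hks hζV, inner_smul_left]
    rw [← h.sum_mol_smul hk hks hζ hζs hζS]
    simp only [mol_apply (contDiff_pd hk _).continuous (hasCompactSupport_pd hks _) hζV]
    simp
  have i1 : Integrable fun z => inner ℝ (V z) (mol (pd (0, 1) k) (fun w => ζ w • V w) z) :=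
    integrable_inner_mol (contDiff_pd hk _) (hasCompactSupport_pd hks _) hV hζV
  have i2 : ∀ i, Integrable fun z =>
      inner ℝ (V z i • V z) (mol (pd (dir i) k) (fun w => ζ w • V w) z) := fun i =>
    integrable_inner_mol (contDiff_pd hk _) (hasCompactSupport_pd hks _) (hVi i) hζV
  have hI := (((HasInt.of_integrable i1).add
    (HasInt.sum fun i => HasInt.of_integrable (i2 i))).add
    (HasInt.of_integrable (integrable_mul_mol hk hks h.integrable_pressure hadv))).congr hpt
  have h2 := hI.2.symm.trans h1
  rw [integral_inner_mol_pd hk hks heven _ hV hζV] at h2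
  simp only [fun i => integral_inner_mol_pd hk hks heven (dir i) (hVi i) hζV] at h2
  have i3 := (HasInt.sum fun i => HasInt.of_integrable (integrable_inner_mol
    (contDiff_pd hk (dir i)) (hasCompactSupport_pd hks _) hζV (hVi i))).congr
    (g := fun z => ζ z * ∑ i, inner ℝ (V z) (mol (pd (dir i) k) (fun w => V w i • V w) z))
    (fun z => by simp only [inner_smul_left, Finset.mul_sum]; simp)
  rw [i3.2]
  simp only [inner_smul_left, Finset.sum_neg_distrib] at h2 ⊢
  simp only [RCLike.conj_to_real] at h2 ⊢
  linarith

/-- The Duchon-Robert identity: the energy balance of the mollified field, tested with `ζ`. The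
error is the integral of the cubic defect density. -/
theorem IsLocalSolution.regularized_energy (h : IsLocalSolution S V P) (hV3 : MemLp V 3)
    (hζ : ContDiff ℝ ∞ ζ) (hζs : HasCompactSupport ζ) (hk : ContDiff ℝ ∞ k)
    (hks : HasCompactSupport k) (heven : ∀ h, k (-h) = k h)
    (hkr : tsupport k ⊆ Metric.closedBall 0 r) (hS : Metric.cthickening r (tsupport ζ) ⊆ S) :
    (∫ z, pd (0, 1) ζ z * inner ℝ (V z) (mol k V z))
      + (∫ z, advect V ζ z * inner ℝ (V z) (mol k V z))
      + (∫ z, P z * ∑ i, pd (dir i) ζ z * mol k V z i)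
      + (∫ z, P z * mol k (advect V ζ) z)
      + 1 / 2 * (∑ i, ∫ z, pd (dir i) ζ z * mol k (fun w => V w i * ‖V w‖ ^ 2) z)
      - 1 / 2 * (∫ z, advect V ζ z * mol k (fun w => ‖V w‖ ^ 2) z)
      = 1 / 2 * ∫ z, ζ z * defect k V z := by
  have hV := h.integrable_velocity
  have hV2 := h.memLp_velocity
  have hsq := integrable_sq hV2
  have hcu := integrable_coord_mul_sq hV3
  have t1 := h.momentum_cutoff_mol hζ hζs hk hks hkr hS
  have t2 := h.momentum_mol_cutoff hζ hζs hk hks heven hkr hS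
  have hζS : tsupport ζ ⊆ S := (Metric.self_subset_cthickening _).trans hS
  -- the incompressibility condition, tested with `ζ (k * |V|²)`
  have hm := contDiff_mol hk hks hsq
  have h0 : tsupport (fun z => ζ z • mol k (fun w => ‖V w‖ ^ 2) z) ⊆ tsupport ζ :=
    tsupport_smul_subset_left ζ _
  have t3 := h.divergence_free _ (hζ.smul hm) (hζs.of_isClosed_subset (isClosed_tsupport _) h0)
    (h0.trans hζS)
  have j1 : Integrable fun z => advect V ζ z * mol k (fun w => ‖V w‖ ^ 2) z :=
    integrable_mul_mol hk hks (integrable_advect hV hζ hζs) hsq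
  have j2 : ∀ i, Integrable fun z =>
      V z i * mol (pd (dir i) k) (fun w => ‖V w‖ ^ 2) z := fun i =>
    integrable_mul_mol (contDiff_pd hk _) (hasCompactSupport_pd hks _) (integrable_coord hV i) hsq
  have j2' : Integrable fun z =>
      ζ z * ∑ i, V z i * mol (pd (dir i) k) (fun w => ‖V w‖ ^ 2) z :=
    integrable_cc_mul (F := ℝ) hζ.continuous hζs (integrable_finsetSum _ fun i _ => j2 i)
  have t3' := (((HasInt.of_integrable j1).add (HasInt.of_integrable j2')).congr
    (g := fun z => fderiv ℝ (fun z => ζ z • mol k (fun w => ‖V w‖ ^ 2) z) z (V z, 0))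
    fun z => by
      rw [fderiv_spatial]
      simp only [pd_smul hζ hm, pd_mol hk hks hsq, advect]
      simp only [Finset.sum_mul, Finset.mul_sum, smul_eq_mul, ← Finset.sum_add_distrib]
      exact Finset.sum_congr rfl fun i _ => by ring).2.symm.trans t3
  -- integration by parts for `k * (|V|² V)`
  have t4 : ∀ i, ∫ z, ζ z * mol (pd (dir i) k) (fun w => V w i * ‖V w‖ ^ 2) z
      = -∫ z, pd (dir i) ζ z * mol k (fun w => V w i * ‖V w‖ ^ 2) z := by
    intro i
    rw [← integral_mul_pd hζ hζs (contDiff_mol hk hks (hcu i)) (dir i)]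
    simp only [pd_mol hk hks (hcu i)]
  have hdivz : ∀ z, ζ z * ∑ i, mol (pd (dir i) k) (fun w => V w i) z = 0 := by
    intro z
    by_cases hz : ζ z = 0
    · simp [hz]
    · have hb : Metric.closedBall z r ⊆ S :=
        (Metric.closedBall_subset_cthickening (subset_tsupport _ hz) r).trans hS
      rw [h.sum_mol_eq_zero hk hks hkr hb, mul_zero]
  have j3 : ∀ i, Integrable fun z => V z i * inner ℝ (V z) (mol (pd (dir i) k) V z) := fun i =>
    (integrable_inner_mol (contDiff_pd hk (dir i)) (hasCompactSupport_pd hks _)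
      (integrable_coord_smul hV2 i) hV).congr
      (Eventually.of_forall fun z => by simp [inner_smul_left])
  have j3' : Integrable fun z =>
      ζ z * ∑ i, V z i * inner ℝ (V z) (mol (pd (dir i) k) V z) :=
    integrable_cc_mul (F := ℝ) hζ.continuous hζs (integrable_finsetSum _ fun i _ => j3 i)
  have j4 : ∀ i, Integrable fun z => inner ℝ (V z) (mol (pd (dir i) k) (fun w => V w i • V w) z) :=
    fun i => integrable_inner_mol (contDiff_pd hk _) (hasCompactSupport_pd hks _) hV
      (integrable_coord_smul hV2 i)
  have j4' : Integrable fun z =>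
      ζ z * ∑ i, inner ℝ (V z) (mol (pd (dir i) k) (fun w => V w i • V w) z) :=
    integrable_cc_mul (F := ℝ) hζ.continuous hζs (integrable_finsetSum _ fun i _ => j4 i)
  have j5 : ∀ i, Integrable fun z =>
      ζ z * mol (pd (dir i) k) (fun w => V w i * ‖V w‖ ^ 2) z := fun i =>
    (hζ.continuous.mul (contDiff_mol (contDiff_pd hk _) (hasCompactSupport_pd hks _)
      (hcu i)).continuous).integrable_of_hasCompactSupport hζs.mul_right
  have t5 := (((((HasInt.of_integrable j3').const_mul (-2)).add (HasInt.of_integrable j2')).add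
    ((HasInt.of_integrable j4').const_mul 2)).sub
    (HasInt.sum fun i => HasInt.of_integrable (j5 i))).congr (g := fun z => ζ z * defect k V z)
    fun z => by
      rw [defect_eq hV hV2 hV3 hk hks]
      have := hdivz z
      rw [← Finset.mul_sum]
      linear_combination (-‖V z‖ ^ 2) * this
  rw [t5.2]
  simp only [t4, Finset.sum_neg_distrib]
  linarith

end identity

/-! ### Convergence of mollifications -/

section convergence
variable {G : Type*} [NormedAddCommGroup G] [NormedSpace ℝ G] [FiniteDimensional ℝ G]
  [MeasureSpace G] [BorelSpace G] [(volume : Measure G).IsAddHaarMeasure]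
  {F : Type*} [NormedAddCommGroup F] [InnerProductSpace ℝ F] [CompleteSpace F]

/-- Translations are continuous in `L^p` for finite `p`. -/
theorem eventually_eLpNorm_translate_sub_le {p : ENNReal} (hp1 : 1 ≤ p) (hp : p ≠ ⊤) {f : G → F}
    (hf : MemLp f p) {ε : ENNReal} (hε : 0 < ε) :
    ∀ᶠ h : G in 𝓝 0, eLpNorm (fun z => f (z - h) - f z) p volume ≤ ε := by
  have : Fact (1 ≤ p) := ⟨hp1⟩
  let τ : C(G, C(G, G)) := ContinuousMap.curry ⟨fun q : G × G => q.2 - q.1, by fun_prop⟩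
  have hm : ∀ h, MeasurePreserving (τ h) volume volume := fun h => measurePreserving_sub_right _ h
  have h1 := (tendsto_const_nhds (x := hf.toLp f) (f := 𝓝 (0 : G))).compMeasurePreservingLp
    (τ.continuous.tendsto 0) hm (hm 0) hp
  have h2 := (EMetric.tendsto_nhds.1 h1) ε hε
  filter_upwards [h2] with h hh
  refine le_of_eq_of_le ?_ hh.le
  rw [Lp.toLp_compMeasurePreserving hf (hm h), Lp.toLp_compMeasurePreserving hf (hm 0),
    Lp.edist_toLp_toLp]
  congr 1
  funext z
  change f (z - h) - f z = f (z - h) - f (z - 0)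
  rw [sub_zero]

/-- A symmetric mollifier of radius `r`. -/
structure IsMollifier (k : G → ℝ) (r : ℝ) : Prop where
  smooth : ContDiff ℝ ∞ k
  nonneg : ∀ h, 0 ≤ k h
  even : ∀ h, k (-h) = k h
  integral_eq_one : ∫ h, k h = 1
  tsupport_subset : tsupport k ⊆ Metric.closedBall 0 r

namespace IsMollifier
variable {k : G → ℝ} {r : ℝ}

theorem hasCompactSupport (hk : IsMollifier k r) : HasCompactSupport k :=
  (isCompact_closedBall (0 : G) r).of_isClosed_subset (isClosed_tsupport _) hk.tsupport_subset

theorem integrable (hk : IsMollifier k r) : Integrable k :=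
  hk.smooth.continuous.integrable_of_hasCompactSupport hk.hasCompactSupport

theorem lintegral_eq_one (hk : IsMollifier k r) : ∫⁻ h, ENNReal.ofReal (k h) = 1 := by
  rw [← ofReal_integral_eq_lintegral_ofReal hk.integrable (Eventually.of_forall hk.nonneg),
    hk.integral_eq_one, ENNReal.ofReal_one]

theorem eq_zero (hk : IsMollifier k r) {h : G} (hh : r < ‖h‖) : k h = 0 := by
  by_contra hcon
  have := hk.tsupport_subset (subset_tsupport _ hcon)
  rw [mem_closedBall_zero_iff] at this
  linarith

theorem enorm_mol_sub_le (hk : IsMollifier k r) {g : G → F} (hg : Integrable g) (z : G) :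
    ‖mol k g z - g z‖ₑ ≤ ∫⁻ h, ENNReal.ofReal (k h) * ‖g (z - h) - g z‖ₑ := by
  have h0 : mol k g z = ∫ h, k h • g (z - h) := by
    rw [mol, ← integral_sub_left_eq_self (fun w => k (z - w) • g w) volume z]
    simp
  have h1 : Integrable fun h => k h • g (z - h) := by
    simpa using (integrable_mol_integrand hk.smooth.continuous hk.hasCompactSupport hg
      z).comp_sub_left z
  have h2 : g z = ∫ h, k h • g z := by
    rw [integral_smul_const, hk.integral_eq_one, one_smul]
  have h3 : mol k g z - g z = ∫ h, k h • (g (z - h) - g z) := by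
    conv_lhs => rw [h0, h2]
    rw [← integral_sub h1 (hk.integrable.smul_const _)]
    simp only [smul_sub]
  rw [h3]
  refine (enorm_integral_le_lintegral_enorm _).trans (lintegral_mono fun h => ?_)
  rw [enorm_smul, Real.enorm_of_nonneg (hk.nonneg h)]

/-- Pairing with a mollification differs from the pairing with the original function by at most
the `L²` modulus of continuity. -/
theorem norm_integral_inner_mol_sub_le (hk : IsMollifier k r) {f g : G → F} (hf : Integrable f)
    (hf2 : MemLp f 2) (hg : Integrable g) (hg2 : MemLp g 2) {δ : ENNReal}
    (hδ : ∀ h, ‖h‖ ≤ r → eLpNorm (fun z => g (z - h) - g z) 2 volume ≤ δ) :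
    ‖(∫ z, inner ℝ (f z) (mol k g z)) - ∫ z, inner ℝ (f z) (g z)‖ₑ ≤ eLpNorm f 2 volume * δ := by
  have i1 := integrable_inner_mol hk.smooth hk.hasCompactSupport hf hg
  have i2 : Integrable fun z => inner ℝ (f z) (g z) := by
    refine (hf2.norm.integrable_mul hg2.norm).mono' (hf.1.inner hg.1)
      (Eventually.of_forall fun z => ?_)
    exact norm_inner_le_norm _ _
  rw [← integral_sub i1 i2]
  refine (enorm_integral_le_lintegral_enorm _).trans ?_
  have hmeas : AEStronglyMeasurable (fun p : G × G => g (p.1 - p.2) - g p.1)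
      (volume.prod volume) :=
    (hg.1.comp_quasiMeasurePreserving (quasiMeasurePreserving_sub volume volume)).sub hg.1.comp_fst
  calc ∫⁻ z, ‖inner ℝ (f z) (mol k g z) - inner ℝ (f z) (g z)‖ₑ
      ≤ ∫⁻ z, ∫⁻ h, ENNReal.ofReal (k h) * (‖f z‖ₑ * ‖g (z - h) - g z‖ₑ) := by
        refine lintegral_mono fun z => ?_
        rw [← inner_sub_right]
        have h1 : ‖(inner ℝ (f z) (mol k g z - g z) : ℝ)‖ₑ ≤ ‖f z‖ₑ * ‖mol k g z - g z‖ₑ := by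
          rw [← ofReal_norm, ← ofReal_norm, ← ofReal_norm,
            ← ENNReal.ofReal_mul (norm_nonneg _)]
          exact ENNReal.ofReal_le_ofReal (norm_inner_le_norm _ _)
        refine h1.trans ((mul_le_mul_right (hk.enorm_mol_sub_le hg z) _).trans ?_)
        rw [← lintegral_const_mul' _ _ (by simp)]
        exact lintegral_mono fun h => by rw [mul_left_comm]
    _ = ∫⁻ h, ∫⁻ z, ENNReal.ofReal (k h) * (‖f z‖ₑ * ‖g (z - h) - g z‖ₑ) := by
        refine lintegral_lintegral_swap ?_
        refine AEMeasurable.mul ?_ ((hf.1.comp_fst.enorm).mul hmeas.enorm)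
        exact (ENNReal.continuous_ofReal.comp
          (hk.smooth.continuous.comp continuous_snd)).measurable.aemeasurable
    _ ≤ ∫⁻ h, ENNReal.ofReal (k h) * (eLpNorm f 2 volume * δ) := by
        refine lintegral_mono fun h => ?_
        by_cases hh : ‖h‖ ≤ r
        · rw [lintegral_const_mul' _ _ (by simp)]
          refine mul_le_mul_right ?_ _
          have hgh : AEStronglyMeasurable (fun z => g (z - h) - g z) volume :=
            (hg.1.comp_measurePreserving (measurePreserving_sub_right volume h)).sub hg.1
          have := ENNReal.lintegral_mul_le_Lp_mul_Lq volume Real.HolderConjugate.two_two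
            hf.1.enorm hgh.enorm
          refine this.trans ?_
          have e : ∀ u : G → F, (∫⁻ z, ‖u z‖ₑ ^ (2 : ℝ)) ^ (1 / 2 : ℝ) = eLpNorm u 2 volume := by
            intro u
            rw [eLpNorm_eq_lintegral_rpow_enorm_toReal (by simp) (by simp)]
            simp
          simp only [e]
          exact mul_le_mul_right (hδ h hh) _
        · simp [hk.eq_zero (not_le.1 hh)]
    _ = eLpNorm f 2 volume * δ := by
        rw [lintegral_mul_const _ (by
          exact (ENNReal.continuous_ofReal.comp hk.smooth.continuous).measurable),
          hk.lintegral_eq_one, one_mul]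

end IsMollifier

/-- Mollification converges weakly in `L²`, along kernels of radius tending to zero. -/
theorem tendsto_integral_inner_mol {ι : Type*} {l : Filter ι} {k : ι → G → ℝ} {r : ι → ℝ}
    (hk : ∀ n, IsMollifier (k n) (r n)) (hr : Tendsto r l (𝓝 0)) {f g : G → F}
    (hf : Integrable f) (hf2 : MemLp f 2) (hg : Integrable g) (hg2 : MemLp g 2) :
    Tendsto (fun n => ∫ z, inner ℝ (f z) (mol (k n) g z)) l (𝓝 (∫ z, inner ℝ (f z) (g z))) := by
  rw [EMetric.tendsto_nhds]
  intro ε hε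
  obtain ⟨δ, hδ0, hδ⟩ : ∃ δ : ENNReal, 0 < δ ∧ eLpNorm f 2 volume * δ < ε := by
    obtain ⟨δ, hδ0, hδ⟩ := ENNReal.exists_nnreal_pos_mul_lt hf2.2.ne hε.ne'
    exact ⟨δ, by simpa using hδ0, by rwa [mul_comm]⟩
  obtain ⟨s, hs0, hs⟩ := Metric.eventually_nhds_iff.1
    (eventually_eLpNorm_translate_sub_le (by norm_num) (by simp) hg2 hδ0)
  filter_upwards [hr.eventually (gt_mem_nhds hs0)] with n hn
  rw [edist_eq_enorm_sub]
  refine ((hk n).norm_integral_inner_mol_sub_le hf hf2 hg hg2 fun h hh => ?_).trans_lt hδ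
  exact hs (by rw [dist_zero_right]; linarith)

theorem tendsto_integral_mul_mol {ι : Type*} {l : Filter ι} {k : ι → G → ℝ} {r : ι → ℝ}
    (hk : ∀ n, IsMollifier (k n) (r n)) (hr : Tendsto r l (𝓝 0)) {f g : G → ℝ}
    (hf : Integrable f) (hf2 : MemLp f 2) (hg : Integrable g) (hg2 : MemLp g 2) :
    Tendsto (fun n => ∫ z, f z * mol (k n) g z) l (𝓝 (∫ z, f z * g z)) := by
  have := tendsto_integral_inner_mol hk hr hf hf2 hg hg2
  simpa [mul_comm] using this

end convergence

section limit
variable {S N : Set (R3 × ℝ)} {V : R3 × ℝ → R3} {P : R3 × ℝ → ℝ} {ζ : R3 × ℝ → ℝ} {ρ C : ℝ}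

theorem memLp_two_of_bounded {G F : Type*} [MeasureSpace G] [NormedAddCommGroup F] {f : G → F}
    (hf : Integrable f) {C : ℝ} (hC : ∀ᵐ z, ‖f z‖ ≤ C) : MemLp f 2 := by
  rw [memLp_two_iff_integrable_sq_norm hf.1]
  refine (hf.norm.const_mul C).mono' (hf.1.norm.pow 2) ?_
  filter_upwards [hC] with z hz
  rw [norm_pow, norm_norm, sq]
  exact mul_le_mul_of_nonneg_right hz (norm_nonneg _)

theorem memLp_two_indicator {f : R3 × ℝ → ℝ} (hN : MeasurableSet N) (hf : Integrable f)
    {C : ℝ} (hC0 : 0 ≤ C) (hC : ∀ᵐ z, z ∈ N → |f z| ≤ C) : MemLp (N.indicator f) 2 := by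
  refine memLp_two_of_bounded (hf.indicator hN) (C := C) ?_
  filter_upwards [hC] with z hz
  by_cases h : z ∈ N
  · simpa [h] using hz h
  · simpa [h] using hC0

theorem advect_eq_zero {z : R3 × ℝ} (hz : ∀ i, z ∉ tsupport (pd (dir i) ζ)) :
    advect V ζ z = 0 :=
  Finset.sum_eq_zero fun i _ => by rw [image_eq_zero_of_notMem_tsupport (hz i), zero_mul]

theorem exists_bound_pd (hζ : ContDiff ℝ ∞ ζ) (hζs : HasCompactSupport ζ) (e : R3 × ℝ) :
    ∃ M, 0 ≤ M ∧ ∀ z, |pd e ζ z| ≤ M := by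
  obtain ⟨M, hM⟩ := (hasCompactSupport_pd hζs e).exists_bound_of_continuous
    (contDiff_pd hζ e).continuous
  exact ⟨M, (norm_nonneg _).trans (hM 0), hM⟩

theorem exists_bound_advect (hζ : ContDiff ℝ ∞ ζ) (hζs : HasCompactSupport ζ) :
    ∃ M, 0 ≤ M ∧ ∀ (V : R3 × ℝ → R3) (z : R3 × ℝ), |advect V ζ z| ≤ M * ‖V z‖ := by
  choose M hM0 hM using fun i => exists_bound_pd hζ hζs (dir i)
  refine ⟨∑ i, M i, Finset.sum_nonneg fun i _ => hM0 i, fun V z => ?_⟩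
  rw [Finset.sum_mul]
  refine (Finset.abs_sum_le_sum_abs _ _).trans (Finset.sum_le_sum fun i _ => ?_)
  rw [abs_mul]
  exact mul_le_mul (hM i z) (abs_coord_le _ i) (abs_nonneg _) (hM0 i)

/-- If the defect vanishes in the limit, and `V`, `P` are bounded where `∇ζ` does not vanish, then
the energy equality holds when tested with `ζ`. -/
theorem IsLocalSolution.energy_of_tendsto_defect (h : IsLocalSolution S V P) (hV3 : MemLp V 3)
    (hζ : ContDiff ℝ ∞ ζ) (hζs : HasCompactSupport ζ) (hN : MeasurableSet N)
    (hC : ∀ᵐ z, z ∈ N → ‖V z‖ ≤ C ∧ |P z| ≤ C) (hρ : 0 < ρ)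
    (hζN : ∀ i, Metric.cthickening ρ (tsupport (pd (dir i) ζ)) ⊆ N)
    (hζS : Metric.cthickening ρ (tsupport ζ) ⊆ S)
    {k : ℕ → R3 × ℝ → ℝ} {r : ℕ → ℝ} (hk : ∀ n, IsMollifier (k n) (r n))
    (hr : Tendsto r atTop (𝓝 0))
    (hD : Tendsto (fun n => ∫ z, ζ z * defect (k n) V z) atTop (𝓝 0)) :
    (∫ z, pd (0, 1) ζ z * ‖V z‖ ^ 2) + (∫ z, advect V ζ z * ‖V z‖ ^ 2)
      + 2 * ∫ z, P z * advect V ζ z = 0 := by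
  have hV := h.integrable_velocity
  have hV2 := h.memLp_velocity
  have hP := h.integrable_pressure
  have hadv := integrable_advect hV hζ hζs
  -- replacing `C` by a nonnegative bound
  wlog hC0 : 0 ≤ C generalizing C
  · exact this (C := |C|) (by
      filter_upwards [hC] with z hz hzN
      exact ⟨(hz hzN).1.trans (le_abs_self _), (hz hzN).2.trans (le_abs_self _)⟩) (abs_nonneg C)
  obtain ⟨M, hM0, hM⟩ := exists_bound_advect hζ hζs
  have hsub : ∀ i, tsupport (pd (dir i) ζ) ⊆ N := fun i =>
    (Metric.self_subset_cthickening _).trans (hζN i)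
  have hadv0 : ∀ z, z ∉ N → advect V ζ z = 0 := fun z hz =>
    advect_eq_zero fun i hi => hz (hsub i hi)
  have hadvC : ∀ᵐ z, |advect V ζ z| ≤ M * C := by
    filter_upwards [hC] with z hz
    by_cases hzN : z ∈ N
    · exact (hM V z).trans (mul_le_mul_of_nonneg_left (hz hzN).1 hM0)
    · rw [hadv0 z hzN, abs_zero]
      positivity
  have hadv2 : MemLp (advect V ζ) 2 := memLp_two_of_bounded hadv hadvC
  have hev : ∀ᶠ n in atTop, r n ≤ ρ := hr.eventually (ge_mem_nhds hρ)
  have hsq := integrable_sq hV2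
  have hcu := integrable_coord_mul_sq hV3
  have hVi := integrable_coord hV
  have hVi2 : ∀ i, MemLp (fun z => V z i) 2 := fun i =>
    hV2.mono (aestronglyMeasurable_coord hV.1 i) (Eventually.of_forall fun z => abs_coord_le _ i)
  have c1 : Tendsto (fun n => ∫ z, pd (0, 1) ζ z * inner ℝ (V z) (mol (k n) V z)) atTop
      (𝓝 (∫ z, pd (0, 1) ζ z * ‖V z‖ ^ 2)) := by
    obtain ⟨B, hB0, hB⟩ := exists_bound_pd hζ hζs (0, 1)
    have i1 := integrable_cc_mul (contDiff_pd hζ (0, 1)).continuous (hasCompactSupport_pd hζs _) hV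
    have := tendsto_integral_inner_mol hk hr i1 (hV2.of_le_mul (c := B) i1.1
      (Eventually.of_forall fun z => by
        rw [norm_smul]
        exact mul_le_mul_of_nonneg_right (hB z) (norm_nonneg _))) hV hV2
    simpa [inner_smul_left] using this
  -- in the transport term `(V · ∇ζ) V` is square integrable, because `V · ∇ζ` is bounded
  have c2 : Tendsto (fun n => ∫ z, advect V ζ z * inner ℝ (V z) (mol (k n) V z)) atTop
      (𝓝 (∫ z, advect V ζ z * ‖V z‖ ^ 2)) := by
    have i1 : Integrable fun z => advect V ζ z • V z :=
      hV.bdd_smul (M * C) hadv.1 hadvC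
    have := tendsto_integral_inner_mol hk hr i1 (hV2.of_le_mul (c := M * C) i1.1
      (by
        filter_upwards [hadvC] with z hz
        rw [norm_smul]
        exact mul_le_mul_of_nonneg_right hz (norm_nonneg _))) hV hV2
    simpa [inner_smul_left] using this
  -- the pressure is square integrable on the support of `∇ζ`, because it is bounded there
  have c3 : Tendsto (fun n => ∫ z, P z * ∑ i, pd (dir i) ζ z * mol (k n) V z i) atTop
      (𝓝 (∫ z, P z * advect V ζ z)) := by
    have i1 : ∀ i, Integrable fun z => pd (dir i) ζ z * P z := fun i =>
      integrable_cc_mul (contDiff_pd hζ (dir i)).continuous (hasCompactSupport_pd hζs _) hP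
    have i2 : ∀ i, MemLp (fun z => pd (dir i) ζ z * P z) 2 := by
      intro i
      obtain ⟨B, hB0, hB⟩ := exists_bound_pd hζ hζs (dir i)
      refine memLp_two_of_bounded (i1 i) (C := B * C) ?_
      filter_upwards [hC] with z hz
      by_cases hzN : z ∈ N
      · rw [norm_mul]
        exact mul_le_mul (hB z) (hz hzN).2 (abs_nonneg _) hB0
      · rw [image_eq_zero_of_notMem_tsupport (fun hi => hzN (hsub i hi))]
        simp only [zero_mul, norm_zero]
        positivity
    have e1 : ∀ n, ∫ z, P z * ∑ i, pd (dir i) ζ z * mol (k n) V z i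
        = ∑ i, ∫ z, pd (dir i) ζ z * P z * mol (k n) (fun w => V w i) z := by
      intro n
      have := (HasInt.sum fun i => HasInt.of_integrable (integrable_mul_mol (hk n).smooth
        (hk n).hasCompactSupport (i1 i) (hVi i))).congr
        (g := fun z => P z * ∑ i, pd (dir i) ζ z * mol (k n) V z i) fun z => by
          rw [Finset.mul_sum]
          refine Finset.sum_congr rfl fun i _ => ?_
          rw [mol_apply (hk n).smooth.continuous (hk n).hasCompactSupport hV]
          ring
      exact this.2
    have e2 : ∫ z, P z * advect V ζ z = ∑ i, ∫ z, pd (dir i) ζ z * P z * V z i := by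
      have := (HasInt.sum fun i => HasInt.of_integrable ((i2 i).integrable_mul (hVi2 i))).congr
        (g := fun z => P z * advect V ζ z) fun z => by
          rw [advect, Finset.mul_sum]
          refine Finset.sum_congr rfl fun i _ => ?_
          simp only [Pi.mul_apply]
          ring
      exact this.2
    simp only [e1, e2]
    exact tendsto_finsetSum _ fun i _ =>
      tendsto_integral_mul_mol hk hr (i1 i) (i2 i) (hVi i) (hVi2 i)
  have c4 : Tendsto (fun n => ∫ z, P z * mol (k n) (advect V ζ) z) atTop
      (𝓝 (∫ z, P z * advect V ζ z)) := by
    have hPN : MemLp (N.indicator P) 2 := memLp_two_indicator hN hP hC0 (by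
      filter_upwards [hC] with z hz hzN using (hz hzN).2)
    have e2 : ∫ z, P z * advect V ζ z = ∫ z, N.indicator P z * advect V ζ z := by
      congr 1
      funext z
      by_cases hzN : z ∈ N
      · simp [hzN]
      · simp [hadv0 z hzN]
    rw [e2]
    refine (tendsto_integral_mul_mol hk hr (hP.indicator hN) hPN hadv hadv2).congr' ?_
    filter_upwards [hev] with n hn
    congr 1
    funext z
    by_cases hzN : z ∈ N
    · simp [hzN]
    · have : mol (k n) (advect V ζ) z = 0 := by
        have h0 := tsupport_mol_subset (hk n).tsupport_subset (f := advect V ζ)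
          (A := ⋃ i, tsupport (pd (dir i) ζ)) fun z hz => advect_eq_zero fun i hi =>
            hz (mem_iUnion.2 ⟨i, hi⟩)
        by_contra hne
        have h1 := h0 (subset_tsupport _ hne)
        have hcp : IsCompact (⋃ i, tsupport (pd (dir i) ζ)) :=
          isCompact_iUnion fun i => hasCompactSupport_pd hζs (dir i)
        have hr0 : 0 ≤ ρ := hρ.le
        have h2 := Metric.cthickening_mono hn _ h1
        rw [hcp.cthickening_eq_biUnion_closedBall hr0] at h2
        obtain ⟨w, hw, hzw⟩ := mem_iUnion₂.1 h2
        obtain ⟨i, hi⟩ := mem_iUnion.1 hw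
        exact hzN (hζN i (Metric.closedBall_subset_cthickening hi ρ hzw))
      simp [this]
  -- the cubic moments only matter near the support of `∇ζ`, where they may be replaced by their
  -- bounded restrictions to `N`
  have hball : ∀ᶠ n in atTop, ∀ i, ∀ z ∈ tsupport (pd (dir i) ζ),
      Metric.closedBall z (r n) ⊆ N := by
    filter_upwards [hev] with n hn i z hz
    exact (Metric.closedBall_subset_closedBall hn).trans
      ((Metric.closedBall_subset_cthickening hz ρ).trans (hζN i))
  have c5 : Tendsto (fun n => ∑ i, ∫ z, pd (dir i) ζ z * mol (k n) (fun w => V w i * ‖V w‖ ^ 2) z)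
      atTop (𝓝 (∫ z, advect V ζ z * ‖V z‖ ^ 2)) := by
    have hpi : ∀ i, Integrable (pd (dir i) ζ) := fun i =>
      (contDiff_pd hζ _).continuous.integrable_of_hasCompactSupport (hasCompactSupport_pd hζs _)
    have hpi2 : ∀ i, MemLp (pd (dir i) ζ) 2 := fun i =>
      (contDiff_pd hζ _).continuous.memLp_of_hasCompactSupport (hasCompactSupport_pd hζs _)
    have hg2 : ∀ i, MemLp (N.indicator fun w => V w i * ‖V w‖ ^ 2) 2 := fun i =>
      memLp_two_indicator hN (hcu i) (C := C * C ^ 2) (by positivity) (by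
        filter_upwards [hC] with z hz hzN
        have := (hz hzN).1
        rw [abs_mul, abs_pow, abs_norm]
        exact mul_le_mul ((abs_coord_le _ i).trans this) (by gcongr) (by positivity) hC0)
    have e2 : ∫ z, advect V ζ z * ‖V z‖ ^ 2
        = ∑ i, ∫ z, pd (dir i) ζ z * (N.indicator fun w => V w i * ‖V w‖ ^ 2) z := by
      have := (HasInt.sum fun i => HasInt.of_integrable ((hpi2 i).integrable_mul (hg2 i))).congr
        (g := fun z => advect V ζ z * ‖V z‖ ^ 2) fun z => by
          rw [advect, Finset.sum_mul]
          refine Finset.sum_congr rfl fun i _ => ?_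
          simp only [Pi.mul_apply]
          by_cases hzN : z ∈ N
          · simp only [hzN, indicator_of_mem]
            ring
          · rw [image_eq_zero_of_notMem_tsupport (fun hi => hzN (hsub i hi))]
            ring
      exact this.2
    rw [e2]
    refine (tendsto_finsetSum _ fun i _ => tendsto_integral_mul_mol hk hr (hpi i) (hpi2 i)
      ((hcu i).indicator hN) (hg2 i)).congr' ?_
    filter_upwards [hball] with n hn
    refine Finset.sum_congr rfl fun i _ => ?_
    congr 1
    funext z
    by_cases hz : z ∈ tsupport (pd (dir i) ζ)
    · congr 1
      refine mol_congr (hk n).tsupport_subset fun w hw => ?_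
      rw [indicator_of_mem (hn i z hz hw)]
    · simp [image_eq_zero_of_notMem_tsupport hz]
  have c6 : Tendsto (fun n => ∫ z, advect V ζ z * mol (k n) (fun w => ‖V w‖ ^ 2) z)
      atTop (𝓝 (∫ z, advect V ζ z * ‖V z‖ ^ 2)) := by
    have hg2 : MemLp (N.indicator fun w => ‖V w‖ ^ 2) 2 :=
      memLp_two_indicator hN hsq (C := C ^ 2) (by positivity) (by
        filter_upwards [hC] with z hz hzN
        have := (hz hzN).1
        rw [abs_pow, abs_norm]
        gcongr)
    have e2 : ∫ z, advect V ζ z * ‖V z‖ ^ 2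
        = ∫ z, advect V ζ z * (N.indicator fun w => ‖V w‖ ^ 2) z := by
      congr 1
      funext z
      by_cases hzN : z ∈ N
      · simp [hzN]
      · simp [hadv0 z hzN]
    rw [e2]
    refine (tendsto_integral_mul_mol hk hr hadv hadv2 (hsq.indicator hN) hg2).congr' ?_
    filter_upwards [hball] with n hn
    congr 1
    funext z
    by_cases hz : ∃ i, z ∈ tsupport (pd (dir i) ζ)
    · obtain ⟨i, hi⟩ := hz
      congr 1
      refine mol_congr (hk n).tsupport_subset fun w hw => ?_
      rw [indicator_of_mem (hn i z hi hw)]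
    · push Not at hz
      simp [advect_eq_zero hz]
  have hlim := ((((c1.add c2).add c3).add c4).add (c5.const_mul (1 / 2))).sub
    (c6.const_mul (1 / 2))
  have hlim' := (hD.const_mul (1 / 2)).congr' (by
    filter_upwards [hev] with n hn
    exact (h.regularized_energy hV3 hζ hζs (hk n).smooth (hk n).hasCompactSupport (hk n).even
      (hk n).tsupport_subset ((Metric.cthickening_mono hn _).trans hζS)).symm)
  have := tendsto_nhds_unique hlim hlim'
  linarith

end limit

/-! ### Kernels, and the vanishing of the defect -/

theorem exists_isMollifier {G : Type*} [NormedAddCommGroup G] [NormedSpace ℝ G]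
    [FiniteDimensional ℝ G] [MeasureSpace G] [BorelSpace G]
    [(volume : Measure G).IsAddHaarMeasure] {r : ℝ} (hr : 0 < r) :
    ∃ k : G → ℝ, IsMollifier k r := by
  let f : ContDiffBump (0 : G) := ⟨r / 2, r, by positivity, by linarith⟩
  exact ⟨f.normed volume, f.contDiff_normed, f.nonneg_normed, f.normed_neg, f.integral_normed,
    f.tsupport_normed_eq.subset⟩

/-- Mollifiers on `ℝ³` of radius `ε / 2` whose gradient is of the optimal order `ε⁻⁴`. -/
theorem exists_isMollifier_pd_le : ∃ C : ℝ, 0 ≤ C ∧ ∀ ε : ℝ, 0 < ε → ∃ η : R3 → ℝ,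
    IsMollifier η (ε / 2) ∧ ∀ v y, |pd v η y| ≤ C / ε ^ 4 * ‖v‖ := by
  obtain ⟨k, hk⟩ := exists_isMollifier (G := R3) (r := 1 / 2) (by norm_num)
  obtain ⟨C, hC⟩ := (hk.hasCompactSupport.fderiv ℝ).exists_bound_of_continuous
    (hk.smooth.continuous_fderiv (by simp))
  have hC0 : 0 ≤ C := (norm_nonneg _).trans (hC 0)
  refine ⟨C, hC0, fun ε hε => ⟨fun y => (ε ^ 3)⁻¹ * k (ε⁻¹ • y), ⟨?_, ?_, ?_, ?_, ?_⟩, ?_⟩⟩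
  · exact contDiff_const.mul (hk.smooth.comp (contDiff_const_smul _))
  · intro y
    have := hk.nonneg (ε⁻¹ • y)
    positivity
  · intro y
    rw [smul_neg, hk.even]
  · rw [integral_const_mul, Measure.integral_comp_inv_smul, hk.integral_eq_one]
    simp [abs_of_pos hε, hε.ne']
  · refine closure_minimal (fun y hy => ?_) Metric.isClosed_closedBall
    have h1 : k (ε⁻¹ • y) ≠ 0 := right_ne_zero_of_mul hy
    have h2 := hk.tsupport_subset (subset_tsupport _ h1)
    rw [mem_closedBall_zero_iff, norm_smul, norm_inv, Real.norm_of_nonneg hε.le,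
      inv_mul_le_iff₀ hε] at h2
    rw [mem_closedBall_zero_iff]
    linarith
  · intro v y
    have h1 : HasFDerivAt k (fderiv ℝ k (ε⁻¹ • y)) (ε⁻¹ • y) :=
      (hk.smooth.differentiable (by simp)).differentiableAt.hasFDerivAt
    have h2 : HasFDerivAt (fun y : R3 => ε⁻¹ • y) (ε⁻¹ • ContinuousLinearMap.id ℝ R3) y :=
      (hasFDerivAt_id y).const_smul ε⁻¹
    have h3 := ((h1.comp y h2).const_mul (ε ^ 3)⁻¹).fderiv
    have h4 : pd v (fun y => (ε ^ 3)⁻¹ * k (ε⁻¹ • y)) y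
        = (ε ^ 3)⁻¹ * (ε⁻¹ * fderiv ℝ k (ε⁻¹ • y) v) := by
      change fderiv ℝ (fun y => (ε ^ 3)⁻¹ * (k ∘ fun y => ε⁻¹ • y) y) y v = _
      rw [h3]
      simp
    rw [h4, abs_mul, abs_mul, abs_of_pos (by positivity : (0 : ℝ) < (ε ^ 3)⁻¹),
      abs_of_pos (by positivity : (0 : ℝ) < ε⁻¹)]
    have h5 : |fderiv ℝ k (ε⁻¹ • y) v| ≤ C * ‖v‖ :=
      ((fderiv ℝ k (ε⁻¹ • y)).le_opNorm v).trans
        (mul_le_mul_of_nonneg_right (hC _) (norm_nonneg _))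
    calc (ε ^ 3)⁻¹ * (ε⁻¹ * |fderiv ℝ k (ε⁻¹ • y) v|) ≤ (ε ^ 3)⁻¹ * (ε⁻¹ * (C * ‖v‖)) := by gcongr
      _ = C / ε ^ 4 * ‖v‖ := by field_simp

/-- The product of a mollifier in space and a mollifier in time. -/
theorem IsMollifier.mul_time {η : R3 → ℝ} {κ : ℝ → ℝ} {r s : ℝ} (hη : IsMollifier η r)
    (hκ : IsMollifier κ s) : IsMollifier (fun h : R3 × ℝ => η h.1 * κ h.2) (max r s) where
  smooth := (hη.smooth.comp contDiff_fst).mul (hκ.smooth.comp contDiff_snd)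
  nonneg h := mul_nonneg (hη.nonneg _) (hκ.nonneg _)
  even h := by simp [hη.even, hκ.even]
  integral_eq_one := by
    have := integral_prod_mul (μ := (volume : Measure R3)) (ν := (volume : Measure ℝ)) η κ
    rw [hη.integral_eq_one, hκ.integral_eq_one, one_mul] at this
    exact this
  tsupport_subset := by
    refine closure_minimal (fun h hh => ?_) Metric.isClosed_closedBall
    have h1 := hη.tsupport_subset (subset_tsupport _ (left_ne_zero_of_mul hh))
    have h2 := hκ.tsupport_subset (subset_tsupport _ (right_ne_zero_of_mul hh))
    rw [mem_closedBall_zero_iff] at h1 h2 ⊢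
    rw [Prod.norm_def]
    exact max_le_max h1 h2

theorem fderiv_mul_time {η : R3 → ℝ} {κ : ℝ → ℝ} (hη : ContDiff ℝ ∞ η) (hκ : ContDiff ℝ ∞ κ)
    (h : R3 × ℝ) (v : R3) :
    fderiv ℝ (fun h : R3 × ℝ => η h.1 * κ h.2) h (v, 0) = κ h.2 * pd v η h.1 := by
  have h1 : HasFDerivAt (fun h : R3 × ℝ => η h.1)
      ((fderiv ℝ η h.1).comp (ContinuousLinearMap.fst ℝ R3 ℝ)) h :=
    (hη.differentiable (by simp)).differentiableAt.hasFDerivAt.comp h hasFDerivAt_fst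
  have h2 : HasFDerivAt (fun h : R3 × ℝ => κ h.2)
      ((fderiv ℝ κ h.2).comp (ContinuousLinearMap.snd ℝ R3 ℝ)) h :=
    (hκ.differentiable (by simp)).differentiableAt.hasFDerivAt.comp h hasFDerivAt_snd
  rw [(h1.fun_mul h2).fderiv]
  simp [pd]

theorem ennreal_add_pow_three_le (a b : ENNReal) : (a + b) ^ 3 ≤ 8 * (a ^ 3 + b ^ 3) := by
  have key : ∀ a b : ENNReal, a ≤ b → (a + b) ^ 3 ≤ 8 * (a ^ 3 + b ^ 3) := by
    intro a b hab
    calc (a + b) ^ 3 ≤ (2 * b) ^ 3 := by rw [two_mul]; gcongr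
      _ = 8 * b ^ 3 := by rw [mul_pow]; norm_num
      _ ≤ 8 * (a ^ 3 + b ^ 3) := by gcongr; exact le_add_self
  rcases le_total a b with h | h
  · exact key a b h
  · rw [add_comm a, add_comm (a ^ 3)]
    exact key b a h

section defect
variable {V : R3 × ℝ → R3} {η : R3 → ℝ} {κ : ℝ → ℝ} {ε τ A : ℝ}

theorem enorm_defect_le (hη : IsMollifier η (ε / 2)) (hκ : IsMollifier κ τ) (hε : 0 < ε)
    (hA : ∀ v y, |pd v η y| ≤ A * ‖v‖) (z : R3 × ℝ) :
    ‖defect (fun h : R3 × ℝ => η h.1 * κ h.2) V z‖ₑ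
      ≤ ∫⁻ h : R3 × ℝ, (Metric.ball (0 : R3) ε).indicator (fun _ => ENNReal.ofReal A) h.1
        * ENNReal.ofReal (κ h.2) * ‖V z - V (z - h)‖ₑ ^ 3 := by
  have e : ∀ w, ∑ i, (V z i - V w i) * pd (dir i) (fun h : R3 × ℝ => η h.1 * κ h.2) (z - w)
      = κ (z - w).2 * pd (V z - V w) η (z - w).1 := by
    intro w
    rw [← fderiv_mul_time hη.smooth hκ.smooth, fderiv_spatial]
    simp
  unfold defect
  refine (enorm_integral_le_lintegral_enorm _).trans ?_
  rw [← lintegral_sub_left_eq_self _ z]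
  refine lintegral_mono fun h => ?_
  simp only [e]
  simp only [sub_sub_cancel]
  rw [enorm_mul, enorm_mul, enorm_pow, Real.enorm_of_nonneg (hκ.nonneg _)]
  by_cases hh : h.1 ∈ Metric.ball (0 : R3) ε
  · rw [indicator_of_mem hh]
    have h1 : ‖pd (V z - V (z - h)) η h.1‖ₑ ≤ ENNReal.ofReal A * ‖V z - V (z - h)‖ₑ := by
      rw [← ofReal_norm (V z - V (z - h)), ← ofReal_norm,
        ← ENNReal.ofReal_mul' (norm_nonneg _)]
      exact ENNReal.ofReal_le_ofReal (hA _ _)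
    calc ENNReal.ofReal (κ h.2) * ‖pd (V z - V (z - h)) η h.1‖ₑ * ‖‖V z - V (z - h)‖‖ₑ ^ 2
        ≤ ENNReal.ofReal (κ h.2) * (ENNReal.ofReal A * ‖V z - V (z - h)‖ₑ)
          * ‖V z - V (z - h)‖ₑ ^ 2 := by
          rw [enorm_norm]
          gcongr
      _ = _ := by ring
  · have h0 : pd (V z - V (z - h)) η h.1 = 0 := by
      refine image_eq_zero_of_notMem_tsupport fun hmem => hh ?_
      have := hη.tsupport_subset (tsupport_pd_subset _ _ hmem)
      rw [mem_closedBall_zero_iff] at this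
      rw [mem_ball_zero_iff]
      linarith
    simp [h0]

/-- The defect is controlled by the spatial increments of order `ε`, uniformly in the mollification
in time, and by the `L³` modulus of continuity in time. -/
theorem lintegral_enorm_defect_le (hV : Measurable V) (hη : IsMollifier η (ε / 2))
    (hκ : IsMollifier κ τ) (hε : 0 < ε) (hA : ∀ v y, |pd v η y| ≤ A * ‖v‖)
    (K : Set (R3 × ℝ)) {δ : ENNReal}
    (hδ : ∀ s : ℝ, |s| ≤ τ → ∫⁻ z, ‖V z - V (z - (0, s))‖ₑ ^ 3 ≤ δ) :
    ∫⁻ z in K, ‖defect (fun h : R3 × ℝ => η h.1 * κ h.2) V z‖ₑ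
      ≤ 8 * (ENNReal.ofReal A * (∫⁻ z in K, ∫⁻ y in Metric.ball (0 : R3) ε,
          ‖V z - V (z - (y, 0))‖ₑ ^ 3)
        + ENNReal.ofReal A * volume (Metric.ball (0 : R3) ε) * δ) := by
  set Φ : R3 → ENNReal := (Metric.ball (0 : R3) ε).indicator (fun _ => ENNReal.ofReal A) with hΦ
  have hΦm : Measurable Φ := measurable_const.indicator measurableSet_ball
  have hκm0 : Measurable κ := hκ.smooth.continuous.measurable
  have hκm : Measurable fun s => ENNReal.ofReal (κ s) :=
    (ENNReal.continuous_ofReal.comp hκ.smooth.continuous).measurable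
  have hm1 : Measurable fun q : (R3 × ℝ) × (R3 × ℝ) => ‖V q.1 - V (q.1 - (q.2.1, 0))‖ₑ ^ 3 := by
    fun_prop
  have hm2 : Measurable fun q : (R3 × ℝ) × (R3 × ℝ) =>
      ‖V (q.1 - (q.2.1, 0)) - V (q.1 - q.2)‖ₑ ^ 3 := by
    fun_prop
  have hm3 : Measurable fun q : (R3 × ℝ) × (R3 × ℝ) => Φ q.2.1 * ENNReal.ofReal (κ q.2.2) := by
    fun_prop
  have hκ1 : ∫⁻ s, ENNReal.ofReal (κ s) = 1 := hκ.lintegral_eq_one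
  -- the kernel in time has integral one and drops out of the spatial increments
  have b1 : ∀ z, ∫⁻ h : R3 × ℝ, Φ h.1 * ENNReal.ofReal (κ h.2) * ‖V z - V (z - (h.1, 0))‖ₑ ^ 3
      = ENNReal.ofReal A * ∫⁻ y in Metric.ball (0 : R3) ε, ‖V z - V (z - (y, 0))‖ₑ ^ 3 := by
    intro z
    have hmm : Measurable fun y : R3 => ‖V z - V (z - (y, 0))‖ₑ ^ 3 := by fun_prop
    have e1 := lintegral_prod_mul (μ := (volume : Measure R3)) (ν := (volume : Measure ℝ))
      (f := fun y => Φ y * ‖V z - V (z - (y, 0))‖ₑ ^ 3) (g := fun s => ENNReal.ofReal (κ s))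
      (hΦm.mul hmm).aemeasurable hκm.aemeasurable
    rw [hκ1, mul_one] at e1
    calc ∫⁻ h : R3 × ℝ, Φ h.1 * ENNReal.ofReal (κ h.2) * ‖V z - V (z - (h.1, 0))‖ₑ ^ 3
        = ∫⁻ h : R3 × ℝ, Φ h.1 * ‖V z - V (z - (h.1, 0))‖ₑ ^ 3 * ENNReal.ofReal (κ h.2) :=
          lintegral_congr fun h => by ring
      _ = ∫⁻ y, Φ y * ‖V z - V (z - (y, 0))‖ₑ ^ 3 := e1
      _ = ∫⁻ y in Metric.ball (0 : R3) ε, ENNReal.ofReal A * ‖V z - V (z - (y, 0))‖ₑ ^ 3 := by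
          rw [← lintegral_indicator measurableSet_ball]
          refine lintegral_congr fun y => ?_
          by_cases hy : y ∈ Metric.ball (0 : R3) ε <;> simp [hΦ, hy]
      _ = _ := lintegral_const_mul _ hmm
  -- the temporal increments are bounded by the modulus of continuity, by translation invariance
  have b2 : ∫⁻ z, ∫⁻ h : R3 × ℝ, Φ h.1 * ENNReal.ofReal (κ h.2)
        * ‖V (z - (h.1, 0)) - V (z - h)‖ₑ ^ 3
      ≤ ENNReal.ofReal A * volume (Metric.ball (0 : R3) ε) * δ := by
    rw [lintegral_lintegral_swap (hm3.mul hm2).aemeasurable]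
    have e1 := lintegral_prod_mul (μ := (volume : Measure R3)) (ν := (volume : Measure ℝ))
      hΦm.aemeasurable hκm.aemeasurable
    have e2 : ∫⁻ y, Φ y = ENNReal.ofReal A * volume (Metric.ball (0 : R3) ε) := by
      rw [hΦ, lintegral_indicator_const measurableSet_ball]
    rw [hκ1, mul_one, e2] at e1
    calc ∫⁻ h : R3 × ℝ, ∫⁻ z, Φ h.1 * ENNReal.ofReal (κ h.2)
          * ‖V (z - (h.1, 0)) - V (z - h)‖ₑ ^ 3
        ≤ ∫⁻ h : R3 × ℝ, Φ h.1 * ENNReal.ofReal (κ h.2) * δ := by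
          refine lintegral_mono fun h => ?_
          have hmz : Measurable fun z => ‖V (z - (h.1, 0)) - V (z - h)‖ₑ ^ 3 := by fun_prop
          rw [lintegral_const_mul _ hmz]
          by_cases hs : |h.2| ≤ τ
          · refine mul_le_mul_right ((le_of_eq ?_).trans (hδ h.2 hs)) _
            rw [← lintegral_sub_right_eq_self (fun z => ‖V z - V (z - (0, h.2))‖ₑ ^ 3) (h.1, 0)]
            refine lintegral_congr fun z => ?_
            rw [sub_sub, Prod.mk_add_mk, add_zero, zero_add]
          · rw [hκ.eq_zero (by simpa using hs)]
            simp
      _ = (∫⁻ h : R3 × ℝ, Φ h.1 * ENNReal.ofReal (κ h.2)) * δ :=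
          lintegral_mul_const _ (by fun_prop)
      _ = _ := by
          congr 1
  calc ∫⁻ z in K, ‖defect (fun h : R3 × ℝ => η h.1 * κ h.2) V z‖ₑ
      ≤ ∫⁻ z in K, 8 * (ENNReal.ofReal A * (∫⁻ y in Metric.ball (0 : R3) ε,
          ‖V z - V (z - (y, 0))‖ₑ ^ 3) + ∫⁻ h : R3 × ℝ, Φ h.1 * ENNReal.ofReal (κ h.2)
          * ‖V (z - (h.1, 0)) - V (z - h)‖ₑ ^ 3) := by
        refine lintegral_mono fun z => (enorm_defect_le hη hκ hε hA z).trans ?_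
        have hmz1 : Measurable fun h : R3 × ℝ => Φ h.1 * ENNReal.ofReal (κ h.2)
            * ‖V z - V (z - (h.1, 0))‖ₑ ^ 3 := by fun_prop
        have hmz2 : Measurable fun h : R3 × ℝ => Φ h.1 * ENNReal.ofReal (κ h.2)
            * ‖V (z - (h.1, 0)) - V (z - h)‖ₑ ^ 3 := by fun_prop
        have hmz3 := hmz1.add hmz2
        simp only [Pi.add_def] at hmz3
        rw [← b1, ← lintegral_add_left hmz1, ← lintegral_const_mul _ hmz3]
        refine lintegral_mono fun h => ?_
        rw [← mul_add, mul_left_comm]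
        refine mul_le_mul_right ?_ _
        refine le_trans ?_ (ennreal_add_pow_three_le _ _)
        gcongr
        refine le_trans (le_of_eq ?_) (enorm_add_le _ _)
        congr 1
        abel
    _ ≤ _ := by
        have hmb0 : Measurable fun q : (R3 × ℝ) × R3 => ‖V q.1 - V (q.1 - (q.2, 0))‖ₑ ^ 3 := by
          fun_prop
        have hmb1' : Measurable fun z => ∫⁻ y in Metric.ball (0 : R3) ε,
            ‖V z - V (z - (y, 0))‖ₑ ^ 3 := hmb0.lintegral_prod_right'
        have hmb1 : Measurable fun z => ENNReal.ofReal A * ∫⁻ y in Metric.ball (0 : R3) ε,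
            ‖V z - V (z - (y, 0))‖ₑ ^ 3 := hmb1'.const_mul _
        rw [lintegral_const_mul' _ _ (by simp), lintegral_add_left hmb1,
          lintegral_const_mul _ hmb1']
        gcongr
        exact (setLIntegral_le_lintegral _ _).trans b2

end defect

section
variable {V : R3 × ℝ → R3}

/-- The cube of the `L³` norm of the spatial increments of `V` of size less than `ε`, over the
set `K`. -/
def increments (V : R3 × ℝ → R3) (K : Set (R3 × ℝ)) (ε : ℝ) : ENNReal :=
  ∫⁻ z in K, ∫⁻ y in Metric.ball (0 : R3) ε, ‖V z - V (z - (y, 0))‖ₑ ^ 3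

theorem exists_time_modulus (hV3 : MemLp V 3) {δ : ENNReal} (hδ : 0 < δ) :
    ∃ τ : ℝ, 0 < τ ∧ ∀ s : ℝ, |s| ≤ τ → ∫⁻ z, ‖V z - V (z - (0, s))‖ₑ ^ 3 ≤ δ := by
  have hδ' : 0 < min δ 1 := lt_min hδ one_pos
  obtain ⟨t, ht, hsub⟩ := Metric.eventually_nhds_iff.1
    (eventually_eLpNorm_translate_sub_le (by norm_num) (by simp) hV3 hδ')
  refine ⟨t / 2, by positivity, fun s hs => ?_⟩
  have h1 := hsub (y := ((0 : R3), s)) (by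
    rw [dist_zero_right, Prod.norm_def]
    simp only [norm_zero, Real.norm_eq_abs]
    rw [max_eq_right (abs_nonneg _)]
    linarith)
  rw [eLpNorm_eq_lintegral_rpow_enorm_toReal (by simp) (by simp)] at h1
  have h2 : ∫⁻ z, ‖V z - V (z - (0, s))‖ₑ ^ 3
      = ((∫⁻ z, ‖V (z - (0, s)) - V z‖ₑ ^ (3 : ℝ)) ^ (1 / 3 : ℝ)) ^ 3 := by
    rw [← ENNReal.rpow_natCast, ← ENNReal.rpow_mul]
    norm_num
    refine lintegral_congr fun z => ?_
    rw [← enorm_neg, neg_sub]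
  rw [h2]
  have h3 : (∫⁻ z, ‖V (z - (0, s)) - V z‖ₑ ^ (3 : ℝ)) ^ (1 / 3 : ℝ) ≤ min δ 1 := by
    simpa using h1
  calc _ ≤ (min δ 1) ^ 3 := by gcongr
    _ ≤ (min δ 1) ^ 1 := pow_le_pow_right_of_le_one' (min_le_right _ _) (by norm_num)
    _ ≤ δ := by rw [pow_one]; exact min_le_left _ _

/-- Under the critical Besov condition there are mollifiers along which the defect vanishes: the
radius in time is chosen small depending on the radius in space. -/
theorem exists_tendsto_defect (hV : Measurable V) (hV3 : MemLp V 3) {ζ : R3 × ℝ → ℝ}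
    (hζ : Continuous ζ) (hζs : HasCompactSupport ζ)
    (hbes : Tendsto (fun ε : ℝ => increments V (tsupport ζ) ε / ENNReal.ofReal (ε ^ 4))
      (𝓝[>] 0) (𝓝 0)) :
    ∃ (k : ℕ → R3 × ℝ → ℝ) (r : ℕ → ℝ), (∀ n, IsMollifier (k n) (r n)) ∧
      Tendsto r atTop (𝓝 0) ∧
      Tendsto (fun n => ∫ z, ζ z * defect (k n) V z) atTop (𝓝 0) := by
  obtain ⟨C, hC0, hC⟩ := exists_isMollifier_pd_le
  obtain ⟨B, hB⟩ := hζs.exists_bound_of_continuous hζ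
  set ε : ℕ → ℝ := fun n => 1 / ((n : ℝ) + 1) with hεdef
  have hε0 : ∀ n, 0 < ε n := fun n => Nat.one_div_pos_of_nat
  have hεlim : Tendsto ε atTop (𝓝 0) := tendsto_one_div_add_atTop_nhds_zero_nat
  have hεlim' : Tendsto ε atTop (𝓝[>] 0) :=
    tendsto_nhdsWithin_iff.2 ⟨hεlim, Eventually.of_forall hε0⟩
  choose η hη hηA using fun n => hC (ε n) (hε0 n)
  have hδ : ∀ n, ∃ δ : ENNReal, 0 < δ ∧ ENNReal.ofReal (C / ε n ^ 4)
      * volume (Metric.ball (0 : R3) (ε n)) * δ ≤ ENNReal.ofReal (ε n) := by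
    intro n
    have hfin : ENNReal.ofReal (C / ε n ^ 4) * volume (Metric.ball (0 : R3) (ε n)) ≠ ⊤ :=
      ENNReal.mul_ne_top (by simp) measure_ball_lt_top.ne
    obtain ⟨δ, hδ0, hδ⟩ := ENNReal.exists_nnreal_pos_mul_lt hfin
      (by simpa using hε0 n : ENNReal.ofReal (ε n) ≠ 0)
    exact ⟨δ, by simpa using hδ0, by rw [mul_comm]; exact hδ.le⟩
  choose δ hδ0 hδ using hδ
  choose τ hτ0 hτ using fun n => exists_time_modulus hV3 (hδ0 n)
  choose κ hκ using fun n => exists_isMollifier (G := ℝ) (lt_min (hτ0 n) (hε0 n))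
  refine ⟨fun n h => η n h.1 * κ n h.2, fun n => max (ε n / 2) (min (τ n) (ε n)),
    fun n => (hη n).mul_time (hκ n), ?_, ?_⟩
  · refine squeeze_zero (fun n => ?_) (fun n => ?_) hεlim
    · exact le_max_of_le_left (by have := hε0 n; positivity)
    · exact max_le (by have := hε0 n; linarith) (min_le_right _ _)
  · rw [tendsto_zero_iff_enorm_tendsto_zero]
    have hbound : ∀ n, ‖∫ z, ζ z * defect (fun h => η n h.1 * κ n h.2) V z‖ₑ
        ≤ ENNReal.ofReal B * (8 * (ENNReal.ofReal C * (increments V (tsupport ζ) (ε n)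
          / ENNReal.ofReal (ε n ^ 4)) + ENNReal.ofReal (ε n))) := by
      intro n
      have h1 := lintegral_enorm_defect_le hV (hη n) (hκ n) (hε0 n) (hηA n) (tsupport ζ)
        (δ := δ n) fun s hs => hτ n s (hs.trans (min_le_left _ _))
      calc ‖∫ z, ζ z * defect (fun h => η n h.1 * κ n h.2) V z‖ₑ
          ≤ ∫⁻ z, ‖ζ z * defect (fun h => η n h.1 * κ n h.2) V z‖ₑ :=
            enorm_integral_le_lintegral_enorm _
        _ ≤ ∫⁻ z in tsupport ζ, ENNReal.ofReal B
            * ‖defect (fun h => η n h.1 * κ n h.2) V z‖ₑ := by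
            rw [← lintegral_indicator (isClosed_tsupport ζ).measurableSet]
            refine lintegral_mono fun z => ?_
            by_cases hz : z ∈ tsupport ζ
            · rw [indicator_of_mem hz, enorm_mul]
              gcongr
              rw [← ofReal_norm]
              exact ENNReal.ofReal_le_ofReal (hB z)
            · simp [image_eq_zero_of_notMem_tsupport hz]
        _ = ENNReal.ofReal B * ∫⁻ z in tsupport ζ,
            ‖defect (fun h => η n h.1 * κ n h.2) V z‖ₑ := lintegral_const_mul' _ _ (by simp)
        _ ≤ ENNReal.ofReal B * (8 * (ENNReal.ofReal C * (increments V (tsupport ζ) (ε n)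
          / ENNReal.ofReal (ε n ^ 4)) + ENNReal.ofReal (ε n))) := by
            gcongr
            refine h1.trans (mul_le_mul_right (add_le_add (le_of_eq ?_) (hδ n)) _)
            have : 0 < ε n ^ 4 := pow_pos (hε0 n) 4
            rw [ENNReal.ofReal_div_of_pos this, increments]
            simp only [div_eq_mul_inv]
            ring
    have hlim : Tendsto (fun n => ENNReal.ofReal B * (8 * (ENNReal.ofReal C
        * (increments V (tsupport ζ) (ε n) / ENNReal.ofReal (ε n ^ 4)) + ENNReal.ofReal (ε n))))
        atTop (𝓝 (ENNReal.ofReal B * (8 * (ENNReal.ofReal C * 0 + ENNReal.ofReal 0)))) := by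
      refine ENNReal.Tendsto.const_mul (ENNReal.Tendsto.const_mul (Tendsto.add
        (ENNReal.Tendsto.const_mul (hbes.comp hεlim') (Or.inr (by simp)))
        (ENNReal.tendsto_ofReal hεlim)) (Or.inr (by simp))) (Or.inr (by simp))
    simp only [ENNReal.ofReal_zero, mul_zero, add_zero] at hlim
    exact tendsto_of_tendsto_of_tendsto_of_le_of_le tendsto_const_nhds hlim
      (fun _ => zero_le) hbound

end

/-! ### Local cubic integrability -/

theorem exists_cutoff {G : Type*} [NormedAddCommGroup G] [NormedSpace ℝ G]
    [FiniteDimensional ℝ G] [MeasureSpace G] [BorelSpace G]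
    [(volume : Measure G).IsAddHaarMeasure] {J : Set G} (hJ : IsCompact J) {ρ : ℝ} (hρ : 0 < ρ) :
    ∃ θ : G → ℝ, ContDiff ℝ ∞ θ ∧ (∀ z, |θ z| ≤ 1) ∧ (∀ z ∈ J, θ z = 1) ∧
      tsupport θ ⊆ Metric.cthickening ρ J := by
  obtain ⟨k, hk⟩ := exists_isMollifier (G := G) (half_pos hρ)
  set A := Metric.cthickening (ρ / 2) J with hA
  have hAc : IsCompact A := hJ.cthickening
  have hi : Integrable (A.indicator fun _ : G => (1 : ℝ)) :=
    (integrable_indicator_iff hAc.measurableSet).2 (integrableOn_const hAc.measure_lt_top.ne)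
  have hk1 : ∀ z, ∫ w, k (z - w) = 1 := fun z => by
    rw [integral_sub_left_eq_self k volume z, hk.integral_eq_one]
  refine ⟨mol k (A.indicator fun _ => (1 : ℝ)),
    contDiff_mol hk.smooth hk.hasCompactSupport hi, ?_, ?_,
    ?_⟩
  · intro z
    refine le_of_le_of_eq ?_ (hk1 z)
    rw [mol, ← Real.norm_eq_abs]
    refine norm_integral_le_of_norm_le (hk.integrable.comp_sub_left z)
      (Eventually.of_forall fun w => ?_)
    rw [norm_smul, Real.norm_of_nonneg (hk.nonneg _)]
    refine mul_le_of_le_one_right (hk.nonneg _) ?_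
    by_cases hw : w ∈ A <;> simp [hw]
  · intro z hz
    rw [mol_congr hk.tsupport_subset (g := fun _ => (1 : ℝ)) fun w hw => indicator_of_mem
      (Metric.closedBall_subset_cthickening hz _ hw) _]
    simp [mol, hk1]
  · refine (tsupport_mol_subset hk.tsupport_subset (A := A) fun z hz => by simp [hz]).trans ?_
    refine (Metric.cthickening_cthickening_subset (by positivity) (by positivity) J).trans ?_
    rw [add_halves]

/-- A function on the line all of whose mollifications are bounded by `M` is itself bounded
by `M`. -/
theorem ae_norm_le_of_mol_le {F : ℝ → R3} (hF : Integrable F) {M : ℝ}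
    (hM : ∀ (κ : ℝ → ℝ) (τ t : ℝ), IsMollifier κ τ → ‖mol κ F t‖ ≤ M) : ∀ᵐ t, ‖F t‖ ≤ M := by
  let φ : ℕ → ContDiffBump (0 : ℝ) := fun n =>
    ⟨1 / ((n : ℝ) + 1) / 2, 1 / ((n : ℝ) + 1), by positivity, by
      have : (0 : ℝ) < 1 / ((n : ℝ) + 1) := Nat.one_div_pos_of_nat
      linarith⟩
  have h1 : Tendsto (fun n => (φ n).rOut) atTop (𝓝 0) := tendsto_one_div_add_atTop_nhds_zero_nat
  have h2 : ∀ᶠ n in atTop, (φ n).rOut ≤ 2 * (φ n).rIn := Eventually.of_forall fun n => by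
    change 1 / ((n : ℝ) + 1) ≤ 2 * (1 / ((n : ℝ) + 1) / 2)
    linarith
  filter_upwards [ContDiffBump.ae_convolution_tendsto_right_of_locallyIntegrable (μ := volume)
    h1 h2 hF.locallyIntegrable] with t ht
  refine le_of_tendsto ht.norm (Eventually.of_forall fun n => ?_)
  rw [← mol_eq_convolution]
  exact hM _ ((φ n).rOut) t ⟨(φ n).contDiff_normed, (φ n).nonneg_normed, (φ n).normed_neg,
    (φ n).integral_normed, (φ n).tsupport_normed_eq.subset⟩

/-- A bounded primitive of a mollifier. -/
theorem IsMollifier.exists_primitive {κ : ℝ → ℝ} {τ : ℝ} (hκ : IsMollifier κ τ) (t : ℝ) :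
    ∃ Ψ : ℝ → ℝ, ContDiff ℝ ∞ Ψ ∧ (∀ s, |Ψ s| ≤ 1) ∧ ∀ s, deriv Ψ s = κ (t - s) := by
  have hc : Continuous fun s => κ (t - s) := hκ.smooth.continuous.comp (by fun_prop)
  have hd : ∀ s, HasDerivAt (fun s => ∫ q in (0 : ℝ)..s, κ (t - q)) (κ (t - s)) s := fun s =>
    intervalIntegral.integral_hasDerivAt_right (hc.intervalIntegrable _ _)
      (hc.stronglyMeasurableAtFilter _ _) hc.continuousAt
  have hd' : (deriv fun s => ∫ q in (0 : ℝ)..s, κ (t - q)) = fun s => κ (t - s) :=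
    funext fun s => (hd s).deriv
  refine ⟨fun s => ∫ q in (0 : ℝ)..s, κ (t - q), ?_, fun s => ?_, fun s => (hd s).deriv⟩
  · rw [contDiff_infty_iff_deriv]
    refine ⟨fun s => (hd s).differentiableAt, ?_⟩
    rw [hd']
    exact hκ.smooth.comp (contDiff_const.sub contDiff_id)
  · have h1 : Integrable fun q => κ (t - q) := hκ.integrable.comp_sub_left t
    have h2 : ∫ q, κ (t - q) = 1 := by
      rw [integral_sub_left_eq_self κ volume t, hκ.integral_eq_one]
    rw [← Real.norm_eq_abs]
    refine intervalIntegral.norm_integral_le_integral_norm_uIoc.trans ?_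
    rw [← h2]
    refine (setIntegral_le_integral h1.norm (Eventually.of_forall fun q => norm_nonneg _)).trans ?_
    refine integral_mono h1.norm h1 fun q => ?_
    simp only
    rw [Real.norm_of_nonneg (hκ.nonneg _)]

theorem pd_mul_time_dir {η : R3 → ℝ} {κ : ℝ → ℝ} (hη : ContDiff ℝ ∞ η) (hκ : ContDiff ℝ ∞ κ)
    (i : Fin 3) (h : R3 × ℝ) : pd (dir i) (fun h : R3 × ℝ => η h.1 * κ h.2) h
      = κ h.2 * pd (EuclideanSpace.single i 1) η h.1 :=
  fderiv_mul_time hη hκ h _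

theorem pd_mul_time_time {η : R3 → ℝ} {κ : ℝ → ℝ} (hη : ContDiff ℝ ∞ η) (hκ : ContDiff ℝ ∞ κ)
    (h : R3 × ℝ) : pd (0, 1) (fun h : R3 × ℝ => η h.1 * κ h.2) h = η h.1 * deriv κ h.2 := by
  have h1 : HasFDerivAt (fun h : R3 × ℝ => η h.1)
      ((fderiv ℝ η h.1).comp (ContinuousLinearMap.fst ℝ R3 ℝ)) h :=
    (hη.differentiable (by simp)).differentiableAt.hasFDerivAt.comp h hasFDerivAt_fst
  have h2 : HasFDerivAt (fun h : R3 × ℝ => κ h.2)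
      ((fderiv ℝ κ h.2).comp (ContinuousLinearMap.snd ℝ R3 ℝ)) h :=
    (hκ.differentiable (by simp)).differentiableAt.hasFDerivAt.comp h hasFDerivAt_snd
  rw [pd, (h1.fun_mul h2).fderiv]
  simp

section
variable {S : Set (R3 × ℝ)} {V : R3 × ℝ → R3} {P : R3 × ℝ → ℝ}

theorem IsLocalSolution.momentum_scalar (h : IsLocalSolution S V P) {g : R3 × ℝ → ℝ}
    (hg : ContDiff ℝ ∞ g) (hgs : HasCompactSupport g) (hgS : tsupport g ⊆ S) (i : Fin 3) :
    ∫ z, (V z i * pd (0, 1) g z + (∑ j, V z j * (V z i * pd (dir j) g z))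
      + P z * pd (dir i) g z) = 0 := by
  have hsm : tsupport (fun z => g z • (EuclideanSpace.single i 1 : R3)) ⊆ tsupport g :=
    tsupport_smul_subset_left g _
  have h1 := h.momentum_coord (φ := fun z => g z • (EuclideanSpace.single i 1 : R3))
    (hg.smul contDiff_const) (hgs.of_isClosed_subset (isClosed_tsupport _) hsm) (hsm.trans hgS)
  have hpd : ∀ e z, pd e (fun z => g z • (EuclideanSpace.single i 1 : R3)) z
      = pd e g z • (EuclideanSpace.single i 1 : R3) := by
    intro e z
    have := (hg.differentiable (by simp)).differentiableAt (x := z)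
    simp [pd, fderiv_smul_const this]
  simp only [hpd, inner_smul_right] at h1
  rw [← h1]
  refine integral_congr_ae (Eventually.of_forall fun z => ?_)
  have hin : inner ℝ (V z) (EuclideanSpace.single i (1 : ℝ)) = V z i := by
    simpa using EuclideanSpace.inner_single_right i (1 : ℝ) (V z)
  simp [hin, mul_comm]

/-- Testing the momentum equation with `η(x - y) θ(s) Ψ(s)`, where `Ψ` is a bounded primitive of a
mollifier in time, bounds the mollification in space and time of `V`, uniformly in the mollifier in
time. -/
theorem IsLocalSolution.exists_bound_integral (h : IsLocalSolution S V P) {η : R3 → ℝ} {r : ℝ}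
    (hη : IsMollifier η r) {θ : ℝ → ℝ} (hθ : ContDiff ℝ ∞ θ) (hθs : HasCompactSupport θ)
    (hθ1 : ∀ s, |θ s| ≤ 1) :
    ∃ M : ℝ, ∀ (x : R3) (κ : ℝ → ℝ) (τ t : ℝ), IsMollifier κ τ →
      Metric.closedBall x r ×ˢ tsupport θ ⊆ S →
      ∀ i, |∫ z : R3 × ℝ, η (x - z.1) * (θ z.2 * κ (t - z.2)) * V z i| ≤ M := by
  obtain ⟨B0, hB0⟩ := hη.hasCompactSupport.exists_bound_of_continuous hη.smooth.continuous
  have hB0' : 0 ≤ B0 := (norm_nonneg _).trans (hB0 0)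
  have hBi : ∀ i : Fin 3, ∃ B, ∀ y, ‖pd (EuclideanSpace.single i (1 : ℝ)) η y‖ ≤ B := fun i =>
    (hasCompactSupport_pd hη.hasCompactSupport _).exists_bound_of_continuous
      (contDiff_pd hη.smooth _).continuous
  choose B hB using hBi
  have hBn : ∀ i, 0 ≤ B i := fun i => (norm_nonneg _).trans (hB i 0)
  obtain ⟨Bθ, hBθ⟩ := hθs.deriv.exists_bound_of_continuous (hθ.continuous_deriv (by simp))
  have hBθ' : 0 ≤ Bθ := (norm_nonneg _).trans (hBθ 0)
  have hmaj : Integrable fun z => ‖V z‖ * (B0 * Bθ) + ‖V z‖ ^ 2 * ∑ j, B j + |P z| * ∑ j, B j :=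
    ((h.integrable_velocity.norm.mul_const _).add
      ((integrable_sq h.memLp_velocity).mul_const _)).add (h.integrable_pressure.norm.mul_const _)
  refine ⟨∫ z, (‖V z‖ * (B0 * Bθ) + ‖V z‖ ^ 2 * ∑ j, B j + |P z| * ∑ j, B j),
    fun x κ τ t hκ hS i => ?_⟩
  obtain ⟨Ψ, hΨ, hΨ1, hΨd⟩ := hκ.exists_primitive t
  have hηx : ContDiff ℝ ∞ fun y => η (x - y) := hη.smooth.comp (contDiff_const.sub contDiff_id)
  have hθΨ : ContDiff ℝ ∞ fun s => θ s * Ψ s := hθ.mul hΨ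
  set g : R3 × ℝ → ℝ := fun z => η (x - z.1) * (θ z.2 * Ψ z.2) with hgdef
  have hg : ContDiff ℝ ∞ g := (hηx.comp contDiff_fst).mul (hθΨ.comp contDiff_snd)
  have hgsup : tsupport g ⊆ Metric.closedBall x r ×ˢ tsupport θ := by
    refine closure_minimal (fun z hz => ?_) (Metric.isClosed_closedBall.prod (isClosed_tsupport θ))
    have h1 := hη.tsupport_subset (subset_tsupport _ (left_ne_zero_of_mul hz))
    have h2 := subset_tsupport _ (left_ne_zero_of_mul (right_ne_zero_of_mul hz))
    refine ⟨?_, h2⟩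
    simpa [dist_eq_norm, norm_sub_rev] using h1
  have hgs : HasCompactSupport g :=
    ((isCompact_closedBall x r).prod hθs).of_isClosed_subset (isClosed_tsupport g) hgsup
  have hm := h.momentum_scalar hg hgs (hgsup.trans hS) i
  have hpt : ∀ z, pd (0, 1) g z = η (x - z.1) * (deriv θ z.2 * Ψ z.2)
      + η (x - z.1) * (θ z.2 * κ (t - z.2)) := by
    intro z
    rw [hgdef, pd_mul_time_time hηx hθΨ, deriv_fun_mul
      (hθ.differentiable (by simp)).differentiableAt
      (hΨ.differentiable (by simp)).differentiableAt, hΨd]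
    ring
  have hpj : ∀ j z, |pd (dir j) g z| ≤ B j := by
    intro j z
    rw [hgdef, pd_mul_time_dir hηx hθΨ, pd_reflect hη.smooth, abs_mul, abs_mul, abs_neg]
    calc |θ z.2| * |Ψ z.2| * |pd (EuclideanSpace.single j 1) η (x - z.1)|
        ≤ 1 * 1 * B j := by
          gcongr
          · exact hθ1 _
          · exact hΨ1 _
          · exact hB j _
      _ = B j := by ring
  set R : R3 × ℝ → ℝ := fun z => V z i * (η (x - z.1) * (deriv θ z.2 * Ψ z.2))
    + (∑ j, V z j * (V z i * pd (dir j) g z)) + P z * pd (dir i) g z with hR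
  have hRb : ∀ z, ‖R z‖ ≤ ‖V z‖ * (B0 * Bθ) + ‖V z‖ ^ 2 * ∑ j, B j + |P z| * ∑ j, B j := by
    intro z
    refine (norm_add_le _ _).trans (add_le_add ((norm_add_le _ _).trans (add_le_add ?_ ?_)) ?_)
    · simp only [norm_mul, Real.norm_eq_abs]
      have e1 := abs_coord_le (V z) i
      have e2 := hB0 (x - z.1)
      have e3 := hBθ z.2
      have e4 := hΨ1 z.2
      rw [Real.norm_eq_abs] at e2 e3
      calc |V z i| * (|η (x - z.1)| * (|deriv θ z.2| * |Ψ z.2|))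
          ≤ ‖V z‖ * (B0 * (Bθ * 1)) := by gcongr
        _ = _ := by ring
    · rw [Finset.mul_sum]
      refine (norm_sum_le _ _).trans (Finset.sum_le_sum fun j _ => ?_)
      simp only [norm_mul, Real.norm_eq_abs]
      calc |V z j| * (|V z i| * |pd (dir j) g z|) ≤ ‖V z‖ * (‖V z‖ * B j) := by
            gcongr
            · exact abs_coord_le _ j
            · exact abs_coord_le _ i
            · exact hpj j z
        _ = _ := by ring
    · simp only [norm_mul, Real.norm_eq_abs]
      gcongr
      exact (hpj i z).trans (Finset.single_le_sum (fun j _ => hBn j) (Finset.mem_univ i))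
  have hVm := h.integrable_velocity.1
  have hRi : Integrable R := by
    refine hmaj.mono' ?_ (Eventually.of_forall hRb)
    have c1 : Continuous fun z : R3 × ℝ => η (x - z.1) * (deriv θ z.2 * Ψ z.2) := by
      have := hη.smooth.continuous
      have := hθ.continuous_deriv (by simp)
      have := hΨ.continuous
      fun_prop
    refine (((aestronglyMeasurable_coord hVm i).mul c1.aestronglyMeasurable).add ?_).add
      (h.integrable_pressure.1.mul (contDiff_pd hg _).continuous.aestronglyMeasurable)
    exact Finset.aestronglyMeasurable_fun_sum _ fun j _ => (aestronglyMeasurable_coord hVm j).mul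
      ((aestronglyMeasurable_coord hVm i).mul (contDiff_pd hg _).continuous.aestronglyMeasurable)
  have hQi : Integrable fun z : R3 × ℝ => η (x - z.1) * (θ z.2 * κ (t - z.2)) * V z i := by
    have c1 : Continuous fun z : R3 × ℝ => η (x - z.1) * (θ z.2 * κ (t - z.2)) := by
      have := hη.smooth.continuous
      have := hθ.continuous
      have := hκ.smooth.continuous
      fun_prop
    obtain ⟨Bκ, hBκ⟩ := hκ.hasCompactSupport.exists_bound_of_continuous hκ.smooth.continuous
    refine (integrable_coord h.integrable_velocity i).bdd_mul (c := B0 * (1 * Bκ))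
      c1.aestronglyMeasurable (Eventually.of_forall fun z => ?_)
    simp only [norm_mul]
    gcongr
    · exact hB0 _
    · exact hθ1 _
    · exact hBκ _
  have hsplit := ((HasInt.of_integrable hQi).add (HasInt.of_integrable hRi)).congr
    (g := fun z => V z i * pd (0, 1) g z + (∑ j, V z j * (V z i * pd (dir j) g z))
      + P z * pd (dir i) g z) fun z => by
    rw [hpt, hR]
    ring
  have hfin := hsplit.2.symm.trans hm
  rw [eq_neg_of_add_eq_zero_left hfin, abs_neg]
  exact norm_integral_le_of_norm_le hmaj (Eventually.of_forall hRb)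

end

section
variable {S : Set (R3 × ℝ)} {V : R3 × ℝ → R3} {P : R3 × ℝ → ℝ}

theorem norm_le_of_abs_coord_le {v : R3} {M : ℝ} (h : ∀ i, |v i| ≤ M) : ‖v‖ ≤ 3 * M := by
  have h1 : v = ∑ i, v i • EuclideanSpace.single i (1 : ℝ) := by
    ext j
    simp [Finset.sum_apply, Pi.single_apply]
  rw [h1]
  refine (norm_sum_le _ _).trans ?_
  refine (Finset.sum_le_card_nsmul _ _ M fun i _ => ?_).trans (by simp)
  rw [norm_smul]
  simpa using h i

theorem ennreal_lintegral_cube_le {G : Type*} [MeasurableSpace G] (μ : Measure G)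
    {g : G → ENNReal} (hg : AEMeasurable g μ) :
    (∫⁻ y, g y ∂μ) ^ 3 ≤ μ univ ^ 2 * ∫⁻ y, g y ^ 3 ∂μ := by
  have hpq : Real.HolderConjugate (3 : ℝ) (3 / 2) := by
    rw [Real.holderConjugate_iff]
    norm_num
  have h1 := ENNReal.lintegral_mul_le_Lp_mul_Lq μ hpq hg (g := fun _ => 1) aemeasurable_const
  simp only [Pi.mul_def, mul_one, ENNReal.one_rpow, lintegral_const, one_mul] at h1
  calc (∫⁻ y, g y ∂μ) ^ 3
      ≤ ((∫⁻ y, g y ^ (3 : ℝ) ∂μ) ^ (1 / (3 : ℝ)) * μ univ ^ (1 / (3 / 2 : ℝ))) ^ 3 := by gcongr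
    _ = _ := by
        rw [mul_pow, ← ENNReal.rpow_natCast, ← ENNReal.rpow_natCast (μ univ ^ _),
          ← ENNReal.rpow_mul, ← ENNReal.rpow_mul, mul_comm]
        norm_num

/-- The velocity, mollified in space only, is bounded on compact sets: its time derivative is
integrable by the momentum equation. -/
theorem IsLocalSolution.exists_bound_space_mol (h : IsLocalSolution S V P) {η : R3 → ℝ} {r ρ : ℝ}
    (hη : IsMollifier η r) {Kx : Set R3} {J : Set ℝ} (hJ : IsCompact J) (hρ : 0 < ρ) (hr : r ≤ ρ)
    (hS : Metric.cthickening ρ Kx ×ˢ Metric.cthickening ρ J ⊆ S) :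
    ∃ M : ℝ, ∀ x ∈ Kx, ∀ᵐ t, t ∈ J → ‖mol η (fun y => V (y, t)) x‖ ≤ M := by
  obtain ⟨θ, hθ, hθ1, hθJ, hθs⟩ := exists_cutoff hJ hρ
  have hθc : HasCompactSupport θ := hJ.cthickening.of_isClosed_subset (isClosed_tsupport θ) hθs
  obtain ⟨M, hM⟩ := h.exists_bound_integral hη hθ hθc hθ1
  refine ⟨3 * M, fun x hx => ?_⟩
  have hsub : Metric.closedBall x r ×ˢ tsupport θ ⊆ S := by
    refine (prod_mono ?_ hθs).trans hS
    exact (Metric.closedBall_subset_closedBall hr).trans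
      (Metric.closedBall_subset_cthickening hx ρ)
  obtain ⟨B, hB⟩ := hη.hasCompactSupport.exists_bound_of_continuous hη.smooth.continuous
  have hi : Integrable fun z : R3 × ℝ => η (x - z.1) • V z := by
    refine h.integrable_velocity.bdd_smul B ?_ (Eventually.of_forall fun z => hB _)
    have := hη.smooth.continuous
    exact (by fun_prop : Continuous fun z : R3 × ℝ => η (x - z.1)).aestronglyMeasurable
  have hF1 : Integrable fun s => mol η (fun y => V (y, s)) x := hi.integral_prod_right
  have hF : Integrable fun s => θ s • mol η (fun y => V (y, s)) x :=
    hF1.bdd_smul 1 hθ.continuous.aestronglyMeasurable (Eventually.of_forall hθ1)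
  have hae := ae_norm_le_of_mol_le hF (M := 3 * M) fun κ τ t hκ =>
    norm_le_of_abs_coord_le fun i => by
    rw [mol_apply hκ.smooth.continuous hκ.hasCompactSupport hF]
    refine le_of_eq_of_le ?_ (hM x κ τ t hκ hsub i)
    congr 1
    have hQ : Integrable fun z : R3 × ℝ => η (x - z.1) * (θ z.2 * κ (t - z.2)) * V z i := by
      have c1 : Continuous fun z : R3 × ℝ => θ z.2 * κ (t - z.2) := by
        have := hθ.continuous
        have := hκ.smooth.continuous
        fun_prop
      obtain ⟨Bκ, hBκ⟩ := hκ.hasCompactSupport.exists_bound_of_continuous hκ.smooth.continuous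
      have := (integrable_coord hi i).bdd_mul (c := 1 * Bκ) c1.aestronglyMeasurable
        (Eventually.of_forall fun z => by
          rw [norm_mul]
          gcongr
          · exact hθ1 _
          · exact hBκ _)
      refine this.congr (Eventually.of_forall fun z => ?_)
      simp only [PiLp.smul_apply, smul_eq_mul]
      ring
    rw [show (∫ z : R3 × ℝ, η (x - z.1) * (θ z.2 * κ (t - z.2)) * V z i)
      = ∫ s, ∫ y, η (x - y) * (θ s * κ (t - s)) * V (y, s) i from integral_prod_symm _ hQ, mol]
    refine integral_congr_ae ?_
    filter_upwards [h.integrable_velocity.prod_left_ae] with s hs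
    simp only [PiLp.smul_apply]
    rw [mol_apply hη.smooth.continuous hη.hasCompactSupport hs, mol]
    simp only [smul_eq_mul]
    rw [← mul_assoc, ← integral_const_mul]
    refine integral_congr_ae (Eventually.of_forall fun y => ?_)
    ring
  filter_upwards [hae] with t ht htJ
  simpa [hθJ t htJ] using ht

/-- The critical Besov condition upgrades local square integrability to local cubic
integrability. -/
theorem IsLocalSolution.lintegral_cube_lt_top (h : IsLocalSolution S V P) (hVm : Measurable V)
    {Kx : Set R3} (hKx : IsCompact Kx) {J : Set ℝ} (hJ : IsCompact J) {ρ : ℝ} (hρ : 0 < ρ)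
    (hS : Metric.cthickening ρ Kx ×ˢ Metric.cthickening ρ J ⊆ S) {ε : ℝ} (hε : 0 < ε)
    (hερ : ε ≤ ρ) (hinc : increments V (Kx ×ˢ J) ε < ⊤) :
    ∫⁻ z in Kx ×ˢ J, ‖V z‖ₑ ^ 3 < ⊤ := by
  obtain ⟨η, hη⟩ := exists_isMollifier (G := R3) (half_pos hε)
  obtain ⟨M, hM⟩ := h.exists_bound_space_mol hη hJ hρ (by linarith) hS
  obtain ⟨B, hB⟩ := hη.hasCompactSupport.exists_bound_of_continuous hη.smooth.continuous
  have hηm : Measurable η := hη.smooth.continuous.measurable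
  set W : R3 × ℝ → R3 := fun z => mol η (fun y => V (y, z.2)) z.1 with hW
  have hWm : Measurable W := by
    have h1 : Measurable fun q : (R3 × ℝ) × R3 => η (q.1.1 - q.2) • V (q.2, q.1.2) := by
      fun_prop
    exact (h1.stronglyMeasurable.integral_prod_right').measurable
  have hprod : (volume.restrict (Kx ×ˢ J) : Measure (R3 × ℝ))
      = (volume.restrict Kx).prod (volume.restrict J) := by
    rw [Measure.prod_restrict]
    rfl
  -- the mollification is bounded on the compact set
  have b1 : ∫⁻ z in Kx ×ˢ J, ‖W z‖ₑ ^ 3 < ⊤ := by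
    rw [hprod, lintegral_prod _ (hWm.enorm.pow_const 3).aemeasurable]
    calc ∫⁻ x in Kx, ∫⁻ t in J, ‖W (x, t)‖ₑ ^ 3
        ≤ ∫⁻ x in Kx, ∫⁻ t in J, ENNReal.ofReal M ^ 3 := by
          refine setLIntegral_mono' hKx.measurableSet fun x hx => ?_
          refine lintegral_mono_ae ?_
          filter_upwards [ae_restrict_of_ae (hM x hx), ae_restrict_mem hJ.measurableSet]
            with t ht htJ
          gcongr
          rw [← ofReal_norm]
          exact ENNReal.ofReal_le_ofReal (ht htJ)
      _ < ⊤ := by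
          simp only [lintegral_const, Measure.restrict_apply_univ]
          exact ENNReal.mul_lt_top (ENNReal.mul_lt_top (by simp) hJ.measure_lt_top)
            hKx.measure_lt_top
  -- the difference is controlled by the increments
  have b2 : ∀ᵐ z : R3 × ℝ, ‖W z - V z‖ₑ ^ 3 ≤ ENNReal.ofReal B ^ 3
      * (volume (Metric.ball (0 : R3) ε) ^ 2
        * ∫⁻ y in Metric.ball (0 : R3) ε, ‖V z - V (z - (y, 0))‖ₑ ^ 3) := by
    have hslice : ∀ᵐ z : R3 × ℝ, Integrable fun y => V (y, z.2) :=
      (Measure.quasiMeasurePreserving_snd (μ := (volume : Measure R3))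
        (ν := (volume : Measure ℝ))).ae h.integrable_velocity.prod_left_ae
    filter_upwards [hslice] with z hz
    have h1 := hη.enorm_mol_sub_le hz z.1
    have hmz : Measurable fun y : R3 => ‖V z - V (z - (y, 0))‖ₑ := by fun_prop
    have h2 : ‖W z - V z‖ₑ ≤ ENNReal.ofReal B
        * ∫⁻ y in Metric.ball (0 : R3) ε, ‖V z - V (z - (y, 0))‖ₑ := by
      refine h1.trans ?_
      rw [← lintegral_const_mul _ hmz, ← lintegral_indicator measurableSet_ball]
      refine lintegral_mono fun y => ?_
      by_cases hy : y ∈ Metric.ball (0 : R3) ε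
      · rw [indicator_of_mem hy]
        have e1 : V (z.1 - y, z.2) - V (z.1, z.2) = -(V z - V (z - (y, 0))) := by
          rw [neg_sub]
          congr 2
          ext <;> simp
        rw [e1, enorm_neg]
        gcongr
        exact (le_abs_self _).trans (hB y)
      · rw [hη.eq_zero (by
          rw [mem_ball_zero_iff, not_lt] at hy
          linarith)]
        simp
    calc ‖W z - V z‖ₑ ^ 3 ≤ (ENNReal.ofReal B
        * ∫⁻ y in Metric.ball (0 : R3) ε, ‖V z - V (z - (y, 0))‖ₑ) ^ 3 := by gcongr
      _ ≤ _ := by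
        rw [mul_pow]
        refine mul_le_mul_right ?_ _
        refine (ennreal_lintegral_cube_le _ hmz.aemeasurable).trans ?_
        rw [Measure.restrict_apply_univ]
  have b3 : ∫⁻ z in Kx ×ˢ J, ‖W z - V z‖ₑ ^ 3 < ⊤ := by
    refine (lintegral_mono_ae (ae_restrict_of_ae b2)).trans_lt ?_
    rw [lintegral_const_mul' _ _ (by simp),
      lintegral_const_mul' _ _ (ENNReal.pow_ne_top measure_ball_lt_top.ne)]
    exact ENNReal.mul_lt_top (by simp)
      (ENNReal.mul_lt_top (ENNReal.pow_lt_top measure_ball_lt_top) hinc)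
  calc ∫⁻ z in Kx ×ˢ J, ‖V z‖ₑ ^ 3
      ≤ ∫⁻ z in Kx ×ˢ J, 8 * (‖W z‖ₑ ^ 3 + ‖W z - V z‖ₑ ^ 3) := by
        refine lintegral_mono fun z => le_trans ?_ (ennreal_add_pow_three_le _ _)
        gcongr
        calc ‖V z‖ₑ = ‖W z - (W z - V z)‖ₑ := by rw [sub_sub_cancel]
          _ ≤ _ := enorm_sub_le
    _ = 8 * ((∫⁻ z in Kx ×ˢ J, ‖W z‖ₑ ^ 3) + ∫⁻ z in Kx ×ˢ J, ‖W z - V z‖ₑ ^ 3) := by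
        rw [lintegral_const_mul' _ _ (by simp), lintegral_add_left (hWm.enorm.pow_const 3)]
    _ < ⊤ := ENNReal.mul_lt_top (by simp) (ENNReal.add_lt_top.2 ⟨b1, b3⟩)

end

/-! ### The local energy equality -/

section
variable {Ω : Set R3} {T : ℝ} {u v : R3 × ℝ → R3} {p : R3 × ℝ → ℝ}

theorem IsWeakEulerSolution.aestronglyMeasurable (hΩ : IsOpen Ω)
    (h : IsWeakEulerSolution Ω T u p) :
    AEStronglyMeasurable u (volume.restrict (Ω ×ˢ Ioo 0 T)) := by
  refine LocallyIntegrableOn.aestronglyMeasurable ?_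
  rw [locallyIntegrableOn_iff (hΩ.prod isOpen_Ioo).isLocallyClosed]
  intro K hKs hK
  have : IsFiniteMeasure (volume.restrict K) := ⟨by
    rw [Measure.restrict_apply_univ]; exact hK.measure_lt_top⟩
  exact (h.memLp_velocity K hK hKs).integrable (by norm_num)

/-- Truncation of a weak solution to a compact subset of the space-time domain; `v` is a measurable
representative of the velocity. -/
theorem IsWeakEulerSolution.isLocalSolution (hΩ : IsOpen Ω) (h : IsWeakEulerSolution Ω T u p)
    (huv : u =ᵐ[volume.restrict (Ω ×ˢ Ioo 0 T)] v) {S : Set (R3 × ℝ)} (hS : IsCompact S)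
    (hSΩ : S ⊆ Ω ×ˢ Ioo 0 T) : IsLocalSolution S (S.indicator v) (S.indicator p) := by
  have hQ : MeasurableSet (Ω ×ˢ Ioo 0 T) := (hΩ.prod isOpen_Ioo).measurableSet
  have hL2 : MemLp v 2 (volume.restrict S) :=
    (memLp_congr_ae (ae_restrict_of_ae_restrict_of_subset hSΩ huv)).1 (h.memLp_velocity S hS hSΩ)
  have hfin : IsFiniteMeasure (volume.restrict S) := ⟨by
    rw [Measure.restrict_apply_univ]; exact hS.measure_lt_top⟩
  have hne : ∀ {F : Type} [NormedAddCommGroup F] [NormedSpace ℝ F] (φ : R3 × ℝ → F),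
      tsupport φ ⊆ S → ∀ z, z ∉ S → fderiv ℝ φ z = 0 := fun φ hφ z hz =>
    image_eq_zero_of_notMem_tsupport fun h => hz (hφ (tsupport_fderiv_subset ℝ h))
  refine ⟨?_, ?_, ?_, ?_, ?_⟩
  · rw [integrable_indicator_iff hS.measurableSet]
    exact hL2.integrable (by norm_num)
  · rwa [memLp_indicator_iff_restrict hS.measurableSet]
  · rw [integrable_indicator_iff hS.measurableSet]
    exact h.integrable_pressure S hS hSΩ
  · intro φ hφ hφs hφS
    refine Eq.trans ?_ (h.momentum φ hφ hφs (hφS.trans hSΩ))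
    rw [← setIntegral_eq_integral_of_forall_compl_eq_zero (s := Ω ×ˢ Ioo 0 T)]
    · refine integral_congr_ae ?_
      filter_upwards [huv] with z hz
      by_cases hzS : z ∈ S
      · simp only [hzS, indicator_of_mem, hz]
      · simp [divx, hne φ hφS z hzS]
    · intro z hz
      simp [divx, hne φ hφS z fun h => hz (hSΩ h)]
  · intro ψ hψ hψs hψS
    refine Eq.trans ?_ (h.divergence_free ψ hψ hψs (hψS.trans hSΩ))
    rw [← setIntegral_eq_integral_of_forall_compl_eq_zero (s := Ω ×ˢ Ioo 0 T)]
    · refine integral_congr_ae ?_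
      filter_upwards [huv] with z hz
      by_cases hzS : z ∈ S
      · simp only [hzS, indicator_of_mem, hz]
      · simp [hne ψ hψS z hzS]
    · intro z hz
      simp [hne ψ hψS z fun h => hz (hSΩ h)]

theorem ofReal_cube_div {ε : ℝ} (hε : 0 < ε) (a : R3) :
    ENNReal.ofReal (‖a‖ ^ 3 / ε ^ 4) = ‖a‖ₑ ^ 3 / ENNReal.ofReal (ε ^ 4) := by
  rw [ENNReal.ofReal_div_of_pos (by positivity), ENNReal.ofReal_pow (norm_nonneg _), ofReal_norm]

/-- The increments of a truncation are those of the velocity itself, away from the edge of the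
truncation. -/
theorem increments_indicator_le (hv : Measurable v)
    (huv : u =ᵐ[volume.restrict (Ω ×ˢ Ioo 0 T)] v) (hΩ : IsOpen Ω)
    {Kx Kx' : Set R3} {J : Set ℝ} (hKx : IsCompact Kx) (hJm : MeasurableSet J) {ρ : ℝ}
    (hK' : Metric.cthickening ρ Kx ⊆ Kx') (hK'm : MeasurableSet Kx') {J' : Set ℝ}
    (hJ'm : MeasurableSet J') (hJJ' : J ⊆ J') (hK'Ω : Kx' ⊆ Ω) (hJT : J ⊆ Ioo 0 T)
    {ε : ℝ} (hε : 0 < ε) (hερ : ε ≤ ρ) :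
    increments ((Kx' ×ˢ J').indicator v) (Kx ×ˢ J) ε / ENNReal.ofReal (ε ^ 4)
      ≤ ∫⁻ t in Ioo 0 T, ∫⁻ x in Kx, ∫⁻ y in Metric.ball (0 : R3) ε,
        ENNReal.ofReal (‖u (x, t) - u (x - y, t)‖ ^ 3 / ε ^ 4) := by
  set V := (Kx' ×ˢ J').indicator v with hV
  have hVm : Measurable V := hv.indicator (hK'm.prod hJ'm)
  have hprod : (volume.restrict (Kx ×ˢ J) : Measure (R3 × ℝ))
      = (volume.restrict Kx).prod (volume.restrict J) := by
    rw [Measure.prod_restrict]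
    rfl
  have hm : Measurable fun q : (R3 × ℝ) × R3 => ‖V q.1 - V (q.1 - (q.2, 0))‖ₑ ^ 3 := by
    fun_prop
  have hm' : Measurable fun z : R3 × ℝ => ∫⁻ y in Metric.ball (0 : R3) ε,
      ‖V z - V (z - (y, 0))‖ₑ ^ 3 := hm.lintegral_prod_right'
  have huv' : ∀ᵐ t, ∀ᵐ x, (x, t) ∈ Ω ×ˢ Ioo 0 T → u (x, t) = v (x, t) := by
    rw [Filter.EventuallyEq, ae_restrict_iff' (hΩ.prod isOpen_Ioo).measurableSet] at huv
    exact Measure.ae_ae_of_ae_prod (μ := (volume : Measure ℝ)) (ν := (volume : Measure R3))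
      (p := fun q : ℝ × R3 => q.swap ∈ Ω ×ˢ Ioo 0 T → u q.swap = v q.swap)
      (Measure.measurePreserving_swap.quasiMeasurePreserving.ae huv)
  have hc : ENNReal.ofReal (ε ^ 4) ≠ 0 := by
    have : 0 < ε ^ 4 := by positivity
    simpa using this
  rw [increments, hprod, lintegral_prod_symm _ hm'.aemeasurable, div_eq_mul_inv,
    ← lintegral_mul_const' _ _ (ENNReal.inv_ne_top.2 hc)]
  refine (lintegral_mono_set hJT).trans' ?_
  refine lintegral_mono_ae ?_
  filter_upwards [ae_restrict_of_ae huv', ae_restrict_mem hJm] with t ht htJ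
  rw [← lintegral_mul_const' _ _ (ENNReal.inv_ne_top.2 hc)]
  refine lintegral_mono_ae ?_
  filter_upwards [ae_restrict_of_ae ht, ae_restrict_mem hKx.measurableSet] with x hx hxK
  rw [← lintegral_mul_const' _ _ (ENNReal.inv_ne_top.2 hc)]
  refine lintegral_mono_ae ?_
  have ht' : ∀ᵐ y : R3, (x - y, t) ∈ Ω ×ˢ Ioo 0 T → u (x - y, t) = v (x - y, t) :=
    (Measure.measurePreserving_sub_left volume x).quasiMeasurePreserving.ae ht
  filter_upwards [ae_restrict_of_ae ht', ae_restrict_mem measurableSet_ball] with y hy hyb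
  have hρ : 0 ≤ ρ := hε.le.trans hερ
  have h1 : x ∈ Kx' := hK' (Metric.self_subset_cthickening _ hxK)
  have h2 : x - y ∈ Kx' := by
    refine hK' (Metric.mem_cthickening_of_dist_le _ x ρ Kx hxK ?_)
    rw [mem_ball_zero_iff] at hyb
    rw [dist_eq_norm, sub_sub_cancel_left, norm_neg]
    linarith
  rw [ofReal_cube_div hε, div_eq_mul_inv, hx ⟨hK'Ω h1, hJT htJ⟩, hy ⟨hK'Ω h2, hJT htJ⟩]
  have e1 : V (x, t) = v (x, t) := indicator_of_mem (show (x, t) ∈ Kx' ×ˢ J' from ⟨h1, hJJ' htJ⟩) _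
  have e2 : V ((x, t) - (y, 0)) = v (x - y, t) := by
    rw [Prod.mk_sub_mk, sub_zero]
    exact indicator_of_mem (show (x - y, t) ∈ Kx' ×ˢ J' from ⟨h2, hJJ' htJ⟩) _
  rw [e1, e2]

end

section
variable {Ω : Set R3} {T : ℝ} {u v : R3 × ℝ → R3} {p : R3 × ℝ → ℝ}

theorem cthickening_prod_subset {A : Set (R3 × ℝ)} {B : Set R3} {D : Set ℝ} (hA : IsCompact A)
    (hAB : A ⊆ B ×ˢ D) {ρ : ℝ} (hρ : 0 ≤ ρ) :
    Metric.cthickening ρ A ⊆ Metric.cthickening ρ B ×ˢ Metric.cthickening ρ D := by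
  rw [hA.cthickening_eq_biUnion_closedBall hρ]
  refine iUnion₂_subset fun w hw z hz => ?_
  have hd := Metric.mem_closedBall.1 hz
  rw [Prod.dist_eq, max_le_iff] at hd
  exact ⟨Metric.mem_cthickening_of_dist_le _ _ _ _ (hAB hw).1 hd.1,
    Metric.mem_cthickening_of_dist_le _ _ _ _ (hAB hw).2 hd.2⟩

/-- The energy equality tested with a smooth cutoff in space whose gradient is supported where the
solution is bounded. -/
theorem IsWeakEulerSolution.energy_of_smooth_cutoff (hΩ : IsOpen Ω)
    (hsol : IsWeakEulerSolution Ω T u p) (hbesov : LocalBesovVMO Ω T u)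
    {Γ : Set R3} (hΓ : IsOpen Γ) {C : ℝ}
    (hC : ∀ᵐ z ∂(volume.restrict ((Γ ∩ Ω) ×ˢ Ioo 0 T)), ‖u z‖ ≤ C ∧ |p z| ≤ C)
    {χ : R3 → ℝ} (hχ : ContDiff ℝ ∞ χ) (hχs : HasCompactSupport χ) (hχΩ : tsupport χ ⊆ Ω)
    (hχΓ : tsupport (fderiv ℝ χ) ⊆ Γ)
    {ψ : ℝ → ℝ} (hψ : ContDiff ℝ ∞ ψ) (hψs : HasCompactSupport ψ) (hψT : tsupport ψ ⊆ Ioo 0 T) :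
    (∫ z in Ω ×ˢ Ioo 0 T, deriv ψ z.2 * (χ z.1 * ‖u z‖ ^ 2))
      + ∫ z in Ω ×ˢ Ioo 0 T, ψ z.2 * ((‖u z‖ ^ 2 + 2 * p z) * fderiv ℝ χ z.1 (u z)) = 0 := by
  have hQ : MeasurableSet (Ω ×ˢ Ioo (0 : ℝ) T) := (hΩ.prod isOpen_Ioo).measurableSet
  obtain ⟨v, hvm, huv⟩ : ∃ v, Measurable v ∧ u =ᵐ[volume.restrict (Ω ×ˢ Ioo 0 T)] v := by
    have := hsol.aestronglyMeasurable hΩ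
    exact ⟨this.mk u, this.stronglyMeasurable_mk.measurable, this.ae_eq_mk⟩
  -- nested compact neighbourhoods of the supports
  set Kx := tsupport χ with hKx
  set J := tsupport ψ with hJ
  have hKc : IsCompact Kx := hχs
  have hJc : IsCompact J := hψs
  obtain ⟨ρ₁, hρ₁, hρ₁'⟩ := hKc.exists_cthickening_subset_open hΩ hχΩ
  obtain ⟨ρ₂, hρ₂, hρ₂'⟩ := hJc.exists_cthickening_subset_open isOpen_Ioo hψT
  have hGc : IsCompact (tsupport (fderiv ℝ χ)) := hχs.fderiv ℝ
  have hGΩ : tsupport (fderiv ℝ χ) ⊆ Γ ∩ Ω :=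
    subset_inter hχΓ ((tsupport_fderiv_subset ℝ).trans hχΩ)
  obtain ⟨ρ₃, hρ₃, hρ₃'⟩ := hGc.exists_cthickening_subset_open (hΓ.inter hΩ) hGΩ
  obtain ⟨ρ, hρ, h1, h2, h3⟩ : ∃ ρ : ℝ, 0 < ρ ∧ ρ + ρ ≤ ρ₁ ∧ ρ + ρ ≤ ρ₂ ∧ ρ ≤ ρ₃ := by
    refine ⟨min (ρ₁ / 2) (min (ρ₂ / 2) ρ₃), by positivity, ?_, ?_, ?_⟩
    · have := min_le_left (ρ₁ / 2) (min (ρ₂ / 2) ρ₃)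
      linarith
    · have := (min_le_right (ρ₁ / 2) (min (ρ₂ / 2) ρ₃)).trans (min_le_left _ _)
      linarith
    · exact (min_le_right (ρ₁ / 2) (min (ρ₂ / 2) ρ₃)).trans (min_le_right _ _)
  set K1 := Metric.cthickening ρ Kx with hK1
  set J1 := Metric.cthickening ρ J with hJ1
  set K2 := Metric.cthickening (ρ + ρ) Kx with hK2
  set J2 := Metric.cthickening (ρ + ρ) J with hJ2
  have hK1c : IsCompact K1 := hKc.cthickening
  have hJ1c : IsCompact J1 := hJc.cthickening
  have hK2c : IsCompact K2 := hKc.cthickening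
  have hJ2c : IsCompact J2 := hJc.cthickening
  have hK12 : Metric.cthickening ρ K1 ⊆ K2 := Metric.cthickening_cthickening_subset hρ.le hρ.le _
  have hJ12 : Metric.cthickening ρ J1 ⊆ J2 := Metric.cthickening_cthickening_subset hρ.le hρ.le _
  have hK2Ω : K2 ⊆ Ω := (Metric.cthickening_mono h1 _).trans hρ₁'
  have hJ2T : J2 ⊆ Ioo 0 T := (Metric.cthickening_mono h2 _).trans hρ₂'
  have hK1Ω : K1 ⊆ Ω := (Metric.self_subset_cthickening _).trans (hK12.trans hK2Ω)
  have hJ1T : J1 ⊆ Ioo 0 T := (Metric.self_subset_cthickening _).trans (hJ12.trans hJ2T)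
  have hSΩ : K1 ×ˢ J1 ⊆ Ω ×ˢ Ioo 0 T := prod_mono hK1Ω hJ1T
  -- a single finite increment gives cubic integrability on the inner neighbourhood
  have hl2 := hsol.isLocalSolution hΩ huv (hK2c.prod hJ2c) (prod_mono hK2Ω hJ2T)
  have hv2m : Measurable ((K2 ×ˢ J2).indicator v) :=
    hvm.indicator (hK2c.prod hJ2c).measurableSet
  have hcube : ∫⁻ z in K1 ×ˢ J1, ‖(K2 ×ˢ J2).indicator v z‖ₑ ^ 3 < ⊤ := by
    have hev := (hbesov K1 hK1c hK1Ω).eventually (gt_mem_nhds ENNReal.zero_lt_top)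
    have hev' : ∀ᶠ ε : ℝ in 𝓝[>] 0, 0 < ε ∧ ε ≤ ρ :=
      (eventually_mem_nhdsWithin).and
        (eventually_nhdsWithin_of_eventually_nhds (eventually_le_nhds hρ))
    obtain ⟨ε, hε, hε0, hερ⟩ := (hev.and hev').exists
    have hle := increments_indicator_le (T := T) (J' := J2) hvm huv hΩ hK1c
      hJ1c.measurableSet hK12 hK2c.measurableSet hJ2c.measurableSet
      ((Metric.self_subset_cthickening _).trans hJ12) hK2Ω hJ1T hε0 hερ
    have hfin := hle.trans_lt hε
    refine hl2.lintegral_cube_lt_top hv2m hK1c hJ1c hρ (prod_mono hK12 hJ12) hε0 hερ ?_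
    by_contra hcon
    rw [not_lt, top_le_iff] at hcon
    rw [hcon, ENNReal.top_div_of_ne_top ENNReal.ofReal_ne_top] at hfin
    exact absurd hfin (lt_irrefl _)
  set V := (K1 ×ˢ J1).indicator v with hV
  set P := (K1 ×ˢ J1).indicator p with hP
  have hl := hsol.isLocalSolution hΩ huv (hK1c.prod hJ1c) hSΩ
  have hVm : Measurable V := hvm.indicator (hK1c.prod hJ1c).measurableSet
  have hV3 : MemLp V 3 := by
    refine ⟨hVm.aestronglyMeasurable, ?_⟩
    rw [eLpNorm_lt_top_iff_lintegral_rpow_enorm_lt_top (by simp) (by simp)]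
    refine lt_of_le_of_lt ?_ hcube
    rw [← lintegral_indicator (hK1c.prod hJ1c).measurableSet]
    refine lintegral_mono fun z => ?_
    by_cases hz : z ∈ K1 ×ˢ J1
    · have hz2 : z ∈ K2 ×ˢ J2 := prod_mono ((Metric.self_subset_cthickening _).trans hK12)
        ((Metric.self_subset_cthickening _).trans hJ12) hz
      simp [hV, hz, hz2]
    · simp [hV, hz]
  set ζ : R3 × ℝ → ℝ := fun z => χ z.1 * ψ z.2 with hζdef
  have hζ : ContDiff ℝ ∞ ζ := (hχ.comp contDiff_fst).mul (hψ.comp contDiff_snd)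
  have hζsup : tsupport ζ ⊆ Kx ×ˢ J := by
    refine closure_minimal (fun z hz => ?_) ((isClosed_tsupport χ).prod (isClosed_tsupport ψ))
    exact ⟨subset_tsupport _ (left_ne_zero_of_mul hz), subset_tsupport _ (right_ne_zero_of_mul hz)⟩
  have hζs : HasCompactSupport ζ :=
    (hKc.prod hJc).of_isClosed_subset (isClosed_tsupport ζ) hζsup
  have hζS : Metric.cthickening ρ (tsupport ζ) ⊆ K1 ×ˢ J1 :=
    cthickening_prod_subset hζs hζsup hρ.le
  have hbes : Tendsto (fun ε : ℝ => increments V (tsupport ζ) ε / ENNReal.ofReal (ε ^ 4))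
      (𝓝[>] 0) (𝓝 0) := by
    refine tendsto_of_tendsto_of_tendsto_of_le_of_le' tendsto_const_nhds (hbesov Kx hKc hχΩ)
      (Eventually.of_forall fun _ => zero_le) ?_
    filter_upwards [eventually_mem_nhdsWithin,
      eventually_nhdsWithin_of_eventually_nhds (eventually_le_nhds hρ)] with ε hε0 hερ
    refine le_trans ?_ (increments_indicator_le (T := T) (J' := J1) hvm huv hΩ hKc
      hJc.measurableSet subset_rfl hK1c.measurableSet hJ1c.measurableSet
      (Metric.self_subset_cthickening _) hK1Ω hψT hε0 hερ)
    exact ENNReal.div_le_div_right (lintegral_mono_set hζsup) _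
  obtain ⟨k, r, hk, hr, hD⟩ := exists_tendsto_defect hVm hV3 hζ.continuous hζs hbes
  have hN : MeasurableSet ((Γ ∩ Ω) ×ˢ (univ : Set ℝ)) :=
    ((hΓ.inter hΩ).prod isOpen_univ).measurableSet
  have hCN : ∀ᵐ z, z ∈ (Γ ∩ Ω) ×ˢ (univ : Set ℝ) → ‖V z‖ ≤ max C 0 ∧ |P z| ≤ max C 0 := by
    rw [ae_restrict_iff' ((hΓ.inter hΩ).prod isOpen_Ioo).measurableSet] at hC
    rw [Filter.EventuallyEq, ae_restrict_iff' hQ] at huv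
    filter_upwards [hC, huv] with z hz hz' hzN
    by_cases hzS : z ∈ K1 ×ˢ J1
    · have := hz ⟨hzN.1, (hSΩ hzS).2⟩
      rw [hV, hP, indicator_of_mem hzS, indicator_of_mem hzS, ← hz' (hSΩ hzS)]
      exact ⟨this.1.trans (le_max_left _ _), this.2.trans (le_max_left _ _)⟩
    · simp [hV, hP, hzS]
  have hpdi : ∀ i z, pd (dir i) ζ z = ψ z.2 * pd (EuclideanSpace.single i 1) χ z.1 :=
    fun i z => pd_mul_time_dir hχ hψ i z
  have hζN : ∀ i, Metric.cthickening ρ (tsupport (pd (dir i) ζ))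
      ⊆ (Γ ∩ Ω) ×ˢ (univ : Set ℝ) := by
    intro i
    have hsub : tsupport (pd (dir i) ζ) ⊆ tsupport (fderiv ℝ χ) ×ˢ J := by
      refine closure_minimal (fun z hz => ?_)
        ((isClosed_tsupport _).prod (isClosed_tsupport ψ))
      rw [Function.mem_support, hpdi] at hz
      refine ⟨subset_tsupport _ fun h0 => ?_, subset_tsupport _ (left_ne_zero_of_mul hz)⟩
      apply right_ne_zero_of_mul hz
      simp [pd, h0]
    refine (cthickening_prod_subset (hasCompactSupport_pd hζs _) hsub hρ.le).trans
      (prod_mono ?_ (subset_univ _))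
    exact (Metric.cthickening_mono h3 _).trans hρ₃'
  have hE := hl.energy_of_tendsto_defect hV3 hζ hζs hN hCN hρ hζN hζS hk hr hD
  have hadv : ∀ z, advect V ζ z = ψ z.2 * fderiv ℝ χ z.1 (V z) := by
    intro z
    rw [← fderiv_eq_advect, hζdef, fderiv_mul_time hχ hψ, pd]
  obtain ⟨M, hM0, hM⟩ := exists_bound_advect hζ hζs
  have hadvi := integrable_advect hl.integrable_velocity hζ hζs
  have i1 : Integrable fun z => advect V ζ z * ‖V z‖ ^ 2 := by
    refine ((integrable_cube hV3).const_mul M).mono'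
      (hadvi.1.mul (hl.integrable_velocity.1.norm.pow 2))
      (Eventually.of_forall fun z => ?_)
    rw [norm_mul, norm_pow, norm_norm]
    calc |advect V ζ z| * ‖V z‖ ^ 2 ≤ M * ‖V z‖ * ‖V z‖ ^ 2 := by
          gcongr
          exact hM V z
      _ = M * ‖V z‖ ^ 3 := by ring
  have i2 : Integrable fun z => P z * advect V ζ z := by
    refine (hl.integrable_pressure.norm.const_mul (M * max C 0)).mono'
      (hl.integrable_pressure.1.mul hadvi.1) ?_
    filter_upwards [hCN] with z hz
    rw [norm_mul, mul_comm]
    refine mul_le_mul_of_nonneg_right ?_ (norm_nonneg _)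
    by_cases hzN : z ∈ (Γ ∩ Ω) ×ˢ (univ : Set ℝ)
    · exact (hM V z).trans (mul_le_mul_of_nonneg_left (hz hzN).1 hM0)
    · rw [advect_eq_zero fun i hi => hzN (hζN i (Metric.self_subset_cthickening _ hi))]
      simp only [norm_zero]
      positivity
  have hoff : ∀ z, z ∉ K1 ×ˢ J1 → V z = 0 := fun z hz => indicator_of_notMem hz _
  have hcomb := ((HasInt.of_integrable i1).add ((HasInt.of_integrable i2).const_mul 2)).congr
    (g := fun z => ψ z.2 * ((‖V z‖ ^ 2 + 2 * P z) * fderiv ℝ χ z.1 (V z))) fun z => by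
      rw [hadv]
      ring
  have r1 : ∫ z in Ω ×ˢ Ioo 0 T, deriv ψ z.2 * (χ z.1 * ‖u z‖ ^ 2)
      = ∫ z, pd (0, 1) ζ z * ‖V z‖ ^ 2 := by
    have hpt : ∀ z, pd (0, 1) ζ z = χ z.1 * deriv ψ z.2 := fun z => pd_mul_time_time hχ hψ z
    refine Eq.trans ?_ (setIntegral_eq_integral_of_forall_compl_eq_zero (s := Ω ×ˢ Ioo 0 T)
      (μ := volume) (f := fun z => pd (0, 1) ζ z * ‖V z‖ ^ 2)
      fun z hz => by simp [hoff z fun h => hz (hSΩ h)])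
    refine integral_congr_ae ?_
    filter_upwards [huv] with z hz
    rw [hpt, hz]
    by_cases hzS : z ∈ K1 ×ˢ J1
    · rw [hV, indicator_of_mem hzS]
      ring
    · rw [hoff z hzS]
      have : χ z.1 * deriv ψ z.2 = 0 := by
        by_contra hne
        apply hzS
        refine ⟨Metric.self_subset_cthickening _ (subset_tsupport _ (left_ne_zero_of_mul hne)),
          Metric.self_subset_cthickening _ ?_⟩
        exact tsupport_deriv_subset (subset_tsupport _ (right_ne_zero_of_mul hne))
      rw [norm_zero]
      linear_combination ‖v z‖ ^ 2 * this
  have r2 : ∫ z in Ω ×ˢ Ioo 0 T, ψ z.2 * ((‖u z‖ ^ 2 + 2 * p z) * fderiv ℝ χ z.1 (u z))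
      = ∫ z, ψ z.2 * ((‖V z‖ ^ 2 + 2 * P z) * fderiv ℝ χ z.1 (V z)) := by
    refine Eq.trans ?_ (setIntegral_eq_integral_of_forall_compl_eq_zero (s := Ω ×ˢ Ioo 0 T)
      (μ := volume) (f := fun z => ψ z.2 * ((‖V z‖ ^ 2 + 2 * P z) * fderiv ℝ χ z.1 (V z)))
      fun z hz => by simp [hoff z fun h => hz (hSΩ h)])
    refine integral_congr_ae ?_
    filter_upwards [huv] with z hz
    rw [hz]
    by_cases hzS : z ∈ K1 ×ˢ J1
    · rw [hV, hP, indicator_of_mem hzS, indicator_of_mem hzS]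
    · rw [hoff z hzS]
      by_cases h0 : ψ z.2 = 0
      · simp [h0]
      · have : fderiv ℝ χ z.1 = 0 := by
          by_contra hne
          apply hzS
          exact ⟨Metric.self_subset_cthickening _ (tsupport_fderiv_subset ℝ
            (subset_tsupport _ hne)), Metric.self_subset_cthickening _ (subset_tsupport _ h0)⟩
        simp [this]
  rw [r1, r2, hcomb.2]
  linarith

end

/-! ### The distance to the boundary -/

section geometry
variable {Ω : Set R3}

namespace IsSmoothBoundedDomain

theorem ne_univ (hΩ : IsSmoothBoundedDomain Ω) : Ω ≠ univ := fun h =>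
  NormedSpace.unbounded_univ ℝ R3 (h ▸ hΩ.isBounded)

theorem isCompact_frontier (hΩ : IsSmoothBoundedDomain Ω) : IsCompact (frontier Ω) :=
  Metric.isCompact_of_isClosed_isBounded isClosed_frontier
    (hΩ.isBounded.closure.subset frontier_subset_closure)

theorem frontier_subset_compl (hΩ : IsSmoothBoundedDomain Ω) : frontier Ω ⊆ Ωᶜ := by
  rw [hΩ.isOpen.frontier_eq]
  exact fun x hx => hx.2

theorem exists_mem_frontier_dist_eq (hΩ : IsSmoothBoundedDomain Ω) {x : R3} (hx : x ∈ Ω) :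
    ∃ y ∈ frontier Ω, Metric.infDist x Ωᶜ = dist x y :=
  exists_mem_frontier_infDist_compl_eq_dist hx hΩ.ne_univ

theorem infDist_frontier (hΩ : IsSmoothBoundedDomain Ω) {x : R3} (hx : x ∈ Ω) :
    Metric.infDist x (frontier Ω) = Metric.infDist x Ωᶜ := by
  obtain ⟨y, hy, hxy⟩ := hΩ.exists_mem_frontier_dist_eq hx
  refine le_antisymm ?_ (Metric.infDist_le_infDist_of_subset hΩ.frontier_subset_compl ⟨y, hy⟩)
  rw [hxy]
  exact Metric.infDist_le_dist_of_mem hy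

theorem boundaryProj_spec (hΩ : IsSmoothBoundedDomain Ω) {x : R3} (hx : x ∈ Ω) :
    boundaryProj Ω x ∈ frontier Ω ∧ dist x (boundaryProj Ω x) = Metric.infDist x Ωᶜ := by
  have h : ∃ z, z ∈ frontier Ω ∧ dist x z = Metric.infDist x (frontier Ω) := by
    obtain ⟨y, hy, hxy⟩ := hΩ.exists_mem_frontier_dist_eq hx
    exact ⟨y, hy, by rw [hΩ.infDist_frontier hx, hxy]⟩
  have h' := Classical.epsilon_spec h
  exact ⟨h'.1, h'.2.trans (hΩ.infDist_frontier hx)⟩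

theorem infDist_pos (hΩ : IsSmoothBoundedDomain Ω) {x : R3} (hx : x ∈ Ω) :
    0 < Metric.infDist x Ωᶜ := by
  obtain ⟨y, hy, hxy⟩ := hΩ.exists_mem_frontier_dist_eq hx
  rw [hxy, dist_pos]
  rintro rfl
  exact hΩ.frontier_subset_compl hy hx

theorem isOuterUnitNormal (hΩ : IsSmoothBoundedDomain Ω) {x : R3} (hx : x ∈ frontier Ω) :
    IsOuterUnitNormal Ω x (outerUnitNormal Ω x) := by
  obtain ⟨ρ, hρ⟩ := hΩ.smooth_boundary x hx
  exact Classical.epsilon_spec (p := IsOuterUnitNormal Ω x) ⟨_, ρ, hρ, rfl⟩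

end IsSmoothBoundedDomain

theorem mem_of_dist_lt_infDist_compl {x y : R3} (h : dist x y < Metric.infDist x Ωᶜ) : y ∈ Ω := by
  by_contra hy
  exact absurd (Metric.infDist_le_dist_of_mem (s := Ωᶜ) hy) (not_le.2 h)

/-- If a ball contained in `Ω` touches the boundary at `y`, the outer unit normal at `y` points
along the radius through `y`. -/
theorem IsOuterUnitNormal.sub_eq_smul (hΩ : IsOpen Ω) {x y ν : R3} (hy : y ∈ frontier Ω)
    (hν : IsOuterUnitNormal Ω y ν) (hxy : 0 < dist x y)
    (hball : ∀ z, dist x z < dist x y → z ∈ Ω) : y - x = dist x y • ν := by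
  obtain ⟨ρ, hρ, rfl⟩ := hν
  set g := gradient ρ y with hg
  set w := y - x with hw
  have hdw : dist x y = ‖w‖ := by rw [dist_comm, dist_eq_norm]
  rw [hdw] at hxy hball ⊢
  have hkey : ∀ v : R3, inner ℝ w v < 0 → inner ℝ g v ≤ 0 := by
    intro v hv
    by_contra hcon
    push Not at hcon
    have hd : DifferentiableAt ℝ ρ y := (hρ.smooth.differentiable (by simp)).differentiableAt
    have h1 := eventually_neg_of_inner_neg (ρ := fun z => -ρ z) (x := y) (v := v) hd.neg
      (by simp [hρ.eq_zero hΩ hy]) (by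
        have : gradient (fun z => -ρ z) y = -g := by
          rw [hg, gradient, gradient, fderiv_fun_neg, map_neg]
        rw [this, inner_neg_left]
        linarith)
    have hc : Tendsto (fun s : ℝ => y + s • v) (𝓝[>] 0) (𝓝 y) := by
      have : Continuous fun s : ℝ => y + s • v := by fun_prop
      simpa using (this.tendsto 0).mono_left nhdsWithin_le_nhds
    have h2 : ∀ᶠ s : ℝ in 𝓝[>] 0, s * ‖v‖ ^ 2 < -2 * inner ℝ w v := by
      have : Tendsto (fun s : ℝ => s * ‖v‖ ^ 2) (𝓝[>] 0) (𝓝 0) := by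
        have h : Continuous fun s : ℝ => s * ‖v‖ ^ 2 := by fun_prop
        simpa using (h.tendsto 0).mono_left nhdsWithin_le_nhds
      exact this.eventually (gt_mem_nhds (by linarith))
    obtain ⟨s, hs1, hs2, hs3, hs0⟩ :=
      (h1.and (h2.and ((hc.eventually hρ.mem_iff).and self_mem_nhdsWithin))).exists
    have hs0' : (0 : ℝ) < s := hs0
    have hin : y + s • v ∈ Ω := by
      apply hball
      rw [dist_comm, dist_eq_norm, show y + s • v - x = w + s • v by rw [hw]; abel]
      refine lt_of_pow_lt_pow_left₀ 2 (norm_nonneg _) ?_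
      rw [norm_add_sq_real, real_inner_smul_right, norm_smul, mul_pow, Real.norm_eq_abs, sq_abs]
      nlinarith
    have := hs3.1 hin
    linarith
  have hg0 : 0 < ‖g‖ := norm_pos_iff.2 hρ.gradient_ne_zero
  have hne : ‖‖g‖⁻¹ • g‖ = 1 := by rw [norm_smul, norm_inv, norm_norm, inv_mul_cancel₀ hg0.ne']
  have hnf : ‖‖w‖⁻¹ • w‖ = 1 := by rw [norm_smul, norm_inv, norm_norm, inv_mul_cancel₀ hxy.ne']
  set e := ‖g‖⁻¹ • g with he
  set f := ‖w‖⁻¹ • w with hf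
  have hge : g = ‖g‖ • e := by rw [he, smul_inv_smul₀ hg0.ne']
  have hwf : w = ‖w‖ • f := by rw [hf, smul_inv_smul₀ hxy.ne']
  by_cases hef : e = f
  · rw [hef]
    exact hwf
  exfalso
  have hlt : inner ℝ e f < 1 := (inner_lt_one_iff_real_of_norm_eq_one hne hnf).2 hef
  have h1 : inner ℝ w (e - f) < 0 := by
    rw [hwf, real_inner_smul_left, inner_sub_right, real_inner_self_eq_norm_sq, hnf,
      real_inner_comm]
    nlinarith
  have h2 := hkey _ h1
  rw [hge, real_inner_smul_left, inner_sub_right, real_inner_self_eq_norm_sq, hne] at h2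
  nlinarith

/-- A function with Lipschitz constant one which decreases at unit speed in the direction `ν` has
gradient `-ν`. -/
theorem fderiv_eq_neg_inner_of_le {f : R3 → ℝ} (hf : LipschitzWith 1 f) {x ν : R3}
    (hd : DifferentiableAt ℝ f x) (hν : ‖ν‖ = 1)
    (hle : ∀ᶠ s : ℝ in 𝓝[>] 0, f (x + s • ν) ≤ f x - s) (v : R3) :
    fderiv ℝ f x v = -inner ℝ v ν := by
  set w := gradient f x with hw
  have hfd : ∀ v, fderiv ℝ f x v = inner ℝ w v := fun v => by
    rw [hw, gradient, InnerProductSpace.toDual_symm_apply]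
  have hw1 : ‖w‖ ≤ 1 := by
    have : ‖fderiv ℝ f x‖ ≤ 1 := by
      simpa using norm_fderiv_le_of_lipschitz ℝ hf (x₀ := x)
    rwa [hw, gradient, LinearIsometryEquiv.norm_map]
  have hwν : inner ℝ w ν ≤ -1 := by
    have h1 : HasDerivAt (fun s : ℝ => x + s • ν) ν 0 := by
      simpa using ((hasDerivAt_id (0 : ℝ)).smul_const ν).const_add x
    have h2 : HasFDerivAt f (fderiv ℝ f x) (x + (0 : ℝ) • ν) := by simpa using hd.hasFDerivAt
    have h3 : HasDerivAt (fun s : ℝ => f (x + s • ν)) (fderiv ℝ f x ν) 0 :=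
      h2.comp_hasDerivAt 0 h1
    rw [hfd] at h3
    have h5 := (hasDerivAt_iff_tendsto_slope.1 h3).mono_left
      (nhdsWithin_mono 0 fun s (hs : s ∈ Ioi (0 : ℝ)) => ne_of_gt hs)
    refine le_of_tendsto h5 ?_
    filter_upwards [hle, self_mem_nhdsWithin] with s hs hs0
    have hs0' : (0 : ℝ) < s := hs0
    simp only [slope, vsub_eq_sub, sub_zero, zero_smul, add_zero, smul_eq_mul]
    rw [inv_mul_le_iff₀ hs0']
    linarith
  have hsum : w + ν = 0 := by
    have : ‖w + ν‖ ^ 2 ≤ 0 := by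
      rw [norm_add_sq_real, hν]
      nlinarith [norm_nonneg w]
    exact norm_eq_zero.1 (pow_eq_zero_iff (two_ne_zero) |>.1 (le_antisymm this (sq_nonneg _)))
  rw [hfd, eq_neg_of_add_eq_zero_left hsum, inner_neg_left, real_inner_comm]

/-- Where it is differentiable, the distance to the boundary has gradient `-n ∘ σ`. This needs
neither the uniqueness of the nearest point nor a tubular neighbourhood: the derivative has norm at
most one, and the distance decreases at unit speed towards a nearest boundary point. -/
theorem IsSmoothBoundedDomain.fderiv_infDist (hΩ : IsSmoothBoundedDomain Ω) {x : R3} (hx : x ∈ Ω)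
    (hd : DifferentiableAt ℝ (fun y => Metric.infDist y Ωᶜ) x) (v : R3) :
    fderiv ℝ (fun y => Metric.infDist y Ωᶜ) x v
      = -inner ℝ v (outerUnitNormal Ω (boundaryProj Ω x)) := by
  obtain ⟨hσ, hxσ⟩ := hΩ.boundaryProj_spec hx
  have hν' := hΩ.isOuterUnitNormal hσ
  generalize boundaryProj Ω x = σ at *
  generalize outerUnitNormal Ω σ = ν at *
  have hpos : 0 < dist x σ := hxσ ▸ hΩ.infDist_pos hx
  have hν := hν'.sub_eq_smul hΩ.isOpen hσ hpos
    (fun z hz => mem_of_dist_lt_infDist_compl (hxσ ▸ hz))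
  have hν1 : ‖ν‖ = 1 := by
    have h := congrArg norm hν
    rw [← dist_eq_norm, dist_comm, norm_smul, Real.norm_of_nonneg dist_nonneg] at h
    exact (mul_left_cancel₀ hpos.ne' (by rw [mul_one]; exact h)).symm
  refine fderiv_eq_neg_inner_of_le (Metric.lipschitz_infDist_pt Ωᶜ) hd hν1 ?_ v
  have hsmall : ∀ᶠ s : ℝ in 𝓝[>] 0, s < dist x σ :=
    eventually_nhdsWithin_of_eventually_nhds (gt_mem_nhds hpos)
  filter_upwards [hsmall] with s hs
  rw [← hxσ]
  refine (Metric.infDist_le_dist_of_mem (hΩ.frontier_subset_compl hσ)).trans ?_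
  rw [dist_comm, dist_eq_norm, ← sub_sub, hν, ← sub_smul, norm_smul, hν1, mul_one,
    Real.norm_of_nonneg (by linarith)]

/-! ### The volume of boundary layers -/

/-- A bounded set which meets every line of direction `e` in a set of diameter at most `m` has
volume at most a constant times `m`, by Fubini's theorem applied to its translates along `e`. -/
theorem volume_le_of_line_section {A : Set R3} (hA : MeasurableSet A) {c e : R3} {R m : ℝ}
    (hAc : A ⊆ Metric.closedBall c R) (he : ‖e‖ ≤ 1)
    (h : ∀ y ∈ A, ∀ s : ℝ, 0 ≤ s → y + s • e ∈ A → s ≤ m) :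
    volume A ≤ ENNReal.ofReal m * volume (Metric.closedBall c (R + 1)) := by
  have hmeas : Measurable fun q : ℝ × R3 => A.indicator (fun _ => (1 : ENNReal)) (q.2 - q.1 • e) :=
    (measurable_const.indicator hA).comp
      (measurable_snd.sub (measurable_fst.smul_const e))
  have h1 : ∀ s : ℝ, ∫⁻ x : R3, A.indicator (fun _ => (1 : ENNReal)) (x - s • e) = volume A := by
    intro s
    rw [lintegral_sub_right_eq_self (fun x => A.indicator (fun _ => (1 : ENNReal)) x) (s • e)]
    exact lintegral_indicator_one hA
  have h2 : volume A = ∫⁻ s in Icc (0 : ℝ) 1, ∫⁻ x : R3,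
      A.indicator (fun _ => (1 : ENNReal)) (x - s • e) := by
    simp_rw [h1]
    simp
  rw [h2, lintegral_lintegral_swap hmeas.aemeasurable]
  have h3 : ∀ x : R3, ∫⁻ s in Icc (0 : ℝ) 1, A.indicator (fun _ => (1 : ENNReal)) (x - s • e)
      ≤ (Metric.closedBall c (R + 1)).indicator (fun _ => ENNReal.ofReal m) x := by
    intro x
    have hS : MeasurableSet {s : ℝ | x - s • e ∈ A} :=
      (measurable_const.sub (measurable_id.smul_const e)) hA
    have heq : (fun s : ℝ => A.indicator (fun _ => (1 : ENNReal)) (x - s • e))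
        = {s : ℝ | x - s • e ∈ A}.indicator 1 := by
      ext s
      by_cases hs : x - s • e ∈ A <;> simp [indicator, hs]
    rw [heq, lintegral_indicator_one hS, Measure.restrict_apply hS]
    by_cases hx : x ∈ Metric.closedBall c (R + 1)
    · rw [indicator_of_mem hx]
      refine (Real.volume_le_diam _).trans (Metric.ediam_le fun s hs t ht => ?_)
      wlog hst : s ≤ t generalizing s t
      · rw [edist_comm]
        exact this t ht s hs (le_of_not_ge hst)
      rw [edist_dist, dist_comm, Real.dist_eq, abs_of_nonneg (sub_nonneg.2 hst)]
      refine ENNReal.ofReal_le_ofReal (h _ ht.1 _ (sub_nonneg.2 hst) ?_)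
      rw [sub_smul]
      simpa using hs.1
    · have hempty : {s : ℝ | x - s • e ∈ A} ∩ Icc 0 1 = ∅ := by
        rw [eq_empty_iff_forall_notMem]
        rintro s ⟨hs, hs0, hs1⟩
        apply hx
        have h4 := hAc hs
        rw [Metric.mem_closedBall, dist_eq_norm] at h4 ⊢
        have h5 : ‖s • e‖ ≤ 1 := by
          rw [norm_smul, Real.norm_of_nonneg hs0]
          nlinarith [norm_nonneg e]
        calc ‖x - c‖ = ‖(x - s • e - c) + s • e‖ := by congr 1; abel
          _ ≤ _ := (norm_add_le _ _).trans (add_le_add h4 h5)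
      simp [hempty]
  refine (lintegral_mono h3).trans (le_of_eq ?_)
  rw [lintegral_indicator_const Metric.isClosed_closedBall.measurableSet]

/-- Near a boundary point, `Ω` lies below a function which increases in the normal direction, so
that the layer of width `δ` along the boundary has volume `O(δ)`. -/
theorem IsLocalDefiningFunction.exists_volume_layer_le (hΩ : IsOpen Ω) {x : R3} {ρ : R3 → ℝ}
    (hρ : IsLocalDefiningFunction Ω x ρ) :
    ∃ r > 0, ∃ K : ℝ, 0 ≤ K ∧ ∀ δ, 0 < δ → δ < r →
      volume (Ω ∩ Metric.thickening δ (frontier Ω ∩ Metric.ball x r)) ≤ ENNReal.ofReal (K * δ) := by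
  set g := gradient ρ x with hg
  have hg0 : 0 < ‖g‖ := norm_pos_iff.2 hρ.gradient_ne_zero
  set e := ‖g‖⁻¹ • g with he
  have hne : ‖e‖ = 1 := by rw [norm_smul, norm_inv, norm_norm, inv_mul_cancel₀ hg0.ne']
  have hdiff : Differentiable ℝ ρ := hρ.smooth.differentiable (by simp)
  have hfc : Continuous (fderiv ℝ ρ) := hρ.smooth.continuous_fderiv (by simp)
  have hxe : fderiv ℝ ρ x e = ‖g‖ := by
    have : fderiv ℝ ρ x e = inner ℝ g e := by
      rw [hg, gradient, InnerProductSpace.toDual_symm_apply]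
    rw [this, he, real_inner_smul_right, real_inner_self_eq_norm_sq]
    field_simp
  have hev1 : ∀ᶠ y in 𝓝 x, ‖g‖ / 2 < fderiv ℝ ρ y e := by
    have hc : Continuous fun y => fderiv ℝ ρ y e := hfc.clm_apply continuous_const
    exact hc.continuousAt.eventually (lt_mem_nhds (by simp only [hxe]; linarith))
  have hev2 : ∀ᶠ y in 𝓝 x, ‖fderiv ℝ ρ y‖ < ‖fderiv ℝ ρ x‖ + 1 :=
    hfc.norm.continuousAt.eventually (gt_mem_nhds (by linarith))
  set L := ‖fderiv ℝ ρ x‖ + 1 with hL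
  have hL0 : 0 ≤ L := by positivity
  obtain ⟨R, hR, hball⟩ := Metric.eventually_nhds_iff_ball.1 (hev1.and (hev2.and hρ.mem_iff))
  have hconv := convex_ball x R
  have hlip : ∀ y ∈ Metric.ball x R, ∀ z ∈ Metric.ball x R, ρ z - ρ y ≤ L * dist z y := by
    intro y hy z hz
    rw [dist_eq_norm]
    exact (le_abs_self _).trans (hconv.norm_image_sub_le_of_norm_fderiv_le (𝕜 := ℝ)
      (fun w _ => hdiff w) (fun w hw => (hball w hw).2.1.le) hy hz)
  have hmono : ∀ y ∈ Metric.ball x R, ∀ s : ℝ, 0 ≤ s → y + s • e ∈ Metric.ball x R →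
      ‖g‖ / 2 * s ≤ ρ (y + s • e) - ρ y := by
    intro y hy s hs hys
    have hder : ∀ t, HasDerivAt (fun t : ℝ => ρ (y + t • e)) (fderiv ℝ ρ (y + t • e) e) t := by
      intro t
      have h1 : HasDerivAt (fun t : ℝ => y + t • e) e t := by
        simpa using ((hasDerivAt_id t).smul_const e).const_add y
      exact (hdiff _).hasFDerivAt.comp_hasDerivAt t h1
    have hin : ∀ t ∈ Icc (0 : ℝ) s, y + t • e ∈ Metric.ball x R := by
      intro t ht
      rcases eq_or_lt_of_le hs with rfl | hs'
      · have : t = 0 := le_antisymm ht.2 ht.1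
        simpa [this] using hy
      have := hconv.add_smul_sub_mem hy hys (t := t / s)
        ⟨div_nonneg ht.1 hs, div_le_one_of_le₀ ht.2 hs⟩
      rwa [add_sub_cancel_left, smul_smul, div_mul_cancel₀ _ hs'.ne'] at this
    have := (convex_Icc (0 : ℝ) s).mul_sub_le_image_sub_of_le_deriv
      (f := fun t : ℝ => ρ (y + t • e)) (C := ‖g‖ / 2)
      (fun t _ => (hder t).continuousAt.continuousWithinAt)
      (fun t _ => (hder t).differentiableAt.differentiableWithinAt)
      (fun t ht => by
        rw [(hder t).deriv]
        exact (hball _ (hin t (interior_subset ht))).1.le)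
      0 (left_mem_Icc.2 hs) s (right_mem_Icc.2 hs) hs
    simpa using this
  set B := volume (Metric.closedBall x (R + 1)) with hB
  have hBtop : B ≠ ⊤ := (isCompact_closedBall x (R + 1)).measure_lt_top.ne
  refine ⟨R / 2, by positivity, 2 * L / ‖g‖ * B.toReal, by positivity, fun δ hδ hδr => ?_⟩
  set A := Ω ∩ Metric.thickening δ (frontier Ω ∩ Metric.ball x (R / 2)) with hA
  have hAball : A ⊆ Metric.ball x R := by
    rintro y ⟨-, hy⟩
    obtain ⟨z, hz, hyz⟩ := Metric.mem_thickening_iff.1 hy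
    rw [Metric.mem_ball]
    have := hz.2
    rw [Metric.mem_ball] at this
    linarith [dist_triangle y z x]
  have hlow : ∀ y ∈ A, -(L * δ) ≤ ρ y ∧ ρ y < 0 := by
    intro y hy
    have hyR := hAball hy
    obtain ⟨z, hz, hyz⟩ := Metric.mem_thickening_iff.1 hy.2
    refine ⟨?_, (hball y hyR).2.2.1 hy.1⟩
    have hzR : z ∈ Metric.ball x R := Metric.ball_subset_ball (by linarith) hz.2
    have hzΩ : z ∉ Ω := by
      have := hz.1
      rw [hΩ.frontier_eq] at this
      exact this.2
    have hz0 : 0 ≤ ρ z := not_lt.1 fun hlt => hzΩ ((hball z hzR).2.2.2 hlt)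
    have := hlip y hyR z hzR
    rw [dist_comm] at this
    nlinarith
  refine (volume_le_of_line_section (m := 2 * L / ‖g‖ * δ)
    (hΩ.inter Metric.isOpen_thickening).measurableSet
    (hAball.trans Metric.ball_subset_closedBall) hne.le fun y hy s hs hys => ?_).trans (le_of_eq ?_)
  · have h1 := hmono y (hAball hy) s hs (hAball hys)
    have h2 := (hlow y hy).1
    have h3 := (hlow _ hys).2
    rw [div_mul_eq_mul_div, le_div_iff₀ hg0]
    linarith
  · rw [← hB, ← ENNReal.ofReal_toReal hBtop, ENNReal.toReal_ofReal ENNReal.toReal_nonneg,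
      ← ENNReal.ofReal_mul (by positivity)]
    congr 1
    ring

/-- The layer of width `δ` along the boundary has volume `O(δ)`. -/
theorem IsSmoothBoundedDomain.exists_volume_layer_le (hΩ : IsSmoothBoundedDomain Ω) :
    ∃ δ₀ > 0, ∃ K : ℝ, 0 ≤ K ∧ ∀ δ, 0 < δ → δ < δ₀ →
      volume {x ∈ Ω | Metric.infDist x Ωᶜ < δ} ≤ ENNReal.ofReal (K * δ) := by
  have hcov : ∃ δ₀ > 0, ∃ K : ℝ, 0 ≤ K ∧ ∀ δ, 0 < δ → δ < δ₀ →
      volume (Ω ∩ Metric.thickening δ (frontier Ω)) ≤ ENNReal.ofReal (K * δ) := by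
    refine hΩ.isCompact_frontier.induction_on (p := fun S => ∃ δ₀ > 0, ∃ K : ℝ, 0 ≤ K ∧
      ∀ δ, 0 < δ → δ < δ₀ → volume (Ω ∩ Metric.thickening δ S) ≤ ENNReal.ofReal (K * δ))
      ⟨1, one_pos, 0, le_rfl, by simp⟩ ?_ ?_ ?_
    · rintro S S' hSS ⟨δ₀, hδ₀, K, hK, h⟩
      exact ⟨δ₀, hδ₀, K, hK, fun δ h0 h1 => (measure_mono (inter_subset_inter_right _
        (Metric.thickening_subset_of_subset δ hSS))).trans (h δ h0 h1)⟩
    · rintro S S' ⟨δ₁, hδ₁, K₁, hK₁, h₁⟩ ⟨δ₂, hδ₂, K₂, hK₂, h₂⟩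
      refine ⟨min δ₁ δ₂, lt_min hδ₁ hδ₂, K₁ + K₂, by positivity, fun δ h0 h => ?_⟩
      rw [Metric.thickening_union, inter_union_distrib_left, add_mul,
        ENNReal.ofReal_add (by positivity) (by positivity)]
      exact (measure_union_le _ _).trans (add_le_add (h₁ δ h0 (h.trans_le (min_le_left _ _)))
        (h₂ δ h0 (h.trans_le (min_le_right _ _))))
    · intro x hx
      obtain ⟨ρ, hρ⟩ := hΩ.smooth_boundary x hx
      obtain ⟨r, hr, K, hK, h⟩ := hρ.exists_volume_layer_le hΩ.isOpen
      exact ⟨_, inter_mem_nhdsWithin _ (Metric.ball_mem_nhds x hr), r, hr, K, hK, h⟩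
  obtain ⟨δ₀, hδ₀, K, hK, h⟩ := hcov
  refine ⟨δ₀, hδ₀, K, hK, fun δ h0 h1 => (measure_mono ?_).trans (h δ h0 h1)⟩
  rintro x ⟨hx, hxδ⟩
  obtain ⟨y, hy, hxy⟩ := hΩ.exists_mem_frontier_dist_eq hx
  exact ⟨hx, Metric.mem_thickening_iff.2 ⟨y, hy, hxy ▸ hxδ⟩⟩

end geometry

/-! ### Smooth approximation of Lipschitz cutoffs -/

section lipschitz
variable {k χ : R3 → ℝ} {r : ℝ} {L : NNReal}

/-- The derivative of the mollification of a Lipschitz function is the mollification of its almost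
everywhere defined derivative. -/
theorem IsMollifier.fderiv_mol_of_lipschitz (hk : IsMollifier k r) (hχ : LipschitzWith L χ)
    (x v : R3) : fderiv ℝ (mol k χ) x v = ∫ w, k (x - w) * fderiv ℝ χ w v := by
  have hk' : Continuous k := hk.smooth.continuous
  have hmol : mol k χ = fun y => ∫ a, k a * χ (y - a) := by
    funext y
    unfold mol
    rw [← integral_sub_left_eq_self (fun a => k a * χ (y - a)) volume y]
    simp
  have hmeas : AEStronglyMeasurable (fun a => k a • fderiv ℝ χ (x - a)) :=
    hk'.aestronglyMeasurable.smul
      (((measurable_fderiv ℝ χ).comp (measurable_const.sub measurable_id)).aestronglyMeasurable)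
  have hdiff : ∀ᵐ a : R3, DifferentiableAt ℝ χ (x - a) :=
    (Measure.measurePreserving_sub_left volume x).quasiMeasurePreserving.ae hχ.ae_differentiableAt
  have h := hasFDerivAt_integral_of_dominated_loc_of_lip (μ := (volume : Measure R3))
    (F := fun y a => k a * χ (y - a)) (F' := fun a => k a • fderiv ℝ χ (x - a)) (x₀ := x)
    (s := univ) (bound := fun a => k a * L) univ_mem
    (Eventually.of_forall fun y => (hk'.mul (hχ.continuous.comp
      (continuous_const.sub continuous_id))).aestronglyMeasurable)
    ((hk'.mul
      (hχ.continuous.comp (continuous_const.sub continuous_id))).integrable_of_hasCompactSupport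
      hk.hasCompactSupport.mul_right) hmeas
    (Eventually.of_forall fun a => ?_) (hk.integrable.mul_const _)
    (hdiff.mono fun a ha => ?_)
  · rw [hmol, h.2.fderiv, ContinuousLinearMap.integral_apply h.1,
      ← integral_sub_left_eq_self _ volume x]
    simp
  · refine LipschitzOnWith.of_dist_le_mul fun y _ z _ => ?_
    rw [dist_eq_norm, ← mul_sub, norm_mul, Real.coe_nnabs, abs_mul, Real.norm_eq_abs, mul_assoc,
      NNReal.abs_eq]
    refine mul_le_mul_of_nonneg_left ?_ (abs_nonneg _)
    simpa [dist_eq_norm] using hχ.dist_le_mul (y - a) (z - a)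
  · have h1 : HasFDerivAt (fun y => χ (y - a)) (fderiv ℝ χ (x - a)) x := by
      rw [hasFDerivAt_comp_sub]
      exact ha.hasFDerivAt
    exact h1.const_mul (k a)

theorem IsMollifier.norm_fderiv_mol_le (hk : IsMollifier k r) (hχ : LipschitzWith L χ) (x : R3) :
    ‖fderiv ℝ (mol k χ) x‖ ≤ L := by
  refine ContinuousLinearMap.opNorm_le_bound _ L.2 fun v => ?_
  rw [hk.fderiv_mol_of_lipschitz hχ]
  have h1 : ∫ w, k (x - w) * (L * ‖v‖) = L * ‖v‖ := by
    rw [integral_mul_const, integral_sub_left_eq_self k volume x, hk.integral_eq_one, one_mul]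
  refine (norm_integral_le_of_norm_le (g := fun w => k (x - w) * (L * ‖v‖))
    ((hk.integrable.comp_sub_left x).mul_const _) (Eventually.of_forall fun w => ?_)).trans h1.le
  rw [norm_mul, Real.norm_of_nonneg (hk.nonneg _)]
  refine mul_le_mul_of_nonneg_left ?_ (hk.nonneg _)
  exact ((fderiv ℝ χ w).le_opNorm v).trans
    (mul_le_mul_of_nonneg_right (norm_fderiv_le_of_lipschitz ℝ hχ) (norm_nonneg _))

theorem IsMollifier.tsupport_fderiv_mol_subset (hk : IsMollifier k r) (hχ : LipschitzWith L χ) :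
    tsupport (fderiv ℝ (mol k χ)) ⊆ Metric.cthickening r (tsupport (fderiv ℝ χ)) := by
  refine closure_minimal (fun x hx => ?_) Metric.isClosed_cthickening
  by_contra hcon
  apply hx
  ext v
  have h := tsupport_mol_subset hk.tsupport_subset (f := fun w => fderiv ℝ χ w v)
    (A := tsupport (fderiv ℝ χ)) fun w hw => by simp [image_eq_zero_of_notMem_tsupport hw]
  rw [hk.fderiv_mol_of_lipschitz hχ]
  change mol k (fun w => fderiv ℝ χ w v) x = 0
  exact image_eq_zero_of_notMem_tsupport fun h' => hcon (h h')

theorem IsMollifier.abs_mol_sub_le (hk : IsMollifier k r) (hχ : LipschitzWith L χ)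
    (hχi : Integrable χ) (x : R3) : |mol k χ x - χ x| ≤ L * r := by
  have h1 : χ x = ∫ w, k (x - w) * χ x := by
    rw [integral_mul_const, integral_sub_left_eq_self k volume x, hk.integral_eq_one, one_mul]
  have h2 : mol k χ x - χ x = ∫ w, k (x - w) * (χ w - χ x) := by
    have h3 : Integrable fun w => k (x - w) * χ w :=
      (integrable_mol_integrand hk.smooth.continuous hk.hasCompactSupport hχi x :)
    simp only [mul_sub]
    rw [integral_sub h3 ((hk.integrable.comp_sub_left x).mul_const (χ x)), ← h1]
    rfl
  have h3 : ∫ w, k (x - w) * (L * r) = L * r := by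
    rw [integral_mul_const, integral_sub_left_eq_self k volume x, hk.integral_eq_one, one_mul]
  rw [h2, ← Real.norm_eq_abs]
  refine (norm_integral_le_of_norm_le (g := fun w => k (x - w) * (L * r))
    ((hk.integrable.comp_sub_left x).mul_const _) (Eventually.of_forall fun w => ?_)).trans h3.le
  rw [norm_mul, Real.norm_of_nonneg (hk.nonneg _)]
  by_cases h0 : k (x - w) = 0
  · simp [h0]
  refine mul_le_mul_of_nonneg_left ?_ (hk.nonneg _)
  have h4 := hk.tsupport_subset (subset_tsupport _ h0)
  rw [mem_closedBall_zero_iff, ← dist_eq_norm, dist_comm] at h4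
  exact (hχ.dist_le_mul w x).trans (mul_le_mul_of_nonneg_left h4 L.2)

/-- A compactly supported Lipschitz function is approximated by test functions whose derivatives
converge boundedly and almost everywhere. -/
theorem exists_smooth_approx (hχ : LipschitzWith L χ) (hχs : HasCompactSupport χ) {ρ : ℝ}
    (hρ : 0 < ρ) : ∃ f : ℕ → R3 → ℝ, (∀ n, ContDiff ℝ ∞ (f n)) ∧
      (∀ n, tsupport (f n) ⊆ Metric.cthickening ρ (tsupport χ)) ∧
      (∀ n, tsupport (fderiv ℝ (f n)) ⊆ Metric.cthickening ρ (tsupport (fderiv ℝ χ))) ∧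
      (∀ n x, ‖fderiv ℝ (f n) x‖ ≤ L) ∧ (∀ n x, |f n x - χ x| ≤ L * ρ) ∧
      (∀ x, Tendsto (fun n => f n x) atTop (𝓝 (χ x))) ∧
      ∀ᵐ x, ∀ v, Tendsto (fun n => fderiv ℝ (f n) x v) atTop (𝓝 (fderiv ℝ χ x v)) := by
  have hr : ∀ n : ℕ, 0 < ρ / ((n : ℝ) + 1) := fun n => by positivity
  have hrρ : ∀ n : ℕ, ρ / ((n : ℝ) + 1) ≤ ρ := fun n => by
    refine div_le_self hρ.le ?_
    have : (0 : ℝ) ≤ n := n.cast_nonneg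
    linarith
  have hrt : Tendsto (fun n : ℕ => ρ / ((n : ℝ) + 1)) atTop (𝓝 0) :=
    tendsto_const_nhds.div_atTop (tendsto_atTop_add_const_right _ _ tendsto_natCast_atTop_atTop)
  set φ : ℕ → ContDiffBump (0 : R3) := fun n =>
    ⟨ρ / ((n : ℝ) + 1) / 2, ρ / ((n : ℝ) + 1), half_pos (hr n), half_lt_self (hr n)⟩ with hφ
  set k : ℕ → R3 → ℝ := fun n => (φ n).normed volume with hkdef
  have hk : ∀ n, IsMollifier (k n) (ρ / ((n : ℝ) + 1)) := fun n =>
    ⟨(φ n).contDiff_normed, (φ n).nonneg_normed, (φ n).normed_neg, (φ n).integral_normed,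
      (φ n).tsupport_normed_eq.subset⟩
  have hχi : Integrable χ := hχ.continuous.integrable_of_hasCompactSupport hχs
  have hsmall : ∀ n x, |mol (k n) χ x - χ x| ≤ L * (ρ / ((n : ℝ) + 1)) := fun n x =>
    (hk n).abs_mol_sub_le hχ hχi x
  refine ⟨fun n => mol (k n) χ, fun n => contDiff_mol (hk n).smooth (hk n).hasCompactSupport hχi,
    fun n => ?_, fun n => ?_, fun n x => (hk n).norm_fderiv_mol_le hχ x, fun n x => ?_, fun x => ?_,
    ?_⟩
  · exact (tsupport_mol_subset (hk n).tsupport_subset fun z hz =>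
      image_eq_zero_of_notMem_tsupport hz).trans (Metric.cthickening_mono (hrρ n) _)
  · exact ((hk n).tsupport_fderiv_mol_subset hχ).trans (Metric.cthickening_mono (hrρ n) _)
  · exact (hsmall n x).trans (mul_le_mul_of_nonneg_left (hrρ n) L.2)
  · rw [tendsto_iff_dist_tendsto_zero]
    refine squeeze_zero (fun _ => dist_nonneg) (fun n => hsmall n x) ?_
    simpa using hrt.const_mul (L : ℝ)
  · have hloc : LocallyIntegrable (gradient χ) := by
      have hm : AEStronglyMeasurable (gradient χ) volume :=
        ((InnerProductSpace.toDual ℝ R3).symm.continuous.measurable.comp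
          (measurable_fderiv ℝ χ)).aestronglyMeasurable
      refine (locallyIntegrable_const (L : ℝ)).mono hm (Eventually.of_forall fun x => ?_)
      rw [gradient, LinearIsometryEquiv.norm_map]
      exact (norm_fderiv_le_of_lipschitz ℝ hχ).trans (le_abs_self _)
    filter_upwards [ContDiffBump.ae_convolution_tendsto_right_of_locallyIntegrable (φ := φ) (K := 2)
      hrt (Eventually.of_forall fun n => by simp only [hφ]; linarith) hloc] with x hx v
    have h1 : Tendsto (fun n => inner ℝ (mol (k n) (gradient χ) x) v) atTop
        (𝓝 (inner ℝ (gradient χ x) v)) := by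
      refine Tendsto.inner ?_ tendsto_const_nhds
      simp only [mol_eq_convolution]
      exact hx
    have h2 : ∀ y, fderiv ℝ χ y v = inner ℝ (gradient χ y) v := fun y => by
      rw [gradient, InnerProductSpace.toDual_symm_apply]
    rw [h2]
    refine h1.congr fun n => ?_
    rw [(hk n).fderiv_mol_of_lipschitz hχ, mol, real_inner_comm, ← integral_inner]
    · refine integral_congr_ae (Eventually.of_forall fun w => ?_)
      simp only [h2, real_inner_smul_right, real_inner_comm]
    · exact ((hk n).hasCompactSupport.convolutionExists_left (ContinuousLinearMap.lsmul ℝ ℝ)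
        (hk n).smooth.continuous hloc x).integrable_swap

end lipschitz

/-! ### The energy equality with a Lipschitz cutoff -/

section
variable {Ω : Set R3} {T : ℝ} {u v : R3 × ℝ → R3} {p : R3 × ℝ → ℝ}

theorem IsWeakEulerSolution.aestronglyMeasurable_pressure (hΩ : IsOpen Ω)
    (h : IsWeakEulerSolution Ω T u p) :
    AEStronglyMeasurable p (volume.restrict (Ω ×ˢ Ioo 0 T)) := by
  refine LocallyIntegrableOn.aestronglyMeasurable ?_
  rw [locallyIntegrableOn_iff (hΩ.prod isOpen_Ioo).isLocallyClosed]
  exact fun K hKs hK => h.integrable_pressure K hK hKs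

/-- The energy is integrable on the whole domain: locally because `u ∈ L²_loc`, near the boundary
because `u` is bounded there. -/
theorem IsWeakEulerSolution.integrableOn_sq (hΩ : IsSmoothBoundedDomain Ω)
    (hsol : IsWeakEulerSolution Ω T u p) {Γ : Set R3} (hΓ : IsOpen Γ) (hΓΩ : frontier Ω ⊆ Γ) {C : ℝ}
    (hC : ∀ᵐ z ∂(volume.restrict ((Γ ∩ Ω) ×ˢ Ioo 0 T)), ‖u z‖ ≤ C ∧ |p z| ≤ C)
    {J : Set ℝ} (hJ : IsCompact J) (hJT : J ⊆ Ioo 0 T) :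
    IntegrableOn (fun z => ‖u z‖ ^ 2) (Ω ×ˢ J) := by
  have hKc : IsCompact (closure Ω \ Γ) :=
    (Metric.isCompact_of_isClosed_isBounded isClosed_closure hΩ.isBounded.closure).diff hΓ
  have hKΩ : closure Ω \ Γ ⊆ Ω := by
    rintro x ⟨hx, hxΓ⟩
    by_contra hxΩ
    apply hxΓ
    apply hΓΩ
    rw [hΩ.isOpen.frontier_eq]
    exact ⟨hx, hxΩ⟩
  have hsub : Ω ×ˢ J ⊆ (closure Ω \ Γ) ×ˢ J ∪ (Γ ∩ Ω) ×ˢ J := by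
    rintro z ⟨hz, hzJ⟩
    by_cases h : z.1 ∈ Γ
    · exact Or.inr ⟨⟨h, hz⟩, hzJ⟩
    · exact Or.inl ⟨⟨subset_closure hz, h⟩, hzJ⟩
  refine IntegrableOn.mono_set (IntegrableOn.union ?_ ?_) hsub
  · exact (hsol.memLp_velocity _ (hKc.prod hJ) (prod_mono hKΩ hJT)).integrable_norm_pow (by simp)
  · have hmono : (Γ ∩ Ω) ×ˢ J ⊆ (Γ ∩ Ω) ×ˢ Ioo 0 T := prod_mono subset_rfl hJT
    have hfin : IsFiniteMeasure (volume.restrict ((Γ ∩ Ω) ×ˢ J)) := ⟨by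
      rw [Measure.restrict_apply_univ]
      exact ((hΩ.isBounded.subset inter_subset_right).prod hJ.isBounded).measure_lt_top⟩
    refine Integrable.of_bound (C := C ^ 2) ?_ ?_
    · exact ((hsol.aestronglyMeasurable hΩ.isOpen).mono_set
        (prod_mono inter_subset_right hJT)).norm.pow 2
    · filter_upwards [ae_restrict_of_ae_restrict_of_subset hmono hC] with z hz
      rw [norm_pow, norm_norm]
      exact pow_le_pow_left₀ (norm_nonneg _) hz.1 2

/-- A bounded function of time supported in a compact set times the energy density is integrable. -/
theorem integrableOn_mul_sq (hsq : ∀ J : Set ℝ, IsCompact J → J ⊆ Ioo 0 T →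
      IntegrableOn (fun z => ‖u z‖ ^ 2) (Ω ×ˢ J)) (hΩ : MeasurableSet Ω)
    {ψ : ℝ → ℝ} (hψ : Continuous ψ) (hψs : HasCompactSupport ψ) (hψT : tsupport ψ ⊆ Ioo 0 T) :
    IntegrableOn (fun z => ψ z.2 * ‖u z‖ ^ 2) (Ω ×ˢ Ioo 0 T) := by
  obtain ⟨M, hM⟩ := hψs.exists_bound_of_continuous hψ
  have h1 : IntegrableOn (fun z : R3 × ℝ => ψ z.2 * ‖u z‖ ^ 2) (Ω ×ˢ tsupport ψ) :=
    Integrable.bdd_mul (c := M) (hsq _ hψs hψT) (hψ.comp continuous_snd).aestronglyMeasurable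
      (Eventually.of_forall fun z => hM _)
  refine h1.of_forall_sdiff_eq_zero (hΩ.prod measurableSet_Ioo) fun z hz => ?_
  have : z.2 ∉ tsupport ψ := fun h => hz.2 ⟨hz.1.1, h⟩
  simp [image_eq_zero_of_notMem_tsupport this]

/-- The energy equality tested with a Lipschitz cutoff in space whose gradient is supported where
the solution is bounded. -/
theorem IsWeakEulerSolution.energy_of_lipschitz_cutoff (hΩ : IsSmoothBoundedDomain Ω)
    (hsol : IsWeakEulerSolution Ω T u p) (hbesov : LocalBesovVMO Ω T u)
    {Γ : Set R3} (hΓ : IsOpen Γ) (hΓΩ : frontier Ω ⊆ Γ) {C : ℝ}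
    (hC : ∀ᵐ z ∂(volume.restrict ((Γ ∩ Ω) ×ˢ Ioo 0 T)), ‖u z‖ ≤ C ∧ |p z| ≤ C)
    {χ : R3 → ℝ} {L : NNReal} (hχ : LipschitzWith L χ) (hχs : HasCompactSupport χ)
    (hχΩ : tsupport χ ⊆ Ω) (hχΓ : tsupport (fderiv ℝ χ) ⊆ Γ)
    {ψ : ℝ → ℝ} (hψ : ContDiff ℝ ∞ ψ) (hψs : HasCompactSupport ψ) (hψT : tsupport ψ ⊆ Ioo 0 T) :
    (∫ z in Ω ×ˢ Ioo 0 T, deriv ψ z.2 * (χ z.1 * ‖u z‖ ^ 2))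
      + ∫ z in Ω ×ˢ Ioo 0 T, ψ z.2 * ((‖u z‖ ^ 2 + 2 * p z) * fderiv ℝ χ z.1 (u z)) = 0 := by
  obtain ⟨ρ₁, hρ₁, hρ₁'⟩ := hχs.isCompact.exists_cthickening_subset_open hΩ.isOpen hχΩ
  obtain ⟨ρ₂, hρ₂, hρ₂'⟩ :=
    (hχs.fderiv ℝ).isCompact.exists_cthickening_subset_open hΓ hχΓ
  set ρ := min ρ₁ ρ₂ with hρdef
  have hρ : 0 < ρ := lt_min hρ₁ hρ₂
  obtain ⟨f, hf, hfs, hfd, hfL, hfb, hft, hfdt⟩ := exists_smooth_approx hχ hχs hρ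
  have hfΩ : ∀ n, tsupport (f n) ⊆ Ω := fun n =>
    (hfs n).trans ((Metric.cthickening_mono (min_le_left _ _) _).trans hρ₁')
  have hfΓ : ∀ n, tsupport (fderiv ℝ (f n)) ⊆ Γ := fun n =>
    (hfd n).trans ((Metric.cthickening_mono (min_le_right _ _) _).trans hρ₂')
  have hfc : ∀ n, HasCompactSupport (f n) := fun n =>
    hχs.isCompact.cthickening.of_isClosed_subset (isClosed_tsupport _) (hfs n)
  have hid := fun n => hsol.energy_of_smooth_cutoff hΩ.isOpen hbesov hΓ hC (hf n) (hfc n) (hfΩ n)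
    (hfΓ n) hψ hψs hψT
  have hum := hsol.aestronglyMeasurable hΩ.isOpen
  have hpm := hsol.aestronglyMeasurable_pressure hΩ.isOpen
  have hψd : Continuous (deriv ψ) := hψ.continuous_deriv (by simp)
  have hE := integrableOn_mul_sq (fun J hJ hJT => hsol.integrableOn_sq hΩ hΓ hΓΩ hC hJ hJT)
    hΩ.isOpen.measurableSet hψd hψs.deriv (tsupport_deriv_subset.trans hψT)
  obtain ⟨B, hB⟩ := hχs.exists_bound_of_continuous hχ.continuous
  have hQfin : IsFiniteMeasure (volume.restrict (Ω ×ˢ Ioo (0 : ℝ) T)) := ⟨by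
    rw [Measure.restrict_apply_univ]
    exact (hΩ.isBounded.prod (Metric.isBounded_Ioo 0 T)).measure_lt_top⟩
  have t1 : Tendsto (fun n => ∫ z in Ω ×ˢ Ioo 0 T, deriv ψ z.2 * (f n z.1 * ‖u z‖ ^ 2)) atTop
      (𝓝 (∫ z in Ω ×ˢ Ioo 0 T, deriv ψ z.2 * (χ z.1 * ‖u z‖ ^ 2))) := by
    refine tendsto_integral_of_dominated_convergence
      (fun z => (B + L * ρ) * ‖deriv ψ z.2 * ‖u z‖ ^ 2‖) (fun n => ?_) (hE.norm.const_mul _)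
      (fun n => Eventually.of_forall fun z => ?_) (Eventually.of_forall fun z => ?_)
    · exact (hψd.comp continuous_snd).aestronglyMeasurable.mul
        (((hf n).continuous.comp continuous_fst).aestronglyMeasurable.mul (hum.norm.pow 2))
    · rw [mul_left_comm, norm_mul]
      refine mul_le_mul_of_nonneg_right ?_ (norm_nonneg _)
      have h1 := hfb n z.1
      have h2 := hB z.1
      rw [Real.norm_eq_abs] at h2 ⊢
      calc |f n z.1| = |χ z.1 + (f n z.1 - χ z.1)| := by congr 1; ring
        _ ≤ _ := (abs_add_le _ _).trans (add_le_add h2 h1)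
    · exact ((hft z.1).mul_const _).const_mul _
  have t2 : Tendsto (fun n => ∫ z in Ω ×ˢ Ioo 0 T,
        ψ z.2 * ((‖u z‖ ^ 2 + 2 * p z) * fderiv ℝ (f n) z.1 (u z))) atTop
      (𝓝 (∫ z in Ω ×ˢ Ioo 0 T, ψ z.2 * ((‖u z‖ ^ 2 + 2 * p z) * fderiv ℝ χ z.1 (u z)))) := by
    obtain ⟨M, hM⟩ := hψs.exists_bound_of_continuous hψ.continuous
    refine tendsto_integral_of_dominated_convergence
      (fun z => M * ((|C| ^ 2 + 2 * |C|) * (L * |C|))) (fun n => ?_) (integrable_const _)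
      (fun n => ?_) ?_
    · refine (hψ.continuous.comp continuous_snd).aestronglyMeasurable.mul
        (((hum.norm.pow 2).add (hpm.const_mul 2)).mul ?_)
      exact (ContinuousLinearMap.id ℝ (R3 →L[ℝ] ℝ)).aestronglyMeasurable_comp₂
        (((hf n).continuous_fderiv (by simp)).comp continuous_fst).aestronglyMeasurable hum
    · rw [ae_restrict_iff' ((hΓ.inter hΩ.isOpen).prod isOpen_Ioo).measurableSet] at hC
      rw [ae_restrict_iff' (hΩ.isOpen.prod isOpen_Ioo).measurableSet]
      filter_upwards [hC] with z hz hzQ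
      have hM0 : 0 ≤ M := (norm_nonneg _).trans (hM 0)
      by_cases hzΓ : z.1 ∈ Γ
      · obtain ⟨h1, h2⟩ := hz ⟨⟨hzΓ, hzQ.1⟩, hzQ.2⟩
        replace h1 := h1.trans (le_abs_self C)
        replace h2 := h2.trans (le_abs_self C)
        have h3 : ‖‖u z‖ ^ 2 + 2 * p z‖ ≤ |C| ^ 2 + 2 * |C| := by
          refine (norm_add_le _ _).trans (add_le_add ?_ ?_)
          · rw [norm_pow, norm_norm]
            exact pow_le_pow_left₀ (norm_nonneg _) h1 2
          · rw [norm_mul, Real.norm_ofNat]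
            exact mul_le_mul_of_nonneg_left h2 zero_le_two
        rw [norm_mul, norm_mul]
        gcongr
        · exact hM _
        · exact ((fderiv ℝ (f n) z.1).le_opNorm _).trans
            (mul_le_mul (hfL n _) h1 (norm_nonneg _) L.2)
      · have h0 : fderiv ℝ (f n) z.1 = 0 :=
          image_eq_zero_of_notMem_tsupport fun h => hzΓ (hfΓ n h)
        simp only [h0, zero_apply, mul_zero, norm_zero]
        positivity
    · have hae : ∀ᵐ z : R3 × ℝ, ∀ v,
          Tendsto (fun n => fderiv ℝ (f n) z.1 v) atTop (𝓝 (fderiv ℝ χ z.1 v)) :=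
        Measure.quasiMeasurePreserving_fst.ae hfdt
      filter_upwards [ae_restrict_of_ae hae] with z hz
      exact ((hz (u z)).const_mul _).const_mul _
  exact tendsto_nhds_unique (t1.add t2) (by simp only [hid]; exact tendsto_const_nhds)

end

/-! ### Cutoffs at the boundary and the normal flux -/

section
variable {Ω : Set R3} {T : ℝ} {u v : R3 × ℝ → R3} {p : R3 × ℝ → ℝ}

theorem IsSmoothBoundedDomain.exists_layer_subset (hΩ : IsSmoothBoundedDomain Ω) {O : Set R3}
    (hO : IsOpen O) (h : frontier Ω ⊆ O) :
    ∃ δ > 0, ∀ x ∈ Ω, Metric.infDist x Ωᶜ < δ → x ∈ O := by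
  obtain ⟨δ, hδ, hsub⟩ := hΩ.isCompact_frontier.exists_thickening_subset_open hO h
  refine ⟨δ, hδ, fun x hx hxδ => hsub ?_⟩
  obtain ⟨y, hy, hxy⟩ := hΩ.exists_mem_frontier_dist_eq hx
  exact Metric.mem_thickening_iff.2 ⟨y, hy, hxy ▸ hxδ⟩

/-- A Lipschitz cutoff which vanishes at distance at most `δ / 4` from the complement of `Ω` and
equals `1` at distance at least `δ / 2`. -/
def boundaryCutoff (Ω : Set R3) (δ : ℝ) (x : R3) : ℝ :=
  max 0 (min 1 (4 / δ * Metric.infDist x Ωᶜ - 1))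

theorem boundaryCutoff_mem_Icc (Ω : Set R3) (δ : ℝ) (x : R3) :
    boundaryCutoff Ω δ x ∈ Icc (0 : ℝ) 1 :=
  ⟨le_max_left _ _, max_le zero_le_one (min_le_left _ _)⟩

variable {δ : ℝ}

theorem boundaryCutoff_eq_zero (hδ : 0 < δ) {x : R3} (hx : Metric.infDist x Ωᶜ ≤ δ / 4) :
    boundaryCutoff Ω δ x = 0 := by
  refine max_eq_left ((min_le_right _ _).trans ?_)
  rw [div_mul_eq_mul_div, sub_nonpos, div_le_one hδ]
  linarith

theorem boundaryCutoff_eq_one (hδ : 0 < δ) {x : R3} (hx : δ / 2 ≤ Metric.infDist x Ωᶜ) :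
    boundaryCutoff Ω δ x = 1 := by
  unfold boundaryCutoff
  rw [min_eq_left, max_eq_right zero_le_one]
  rw [div_mul_eq_mul_div, le_sub_iff_add_le, le_div_iff₀ hδ]
  linarith

theorem abs_boundaryCutoff_sub_le (hδ : 0 < δ) (x y : R3) :
    |boundaryCutoff Ω δ x - boundaryCutoff Ω δ y|
      ≤ 4 / δ * |Metric.infDist x Ωᶜ - Metric.infDist y Ωᶜ| := by
  have h : ∀ a b : ℝ, |max 0 (min 1 a) - max 0 (min 1 b)| ≤ |a - b| := by
    intro a b
    rw [max_comm 0, max_comm 0, min_comm 1, min_comm 1]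
    refine (abs_max_sub_max_le_abs _ _ _).trans ((abs_min_sub_min_le_max _ _ _ _).trans ?_)
    simp
  refine (h _ _).trans (le_of_eq ?_)
  rw [sub_sub_sub_cancel_right, ← mul_sub, abs_mul, abs_of_pos (by positivity : 0 < 4 / δ)]

theorem lipschitzWith_boundaryCutoff (hδ : 0 < δ) :
    LipschitzWith (4 / δ).toNNReal (boundaryCutoff Ω δ) := by
  refine LipschitzWith.of_dist_le_mul fun x y => ?_
  rw [Real.coe_toNNReal _ (by positivity)]
  refine (abs_boundaryCutoff_sub_le hδ x y).trans (mul_le_mul_of_nonneg_left ?_ (by positivity))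
  simpa [Real.dist_eq] using (Metric.lipschitz_infDist_pt Ωᶜ).dist_le_mul x y

theorem tsupport_boundaryCutoff_subset (hδ : 0 < δ) : tsupport (boundaryCutoff Ω δ) ⊆ Ω := by
  have hcl : IsClosed {x | δ / 4 ≤ Metric.infDist x Ωᶜ} :=
    isClosed_le continuous_const (Metric.continuous_infDist_pt _)
  have h1 : tsupport (boundaryCutoff Ω δ) ⊆ {x | δ / 4 ≤ Metric.infDist x Ωᶜ} :=
    closure_minimal (fun x hx => not_lt.1 fun h => hx (boundaryCutoff_eq_zero hδ h.le)) hcl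
  intro x hx
  by_contra hxΩ
  have h2 : δ / 4 ≤ Metric.infDist x Ωᶜ := h1 hx
  rw [Metric.infDist_zero_of_mem hxΩ] at h2
  linarith

theorem IsSmoothBoundedDomain.hasCompactSupport_boundaryCutoff (hΩ : IsSmoothBoundedDomain Ω)
    (hδ : 0 < δ) : HasCompactSupport (boundaryCutoff Ω δ) :=
  Metric.isCompact_of_isClosed_isBounded (isClosed_tsupport _)
    (hΩ.isBounded.subset (tsupport_boundaryCutoff_subset hδ))

theorem tsupport_fderiv_boundaryCutoff_subset (hδ : 0 < δ) :
    tsupport (fderiv ℝ (boundaryCutoff Ω δ)) ⊆ {x ∈ Ω | Metric.infDist x Ωᶜ < δ} := by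
  have hcl : IsClosed {x | Metric.infDist x Ωᶜ ≤ δ / 2} :=
    isClosed_le (Metric.continuous_infDist_pt _) continuous_const
  have h1 : tsupport (fderiv ℝ (boundaryCutoff Ω δ)) ⊆ {x | Metric.infDist x Ωᶜ ≤ δ / 2} := by
    refine closure_minimal (fun x hx => mem_ofPred.2 (not_lt.1 fun h => hx ?_)) hcl
    have hev : boundaryCutoff Ω δ =ᶠ[𝓝 x] fun _ => 1 := by
      filter_upwards [(Metric.continuous_infDist_pt Ωᶜ).continuousAt.eventually
        (lt_mem_nhds h)] with y hy
      exact boundaryCutoff_eq_one hδ hy.le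
    rw [hev.fderiv_eq]
    simp
  intro x hx
  have h2 : Metric.infDist x Ωᶜ ≤ δ / 2 := h1 hx
  exact ⟨tsupport_boundaryCutoff_subset hδ (tsupport_fderiv_subset ℝ hx), by linarith⟩

theorem abs_fderiv_le_of_abs_sub_le {f g : R3 → ℝ} {K : ℝ}
    (h : ∀ x y, |f x - f y| ≤ K * |g x - g y|)
    {x : R3} (hf : DifferentiableAt ℝ f x) (hg : DifferentiableAt ℝ g x) (v : R3) :
    |fderiv ℝ f x v| ≤ K * |fderiv ℝ g x v| := by
  have key : ∀ {f : R3 → ℝ}, DifferentiableAt ℝ f x →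
      Tendsto (fun s : ℝ => |s⁻¹ * (f (x + s • v) - f x)|) (𝓝[≠] 0) (𝓝 |fderiv ℝ f x v|) := by
    intro f hf
    have h1 : HasDerivAt (fun s : ℝ => x + s • v) v 0 := by
      simpa using ((hasDerivAt_id (0 : ℝ)).smul_const v).const_add x
    have h2 : HasFDerivAt f (fderiv ℝ f x) (x + (0 : ℝ) • v) := by simpa using hf.hasFDerivAt
    have h3 : HasDerivAt (fun s : ℝ => f (x + s • v)) (fderiv ℝ f x v) 0 :=
      h2.comp_hasDerivAt 0 h1
    have h4 := (hasDerivAt_iff_tendsto_slope.1 h3).abs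
    simpa [slope] using h4
  refine le_of_tendsto_of_tendsto' (key hf) ((key hg).const_mul K) fun s => ?_
  rw [abs_mul, abs_mul, mul_left_comm]
  exact mul_le_mul_of_nonneg_left (h _ _) (abs_nonneg _)

theorem ae_abs_fderiv_boundaryCutoff_le (hδ : 0 < δ) :
    ∀ᵐ x, ∀ v, |fderiv ℝ (boundaryCutoff Ω δ) x v|
      ≤ 4 / δ * |fderiv ℝ (fun y => Metric.infDist y Ωᶜ) x v| := by
  filter_upwards [(lipschitzWith_boundaryCutoff (Ω := Ω) hδ).ae_differentiableAt,
    (Metric.lipschitz_infDist_pt Ωᶜ).ae_differentiableAt] with x h1 h2 v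
  exact abs_fderiv_le_of_abs_sub_le (abs_boundaryCutoff_sub_le hδ) h1 h2 v

theorem measurableSet_layer (hΩ : IsOpen Ω) (δ : ℝ) :
    MeasurableSet {x ∈ Ω | Metric.infDist x Ωᶜ < δ} :=
  (hΩ.inter (isOpen_lt (Metric.continuous_infDist_pt _) continuous_const)).measurableSet

theorem ae_ae_of_ae_prod_swap {A : Set R3} {B : Set ℝ} {q : R3 × ℝ → Prop}
    (h : ∀ᵐ z ∂(volume.restrict (A ×ˢ B)), q z) :
    ∀ᵐ t ∂(volume.restrict B), ∀ᵐ x ∂(volume.restrict A), q (x, t) := by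
  rw [Measure.volume_eq_prod, ← Measure.prod_restrict] at h
  exact Measure.ae_ae_of_ae_prod
    ((Measure.measurePreserving_swap (μ := volume.restrict B)
      (ν := volume.restrict A)).quasiMeasurePreserving.ae h)

/-- The mean normal flux through the layer of width `δ` along the boundary tends to zero: at almost
every time the normal component is uniformly small in thin layers, and at all times it is
bounded. -/
theorem tendsto_normal_flux (hΩ : IsSmoothBoundedDomain Ω) (hvm : Measurable v)
    (huv : u =ᵐ[volume.restrict (Ω ×ˢ Ioo 0 T)] v)
    {Γ : Set R3} (hΓ : IsOpen Γ) (hΓΩ : frontier Ω ⊆ Γ) {C : ℝ}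
    (hC : ∀ᵐ z ∂(volume.restrict ((Γ ∩ Ω) ×ˢ Ioo 0 T)), ‖u z‖ ≤ C ∧ |p z| ≤ C)
    (hnormal : NormalComponentContinuousAndZero Ω T u) :
    Tendsto (fun δ : ℝ => ENNReal.ofReal (4 / δ) *
      ∫⁻ z in {x ∈ Ω | Metric.infDist x Ωᶜ < δ} ×ˢ Ioo 0 T,
        ‖fderiv ℝ (fun y => Metric.infDist y Ωᶜ) z.1 (v z)‖ₑ) (𝓝[>] 0) (𝓝 0) := by
  set d : R3 → ℝ := fun y => Metric.infDist y Ωᶜ with hd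
  set F : R3 × ℝ → ENNReal := fun z => ‖fderiv ℝ d z.1 (v z)‖ₑ with hF
  have hdL : LipschitzWith 1 d := Metric.lipschitz_infDist_pt Ωᶜ
  have hFm : Measurable F := by
    have h1 : Measurable fun z : R3 × ℝ => fderiv ℝ d z.1 :=
      (measurable_fderiv ℝ d).comp measurable_fst
    exact (ContinuousLinearMap.measurable_apply₂.comp (h1.prodMk hvm)).enorm
  obtain ⟨δ₀, hδ₀, K, hK, hvol⟩ := hΩ.exists_volume_layer_le
  obtain ⟨δ₁, hδ₁, hΓδ⟩ := hΩ.exists_layer_subset hΓ hΓΩ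
  -- a pointwise bound in the layer bounds the mean over the layer
  have hmean : ∀ δ t c, 0 < δ → δ < δ₀ → 0 ≤ c →
      (∀ᵐ x ∂(volume.restrict {x ∈ Ω | d x < δ}), F (x, t) ≤ ENNReal.ofReal c) →
      ENNReal.ofReal (4 / δ) * ∫⁻ x in {x ∈ Ω | d x < δ}, F (x, t)
        ≤ ENNReal.ofReal (4 * K * c) := by
    intro δ t c hδ hδδ hc h
    calc ENNReal.ofReal (4 / δ) * ∫⁻ x in {x ∈ Ω | d x < δ}, F (x, t)
        ≤ ENNReal.ofReal (4 / δ) * (ENNReal.ofReal c * ENNReal.ofReal (K * δ)) := by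
          gcongr
          refine (lintegral_mono_ae h).trans ?_
          rw [lintegral_const, Measure.restrict_apply_univ]
          gcongr
          exact hvol δ hδ hδδ
      _ = ENNReal.ofReal (4 * K * c) := by
          rw [← ENNReal.ofReal_mul hc, ← ENNReal.ofReal_mul (by positivity)]
          congr 1
          field_simp
  have hfub : ∀ δ : ℝ, ENNReal.ofReal (4 / δ) * ∫⁻ z in {x ∈ Ω | d x < δ} ×ˢ Ioo 0 T, F z
      = ∫⁻ t in Ioo 0 T, ENNReal.ofReal (4 / δ) * ∫⁻ x in {x ∈ Ω | d x < δ}, F (x, t) := by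
    intro δ
    rw [Measure.volume_eq_prod, ← Measure.prod_restrict, lintegral_prod_symm _ hFm.aemeasurable,
      lintegral_const_mul _ hFm.lintegral_prod_left']
  change Tendsto (fun δ : ℝ => ENNReal.ofReal (4 / δ)
    * ∫⁻ z in {x ∈ Ω | d x < δ} ×ˢ Ioo 0 T, F z) (𝓝[>] 0) (𝓝 0)
  rw [funext hfub]
  have hdata : ∀ᵐ t ∂(volume.restrict (Ioo 0 T)), ∀ᵐ x ∂(volume.restrict Ω),
      v (x, t) = u (x, t) ∧ (x ∈ Γ → ‖u (x, t)‖ ≤ |C|) := by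
    rw [ae_restrict_iff' ((hΓ.inter hΩ.isOpen).prod isOpen_Ioo).measurableSet] at hC
    have hQ : MeasurableSet (Ω ×ˢ Ioo (0 : ℝ) T) := (hΩ.isOpen.prod isOpen_Ioo).measurableSet
    refine ae_ae_of_ae_prod_swap (q := fun z => v z = u z ∧ (z.1 ∈ Γ → ‖u z‖ ≤ |C|)) ?_
    filter_upwards [huv, ae_restrict_of_ae hC, ae_restrict_mem hQ] with z h1 h2 h3
    exact ⟨h1.symm, fun h => (h2 ⟨⟨h, h3.1⟩, h3.2⟩).1.trans (le_abs_self C)⟩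
  have hlayer : ∀ δ, {x ∈ Ω | d x < δ} ⊆ Ω := fun δ x hx => hx.1
  rw [← lintegral_zero (μ := volume.restrict (Ioo (0 : ℝ) T))]
  refine tendsto_lintegral_filter_of_dominated_convergence
    (fun _ => ENNReal.ofReal (4 * K * |C|)) (Eventually.of_forall fun δ =>
      (hFm.lintegral_prod_left').const_mul _) ?_ ?_ ?_
  · filter_upwards [self_mem_nhdsWithin, eventually_nhdsWithin_of_eventually_nhds
      (gt_mem_nhds (lt_min hδ₀ hδ₁))] with δ hδ hδδ
    filter_upwards [hdata] with t ht
    refine hmean δ t |C| hδ (hδδ.trans_le (min_le_left _ _)) (abs_nonneg C) ?_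
    filter_upwards [ae_restrict_of_ae_restrict_of_subset (hlayer δ) ht,
      ae_restrict_mem (measurableSet_layer hΩ.isOpen δ)] with x hx hxδ
    have h1 : ‖v (x, t)‖ ≤ |C| := by
      rw [hx.1]
      exact hx.2 (hΓδ x hxδ.1 (hxδ.2.trans (hδδ.trans_le (min_le_right _ _))))
    change ‖fderiv ℝ d x (v (x, t))‖ₑ ≤ _
    rw [← ofReal_norm]
    refine ENNReal.ofReal_le_ofReal (((fderiv ℝ d x).le_opNorm _).trans ?_)
    have h2 : ‖fderiv ℝ d x‖ ≤ 1 := by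
      simpa using norm_fderiv_le_of_lipschitz ℝ hdL (x₀ := x)
    exact (mul_le_of_le_one_left (norm_nonneg _) h2).trans h1
  · rw [lintegral_const]
    exact ENNReal.mul_ne_top ENNReal.ofReal_ne_top (by simp)
  · filter_upwards [hdata, hnormal] with t ht ⟨Γ', hΓ', hΓ'Ω, g, hg, hgc, hg0⟩
    rw [ENNReal.tendsto_nhds_zero]
    intro ε hε
    obtain ⟨c, hc, hcε⟩ : ∃ c : ℝ, 0 < c ∧ ENNReal.ofReal (4 * K * c) ≤ ε := by
      have h1 : Tendsto (fun c : ℝ => ENNReal.ofReal (4 * K * c)) (𝓝[>] 0) (𝓝 0) := by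
        have : Continuous fun c : ℝ => ENNReal.ofReal (4 * K * c) :=
          ENNReal.continuous_ofReal.comp (by fun_prop)
        simpa using (this.tendsto 0).mono_left nhdsWithin_le_nhds
      obtain ⟨c, hc, hc'⟩ := ((h1.eventually (eventually_le_nhds hε)).and
        self_mem_nhdsWithin).exists
      exact ⟨c, hc', hc⟩
    -- the normal component is below `c` in a thin layer
    obtain ⟨O, hO, hOg⟩ := (continuousOn_iff'.1 hgc) (Metric.ball 0 c) Metric.isOpen_ball
    have hfO : frontier Ω ⊆ O ∩ Γ' := by
      intro x hx
      have : x ∈ g ⁻¹' Metric.ball 0 c ∩ (Γ' ∩ closure Ω) :=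
        ⟨by simp [hg0 x hx, hc], hΓ'Ω hx, frontier_subset_closure hx⟩
      rw [hOg] at this
      exact ⟨this.1, this.2.1⟩
    obtain ⟨δ₂, hδ₂, hOδ⟩ := hΩ.exists_layer_subset (hO.inter hΓ') hfO
    filter_upwards [self_mem_nhdsWithin, eventually_nhdsWithin_of_eventually_nhds
      (gt_mem_nhds (lt_min hδ₀ hδ₂))] with δ hδ hδδ
    refine (hmean δ t c hδ (hδδ.trans_le (min_le_left _ _)) hc.le ?_).trans hcε
    rw [ae_restrict_iff' (hΓ'.inter hΩ.isOpen).measurableSet] at hg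
    filter_upwards [ae_restrict_of_ae_restrict_of_subset (hlayer δ) ht, ae_restrict_of_ae hg,
      ae_restrict_of_ae hdL.ae_differentiableAt,
      ae_restrict_mem (measurableSet_layer hΩ.isOpen δ)] with x hx hgx hdx hxδ
    have hxO := hOδ x hxδ.1 (hxδ.2.trans (hδδ.trans_le (min_le_right _ _)))
    have h1 : x ∈ g ⁻¹' Metric.ball 0 c ∩ (Γ' ∩ closure Ω) := by
      rw [hOg]
      exact ⟨hxO.1, hxO.2, subset_closure hxδ.1⟩
    have h2 : ‖g x‖ < c := by simpa using h1.1
    change ‖fderiv ℝ d x (v (x, t))‖ₑ ≤ _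
    rw [← ofReal_norm]
    refine ENNReal.ofReal_le_ofReal ?_
    rw [hΩ.fderiv_infDist hxδ.1 hdx, norm_neg, hx.1, ← hgx ⟨hxO.2, hxδ.1⟩]
    exact h2.le

end

/-! ### The global energy equality -/

section
variable {Ω : Set R3} {T : ℝ} {u : R3 × ℝ → R3} {p : R3 × ℝ → ℝ}

/-- The boundary term of the energy equality tested with `boundaryCutoff Ω δ` vanishes as `δ → 0`,
since it is controlled by the mean normal flux through a boundary layer. -/
theorem IsWeakEulerSolution.tendsto_boundary_term (hΩ : IsSmoothBoundedDomain Ω)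
    (hsol : IsWeakEulerSolution Ω T u p)
    {Γ : Set R3} (hΓ : IsOpen Γ) (hΓΩ : frontier Ω ⊆ Γ) {C : ℝ}
    (hC : ∀ᵐ z ∂(volume.restrict ((Γ ∩ Ω) ×ˢ Ioo 0 T)), ‖u z‖ ≤ C ∧ |p z| ≤ C)
    (hnormal : NormalComponentContinuousAndZero Ω T u)
    {ψ : ℝ → ℝ} {M : ℝ} (hM : ∀ t, |ψ t| ≤ M) :
    Tendsto (fun δ : ℝ => ∫ z in Ω ×ˢ Ioo 0 T, ψ z.2 *
      ((‖u z‖ ^ 2 + 2 * p z) * fderiv ℝ (boundaryCutoff Ω δ) z.1 (u z))) (𝓝[>] 0) (𝓝 0) := by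
  obtain ⟨v, hvm, huv⟩ : ∃ v, Measurable v ∧ u =ᵐ[volume.restrict (Ω ×ˢ Ioo 0 T)] v := by
    have := hsol.aestronglyMeasurable hΩ.isOpen
    exact ⟨this.mk u, this.stronglyMeasurable_mk.measurable, this.ae_eq_mk⟩
  have hflux := tendsto_normal_flux hΩ hvm huv hΓ hΓΩ hC hnormal
  obtain ⟨δ₁, hδ₁, hΓδ⟩ := hΩ.exists_layer_subset hΓ hΓΩ
  have hM0 : 0 ≤ M := (abs_nonneg _).trans (hM 0)
  set B := M * (|C| ^ 2 + 2 * |C|) with hB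
  have hB0 : 0 ≤ B := by positivity
  have hlim := ENNReal.Tendsto.const_mul (a := ENNReal.ofReal B) hflux
    (Or.inr ENNReal.ofReal_ne_top)
  rw [mul_zero] at hlim
  rw [tendsto_zero_iff_enorm_tendsto_zero]
  refine tendsto_of_tendsto_of_tendsto_of_le_of_le' tendsto_const_nhds hlim
    (Eventually.of_forall fun _ => zero_le) ?_
  filter_upwards [self_mem_nhdsWithin, eventually_nhdsWithin_of_eventually_nhds
    (gt_mem_nhds hδ₁)] with δ hδ hδδ
  have hδ' : (0 : ℝ) < δ := hδ
  set d : R3 → ℝ := fun y => Metric.infDist y Ωᶜ with hd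
  have hlm : MeasurableSet ({x ∈ Ω | d x < δ} ×ˢ Ioo 0 T) :=
    (measurableSet_layer hΩ.isOpen δ).prod measurableSet_Ioo
  have hQ : MeasurableSet (Ω ×ˢ Ioo (0 : ℝ) T) := (hΩ.isOpen.prod isOpen_Ioo).measurableSet
  have hsub : {x ∈ Ω | d x < δ} ×ˢ Ioo 0 T ⊆ Ω ×ˢ Ioo 0 T := prod_mono (fun x hx => hx.1) subset_rfl
  have hcut : ∀ᵐ z : R3 × ℝ, ∀ w, |fderiv ℝ (boundaryCutoff Ω δ) z.1 w|
      ≤ 4 / δ * |fderiv ℝ d z.1 w| :=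
    Measure.quasiMeasurePreserving_fst.ae (ae_abs_fderiv_boundaryCutoff_le hδ')
  rw [ae_restrict_iff' ((hΓ.inter hΩ.isOpen).prod isOpen_Ioo).measurableSet] at hC
  calc ‖∫ z in Ω ×ˢ Ioo 0 T, ψ z.2 *
        ((‖u z‖ ^ 2 + 2 * p z) * fderiv ℝ (boundaryCutoff Ω δ) z.1 (u z))‖ₑ
      ≤ ∫⁻ z in Ω ×ˢ Ioo 0 T, ‖ψ z.2 *
        ((‖u z‖ ^ 2 + 2 * p z) * fderiv ℝ (boundaryCutoff Ω δ) z.1 (u z))‖ₑ :=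
        enorm_integral_le_lintegral_enorm _
    _ = ∫⁻ z in {x ∈ Ω | d x < δ} ×ˢ Ioo 0 T, ‖ψ z.2 *
        ((‖u z‖ ^ 2 + 2 * p z) * fderiv ℝ (boundaryCutoff Ω δ) z.1 (u z))‖ₑ := by
        rw [← lintegral_indicator hQ, ← lintegral_indicator hlm]
        refine lintegral_congr fun z => ?_
        by_cases hz : z ∈ {x ∈ Ω | d x < δ} ×ˢ Ioo 0 T
        · rw [indicator_of_mem hz, indicator_of_mem (hsub hz)]
        · rw [indicator_of_notMem hz]
          refine indicator_apply_eq_zero.2 fun hzQ => ?_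
          have h0 : fderiv ℝ (boundaryCutoff Ω δ) z.1 = 0 :=
            image_eq_zero_of_notMem_tsupport fun h =>
              hz ⟨tsupport_fderiv_boundaryCutoff_subset hδ' h, hzQ.2⟩
          simp [h0]
    _ ≤ ∫⁻ z in {x ∈ Ω | d x < δ} ×ˢ Ioo 0 T,
        ENNReal.ofReal B * (ENNReal.ofReal (4 / δ) * ‖fderiv ℝ d z.1 (v z)‖ₑ) := by
        refine lintegral_mono_ae ?_
        filter_upwards [ae_restrict_of_ae_restrict_of_subset hsub huv, ae_restrict_of_ae hcut,
          ae_restrict_of_ae hC, ae_restrict_mem hlm] with z h1 h2 h3 h4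
        obtain ⟨h5, h6⟩ := h3 ⟨⟨hΓδ z.1 h4.1.1 (h4.1.2.trans hδδ), h4.1.1⟩, h4.2⟩
        replace h5 := h5.trans (le_abs_self C)
        replace h6 := h6.trans (le_abs_self C)
        have h7 : ‖‖u z‖ ^ 2 + 2 * p z‖ ≤ |C| ^ 2 + 2 * |C| := by
          refine (norm_add_le _ _).trans (add_le_add ?_ ?_)
          · rw [norm_pow, norm_norm]
            exact pow_le_pow_left₀ (norm_nonneg _) h5 2
          · rw [norm_mul, Real.norm_ofNat]
            exact mul_le_mul_of_nonneg_left h6 zero_le_two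
        rw [← ofReal_norm, ← ofReal_norm, ← ENNReal.ofReal_mul (by positivity),
          ← ENNReal.ofReal_mul hB0]
        refine ENNReal.ofReal_le_ofReal ?_
        rw [norm_mul, norm_mul, ← mul_assoc, ← h1]
        exact mul_le_mul (mul_le_mul (hM _) h7 (norm_nonneg _) hM0) (h2 _) (norm_nonneg _) hB0
    _ = ENNReal.ofReal B * (ENNReal.ofReal (4 / δ)
        * ∫⁻ z in {x ∈ Ω | d x < δ} ×ˢ Ioo 0 T, ‖fderiv ℝ d z.1 (v z)‖ₑ) := by
        rw [lintegral_const_mul' _ _ ENNReal.ofReal_ne_top,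
          lintegral_const_mul' _ _ ENNReal.ofReal_ne_top]

end
end EulerBdry
end

theorem theorem4p3 (Ω : Set EulerBdry.R3) (hΩ : EulerBdry.IsSmoothBoundedDomain Ω)
    (T : ℝ) (hT : 0 < T)
    (u : EulerBdry.R3 × ℝ → EulerBdry.R3) (p : EulerBdry.R3 × ℝ → ℝ)
    (hsol : EulerBdry.IsWeakEulerSolution Ω T u p)
    (hbesov : EulerBdry.LocalBesovVMO Ω T u)
    (hbdd : EulerBdry.BoundedNearBoundary Ω T u p)
    (hnormal : EulerBdry.NormalComponentContinuousAndZero Ω T u) :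
    EulerBdry.GlobalEnergyEquality Ω T u := by
  obtain ⟨Γ, hΓ, hΓΩ, C, hC⟩ := hbdd
  have hsq : ∀ J : Set ℝ, IsCompact J → J ⊆ Ioo 0 T →
      IntegrableOn (fun z => ‖u z‖ ^ 2) (Ω ×ˢ J) := fun J hJ hJT =>
    hsol.integrableOn_sq hΩ hΓ hΓΩ hC hJ hJT
  refine ⟨hsq, fun ψ hψ hψs hψT => ?_⟩
  have hψd : Continuous (deriv ψ) := hψ.continuous_deriv (by simp)
  have hE := EulerBdry.integrableOn_mul_sq hsq hΩ.isOpen.measurableSet hψd hψs.deriv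
    (tsupport_deriv_subset.trans hψT)
  obtain ⟨M, hM⟩ := hψs.exists_bound_of_continuous hψ.continuous
  obtain ⟨δ₁, hδ₁, hΓδ⟩ := hΩ.exists_layer_subset hΓ hΓΩ
  -- the interior term, as the cutoff exhausts the domain
  have h1 : Tendsto (fun δ : ℝ => ∫ z in Ω ×ˢ Ioo 0 T,
      deriv ψ z.2 * (EulerBdry.boundaryCutoff Ω δ z.1 * ‖u z‖ ^ 2)) (𝓝[>] 0)
      (𝓝 (∫ z in Ω ×ˢ Ioo 0 T, deriv ψ z.2 * ‖u z‖ ^ 2)) := by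
    refine tendsto_integral_filter_of_dominated_convergence
      (fun z => ‖deriv ψ z.2 * ‖u z‖ ^ 2‖) ?_ (Eventually.of_forall fun δ =>
        Eventually.of_forall fun z => ?_) hE.norm ?_
    · filter_upwards [self_mem_nhdsWithin] with δ hδ
      simp only [mul_left_comm (deriv ψ _)]
      exact ((EulerBdry.lipschitzWith_boundaryCutoff hδ).continuous.comp
        continuous_fst).aestronglyMeasurable.mul hE.1
    · rw [mul_left_comm, norm_mul]
      have h := EulerBdry.boundaryCutoff_mem_Icc Ω δ z.1
      refine mul_le_of_le_one_left (norm_nonneg _) ?_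
      rw [Real.norm_of_nonneg h.1]
      exact h.2
    · filter_upwards [ae_restrict_mem (hΩ.isOpen.prod isOpen_Ioo).measurableSet] with z hz
      refine tendsto_const_nhds.congr' ?_
      have hpos : 0 < Metric.infDist z.1 Ωᶜ := hΩ.infDist_pos hz.1
      filter_upwards [self_mem_nhdsWithin, eventually_nhdsWithin_of_eventually_nhds
        (gt_mem_nhds hpos)] with δ hδ hδd
      have hδ' : (0 : ℝ) < δ := hδ
      rw [EulerBdry.boundaryCutoff_eq_one hδ' (by linarith), one_mul]
  have h2 := hsol.tendsto_boundary_term hΩ hΓ hΓΩ hC hnormal hM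
  have h3 : ∫ z in Ω ×ˢ Ioo 0 T, deriv ψ z.2 * ‖u z‖ ^ 2 = 0 := by
    have h4 := h1.add h2
    rw [add_zero] at h4
    refine tendsto_nhds_unique_of_eventuallyEq h4 tendsto_const_nhds ?_
    filter_upwards [self_mem_nhdsWithin, eventually_nhdsWithin_of_eventually_nhds
      (gt_mem_nhds hδ₁)] with δ hδ hδδ
    refine hsol.energy_of_lipschitz_cutoff hΩ hbesov hΓ hΓΩ hC
      (EulerBdry.lipschitzWith_boundaryCutoff hδ) (hΩ.hasCompactSupport_boundaryCutoff hδ)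
      (EulerBdry.tsupport_boundaryCutoff_subset hδ) (fun x hx => ?_) hψ hψs hψT
    have := EulerBdry.tsupport_fderiv_boundaryCutoff_subset hδ hx
    exact hΓδ x this.1 (this.2.trans hδδ)
  refine Eq.trans ?_ h3
  rw [Measure.volume_eq_prod, ← Measure.prod_restrict, integral_prod_symm]
  · simp only [integral_const_mul]
  · rw [Measure.prod_restrict, ← Measure.volume_eq_prod]
    exact hE
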